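/- Let $|\mathfrak a|<\mathfrak m$ and let $g_b$ be the Kerr metric of signature $(+,-,-,-)$ in Boyer–Lindquist coordinates $(t,r,\theta,\varphi)$, with $\Delta=r^2-2\mathfrak m r+\mathfrak a^2$ and $\Sigma=r^2+\mathfrak a^2\cos^2\theta$. For large $r$ put $x=r(\sin\theta\cos\varphi,\sin\theta\sin\varphi,\cos\theta)$ and $dt_*=dt-\frac{r^2+\mathfrak a^2}{\Delta}dr$. Let $p=r-i\mathfrak a\cos\theta$, let $$\ell=\tfrac{r^2+\mathfrak a^2}{\Delta}\partial_t+\partial_r+\tfrac{\mathfrak a}{\Delta}\partial_\varphi,\quad n=\tfrac{1}{2\Sigma}\big((r^2+\mathfrak a^2)\partial_t-\Delta\partial_r+\mathfrak a\partial_\varphi\big),\quad m=\tfrac{1}{\sqrt2\,\bar p}\big(i\mathfrak a\sin\theta\,\partial_t+\partial_\theta+\tfrac{i}{\sin\theta}\partial_\varphi\big)$$ be the Kinnersley tetrad, with associated spin dyad $(o,\iota)$, i.e. $\ell=o\bar o$, $n=\iota\bar\iota$, $m=o\bar\iota$, and let $$\varrho=m^a\bar m^b\nabla_b\ell_a,\quad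 \varrho'=\bar m^am^b\nabla_bn_a,\quad \tau=m^an^b\nabla_b\ell_a,\quad \tau'=\bar m^a\ell^b\nabla_bn_a,\quad \Psi_0=W_{abcd}\ell^am^b\bar m^cn^d,$$ where $W$ is the Weyl tensor of $g_b$ (curvature sign such that $\Psi_0=-\mathfrak m/p^3$). For a symmetric two-tensor $h$ let $\vartheta\Psi_1,\vartheta\Psi_0,\vartheta\Psi_{-1}$ be the components along $ooo\iota$, $oo\iota\iota$, $o\iota\iota\iota$ of $$\vartheta\Psi_{ABCD}=\tfrac12\nabla_{(A}{}^{A'}\nabla_B{}^{B'}h^{\rm tf}_{CD)A'B'}\pm\tfrac14(\mathrm{tr}_{g_b}h)\Psi_{ABCD},$$ where $h^{\rm tf}$ is the trace-free part of $h$ and $\Psi_{ABCD}$ is the Weyl spinor of $g_b$. Everything below holds for either choice of the sign. With $p_\pm=p\pm\bar p$, $h_{\ell n}=h(\ell,n)$ etc., and $X(u)$ the derivative of a scalar $u$ along a vector field $X$, put $$\begin{aligned}\mathbb I_\zeta[h]={}&\tfrac14p\big(p_-^2(\varrho'\ell+\varrho n)-p_+^2(\tau'm+\tau\bar m)\big)(p^4\vartheta\Psi_0)\\&+\tfrac14\Re\Big(p^5\vartheta\Psi_0\big(\Psi_0(p^2+\bar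 p^2)-2\bar\Psi_0\bar p^2-4p(p_-\varrho\varrho'-p_+\tau\tau')\big)\Big)\\&+2i\,\Im\big(p^6\bar p(\vartheta\Psi_{-1}\varrho\tau+\vartheta\Psi_1\varrho'\tau')\big)\\&-\tfrac38\Psi_0p^5\Big(p_-^2(h_{nn}\varrho^2+2h_{\ell n}\varrho\varrho'+h_{\ell\ell}\varrho'^2)\\&\qquad-2(p^2+\bar p^2)(h_{n\bar m}\varrho\tau+h_{\ell\bar m}\varrho'\tau+h_{nm}\varrho\tau'+h_{\ell m}\varrho'\tau')+p_+^2(h_{\bar m\bar m}\tau^2+2h_{m\bar m}\tau\tau'+h_{mm}\tau'^2)\Big).\end{aligned}$$ Real stationary symmetric two-tensors are described by their coefficients with respect to $dt_*,dx^1,dx^2,dx^3$, as functions of $x$. For such tensors, $h=\mathcal O(r^{-q})$ means that the coefficients are $C^3$ for large $r$ and that their derivatives of order $k\le 3$ in $x$ are $O(r^{-q-k})$ as $r\to\infty$. Bounds on $\mathbb I_\zeta$ are meant as $r\to\infty$, uniformly in all other variables. 1. Let $g_0$ be a smooth symmetric two-tensor on the sphere at infinity, i.e. a symmetric matrix of smooth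 functions on $S^2$, read as coefficients with respect to $dt_*,dx^i$, and let $h=g_0/r$. Then $\mathbb I_\zeta[h]=O(r)$. If moreover $h$ is the leading part of a linearized vacuum perturbation, i.e. if for some $\delta>0$ there is a stationary symmetric two-tensor $k=\mathcal O(r^{-1-\delta})$ with $D_{g_b}\mathrm{Ric}(h+k)=0$ for large $r$ (for example if $D_{g_b}\mathrm{Ric}(h)=0$), then $\Re\,\mathbb I_\zeta[h]=O(1)$. 2. If $\epsilon>0$ and $h$ is a stationary symmetric two-tensor with $h=\mathcal O(r^{-1-\epsilon})$, then $\mathbb I_\zeta[h]=O(r^{1-\epsilon})$. -/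

import Mathlib

open Filter Asymptotics Topology
open scoped Manifold ContDiff ComplexConjugate

noncomputable section

namespace KerrDecay

/-! ### Tensor calculus in a coordinate chart

Coordinates are `Fin 4 → ℝ`.  A covariant tensor field of rank `n` is given by its components. -/

/-- Coordinate points `(t_*, x¹, x², x³)`. -/
abbrev Pt := Fin 4 → ℝ

/-- Components of a (complex) covariant tensor field of rank `n`. -/
abbrev Tensor (n : ℕ) := Pt → (Fin n → Fin 4) → ℂ

/-- Components of a (complex) vector field. -/
abbrev VecField := Pt → Fin 4 → ℂ

/-- Components of a (real) field of bilinear forms. -/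
abbrev Bilin := Pt → Matrix (Fin 4) (Fin 4) ℝ

/-- The partial derivative `∂_μ f`. -/
def pd {E : Type*} [NormedAddCommGroup E] [NormedSpace ℝ E] (μ : Fin 4) (f : Pt → E) (p : Pt) : E :=
  fderiv ℝ f p (Pi.single μ 1)

/-- Christoffel symbols `Γ^c_{ab}` of the Levi-Civita connection of `g`. -/
def christoffel (g : Bilin) (c a b : Fin 4) (p : Pt) : ℝ :=
  (1 / 2) * ∑ d, (g p)⁻¹ c d *
    (pd a (fun q => g q d b) p + pd b (fun q => g q d a) p - pd d (fun q => g q a b) p)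

/-- Covariant derivative of a covariant tensor; the differentiation index comes first:
`(covD g T)_{a b₁ … bₙ} = ∇_a T_{b₁ … bₙ}`. -/
def covD (g : Bilin) {n : ℕ} (T : Tensor n) : Tensor (n + 1) := fun p i =>
  pd (i 0) (fun q => T q (Fin.tail i)) p
    - ∑ j : Fin n, ∑ c : Fin 4,
        (christoffel g c (i 0) (Fin.tail i j) p : ℂ) * T p (Function.update (Fin.tail i) j c)

/-- Contraction `T_{b₁ … bₙ} v₁^{b₁} ⋯ vₙ^{bₙ}`. -/
def contr {n : ℕ} (T : Tensor n) (v : Fin n → VecField) (p : Pt) : ℂ :=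
  ∑ i : Fin n → Fin 4, T p i * ∏ j, v j p (i j)

/-- A bilinear form as a tensor of rank two. -/
def toTensor (h : Bilin) : Tensor 2 := fun p i => (h p (i 0) (i 1) : ℂ)

/-- The one-form `v_a = g_{ab} v^b`. -/
def lower (g : Bilin) (v : VecField) : Tensor 1 := fun p i => ∑ b, (g p (i 0) b : ℂ) * v p b

/-- Derivative `v^a ∂_a f` of a scalar. -/
def dirD (v : VecField) (f : Pt → ℂ) (p : Pt) : ℂ := ∑ a, v p a * pd a f p

/-- The trace `g^{ab} h_{ab}`. -/
def tr (g h : Bilin) (p : Pt) : ℝ := ∑ a, ∑ b, (g p)⁻¹ a b * h p a b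

/-- The trace-free part of `h`. -/
def traceFree (g h : Bilin) : Bilin := fun p => h p - (tr g h p / 4) • g p

/-- Curvature tensor with all indices down, `R_{abcd}`, with the sign convention
`(∇_a ∇_b - ∇_b ∇_a) V^d = R_{abc}{}^d V^c`. -/
def riem (g : Bilin) (p : Pt) (a b c d : Fin 4) : ℝ :=
  - ∑ k, g p a k *
    (pd c (christoffel g k b d) p - pd d (christoffel g k b c) p
      + ∑ e, (christoffel g k c e p * christoffel g e b d p
        - christoffel g k d e p * christoffel g e b c p))

/-- The contraction `g^{ac} R_{abcd}`. -/
def ric (g : Bilin) (p : Pt) (b d : Fin 4) : ℝ := ∑ a, ∑ c, (g p)⁻¹ a c * riem g p a b c d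

/-- The contraction `g^{bd} g^{ac} R_{abcd}`. -/
def scal (g : Bilin) (p : Pt) : ℝ := ∑ b, ∑ d, (g p)⁻¹ b d * ric g p b d

/-- The Weyl tensor `W_{abcd}` (in four dimensions). -/
def weyl (g : Bilin) : Tensor 4 := fun p i =>
  let a := i 0; let b := i 1; let c := i 2; let d := i 3
  ((riem g p a b c d
    - (1 / 2) * (g p a c * ric g p b d - g p a d * ric g p b c
        - g p b c * ric g p a d + g p b d * ric g p a c)
    + (scal g p / 6) * (g p a c * g p b d - g p a d * g p b c) : ℝ) : ℂ)

/-- The linearized Ricci tensor `D_g Ric(h)`: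
`½ g^{cd} (∇_c ∇_a h_{bd} + ∇_c ∇_b h_{ad} - ∇_c ∇_d h_{ab} - ∇_a ∇_b h_{cd})`. -/
def linRicci (g h : Bilin) (p : Pt) (a b : Fin 4) : ℂ :=
  let K := covD g (covD g (toTensor h))
  (1 / 2) * ∑ c, ∑ d, (((g p)⁻¹ c d : ℝ) : ℂ) *
    (K p ![c, a, b, d] + K p ![c, b, a, d] - K p ![c, d, a, b] - K p ![a, b, c, d])

/-! ### The Kerr metric

`x = r (sin θ cos φ, sin θ sin φ, cos θ)` with `r, θ, φ` the Boyer-Lindquist coordinates, and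
`dt_* = dt - (r² + a²)/Δ dr`.  All formulas below are used for large `r`, away from the axis
`x¹ = x² = 0` of the Boyer-Lindquist coordinates. -/

def rad (p : Pt) : ℝ := √(p 1 ^ 2 + p 2 ^ 2 + p 3 ^ 2)
def cyl (p : Pt) : ℝ := √(p 1 ^ 2 + p 2 ^ 2)
def cosθ (p : Pt) : ℝ := p 3 / rad p
def sinθ (p : Pt) : ℝ := cyl p / rad p

/-- `Δ = r² - 2 M r + a²`. -/
def Del (M a : ℝ) (p : Pt) : ℝ := rad p ^ 2 - 2 * M * rad p + a ^ 2

/-- `Σ = r² + a² cos² θ`. -/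
def Sig (a : ℝ) (p : Pt) : ℝ := rad p ^ 2 + a ^ 2 * cosθ p ^ 2

/-- The one-form `dr`. -/
def dr (p : Pt) : Fin 4 → ℝ := ![0, p 1 / rad p, p 2 / rad p, p 3 / rad p]

/-- The one-form `dθ`, from `dz = cos θ dr - r sin θ dθ`. -/
def dθ (p : Pt) : Fin 4 → ℝ := (cyl p)⁻¹ • (cosθ p • dr p - ![0, 0, 0, 1])

/-- The one-form `dφ`. -/
def dφ (p : Pt) : Fin 4 → ℝ := (cyl p ^ 2)⁻¹ • ![0, - p 2, p 1, 0]

/-- The one-form `dt = dt_* + (r² + a²)/Δ dr`. -/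
def dt (M a : ℝ) (p : Pt) : Fin 4 → ℝ :=
  ![1, 0, 0, 0] + ((rad p ^ 2 + a ^ 2) / Del M a p) • dr p

/-- The square `α ⊗ α` of a one-form. -/
def sq (α : Fin 4 → ℝ) : Matrix (Fin 4) (Fin 4) ℝ := Matrix.vecMulVec α α

/-- The Kerr metric, of signature `(+,-,-,-)`. -/
def kerr (M a : ℝ) : Bilin := fun p =>
  (Del M a p / Sig a p) • sq (dt M a p - (a * sinθ p ^ 2) • dφ p)
    - Sig a p • ((Del M a p)⁻¹ • sq (dr p) + sq (dθ p))
    - (sinθ p ^ 2 / Sig a p) • sq (a • dt M a p - (rad p ^ 2 + a ^ 2) • dφ p)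

/-- The Boyer-Lindquist coordinate vector fields `∂_t, ∂_r, ∂_θ, ∂_φ`, in the coordinates
`(t_*, x)`. -/
def vt (_p : Pt) : Fin 4 → ℝ := ![1, 0, 0, 0]
def vr (M a : ℝ) (p : Pt) : Fin 4 → ℝ :=
  ![- ((rad p ^ 2 + a ^ 2) / Del M a p), p 1 / rad p, p 2 / rad p, p 3 / rad p]
def vθ (p : Pt) : Fin 4 → ℝ := ![0, p 3 * p 1 / cyl p, p 3 * p 2 / cyl p, - cyl p]
def vφ (p : Pt) : Fin 4 → ℝ := ![0, - p 2, p 1, 0]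

/-- The scalar `p = r - i a cos θ`. -/
def pS (a : ℝ) (x : Pt) : ℂ := (rad x : ℂ) - Complex.I * a * cosθ x

/-- The Kinnersley tetrad `ℓ, n, m, m̄`. -/
def ell (M a : ℝ) : VecField := fun x μ =>
  (((rad x ^ 2 + a ^ 2) / Del M a x * vt x μ + vr M a x μ + a / Del M a x * vφ x μ : ℝ) : ℂ)
def nn (M a : ℝ) : VecField := fun x μ =>
  (((rad x ^ 2 + a ^ 2) / (2 * Sig a x) * vt x μ - Del M a x / (2 * Sig a x) * vr M a x μ
    + a / (2 * Sig a x) * vφ x μ : ℝ) : ℂ)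
def mm (a : ℝ) : VecField := fun x μ =>
  (Complex.I * a * sinθ x * vt x μ + vθ x μ + Complex.I / sinθ x * vφ x μ)
    / ((√2 : ℝ) * conj (pS a x))
def mb (a : ℝ) : VecField := fun x μ => conj (mm a x μ)

/-- The tetrad as the vectors `o^A o^{A'} = ℓ`, `o^A ι^{A'} = m`, `ι^A o^{A'} = m̄`,
`ι^A ι^{A'} = n`; the index `0` stands for `o` and `1` for `ι`. -/
def frame (M a : ℝ) : Fin 2 → Fin 2 → VecField :=
  ![![ell M a, mm a], ![mb a, nn M a]]

/-! ### Spin coefficients and Weyl scalars of the background -/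

/-- `ϱ = m^a m̄^b ∇_b ℓ_a`. -/
def rho (M a : ℝ) : Pt → ℂ :=
  contr (covD (kerr M a) (lower (kerr M a) (ell M a))) ![mb a, mm a]
/-- `ϱ' = m̄^a m^b ∇_b n_a`. -/
def rho' (M a : ℝ) : Pt → ℂ :=
  contr (covD (kerr M a) (lower (kerr M a) (nn M a))) ![mm a, mb a]
/-- `τ = m^a n^b ∇_b ℓ_a`. -/
def tau (M a : ℝ) : Pt → ℂ :=
  contr (covD (kerr M a) (lower (kerr M a) (ell M a))) ![nn M a, mm a]
/-- `τ' = m̄^a ℓ^b ∇_b n_a`. -/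
def tau' (M a : ℝ) : Pt → ℂ :=
  contr (covD (kerr M a) (lower (kerr M a) (nn M a))) ![ell M a, mb a]

/-- The Weyl scalars `Ψ₁, Ψ₀, Ψ₋₁` of the background, indexed by spin weight. -/
def Psi1 (M a : ℝ) : Pt → ℂ := contr (weyl (kerr M a)) ![ell M a, nn M a, ell M a, mm a]
def Psi0 (M a : ℝ) : Pt → ℂ := contr (weyl (kerr M a)) ![ell M a, mm a, mb a, nn M a]
def PsiM1 (M a : ℝ) : Pt → ℂ := contr (weyl (kerr M a)) ![ell M a, nn M a, mb a, nn M a]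

/-! ### Linearized Weyl scalars -/

/-- The spin metric `ε^{A'B'}` in the dyad. -/
def spinEps : Fin 2 → Fin 2 → ℂ := ![![0, 1], ![-1, 0]]

/-- Dyad components of `∇_A^{A'} ∇_B^{B'} h^{tf}_{CDA'B'}`, before symmetrization in `ABCD`. -/
def spinHess (M a : ℝ) (h : Bilin) (A : Fin 4 → Fin 2) (p : Pt) : ℂ :=
  ∑ a₁ : Fin 2, ∑ b₁ : Fin 2, ∑ a₂ : Fin 2, ∑ b₂ : Fin 2,
    spinEps a₁ a₂ * spinEps b₁ b₂ *
      contr (covD (kerr M a) (covD (kerr M a) (toTensor (traceFree (kerr M a) h))))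
        ![frame M a (A 0) a₁, frame M a (A 1) b₁, frame M a (A 2) a₂, frame M a (A 3) b₂] p

/-- Dyad components of `∇_{(A}^{A'} ∇_B^{B'} h^{tf}_{CD)A'B'}`. -/
def spinHessSym (M a : ℝ) (h : Bilin) (A : Fin 4 → Fin 2) (p : Pt) : ℂ :=
  (1 / 24) * ∑ s : Equiv.Perm (Fin 4), spinHess M a h (A ∘ s) p

/-- The dyad components `ϑΨ₁, ϑΨ₀, ϑΨ₋₁` of
`ϑΨ_{ABCD} = ½ ∇_{(A}^{A'} ∇_B^{B'} h^{tf}_{CD)A'B'} + κ (tr h) Ψ_{ABCD}`. -/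
def varPsi1 (κ M a : ℝ) (h : Bilin) (p : Pt) : ℂ :=
  (1 / 2) * spinHessSym M a h ![0, 0, 0, 1] p + κ * tr (kerr M a) h p * Psi1 M a p
def varPsi0 (κ M a : ℝ) (h : Bilin) (p : Pt) : ℂ :=
  (1 / 2) * spinHessSym M a h ![0, 0, 1, 1] p + κ * tr (kerr M a) h p * Psi0 M a p
def varPsiM1 (κ M a : ℝ) (h : Bilin) (p : Pt) : ℂ :=
  (1 / 2) * spinHessSym M a h ![0, 1, 1, 1] p + κ * tr (kerr M a) h p * PsiM1 M a p

/-! ### The scalar `𝕀_ζ` -/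

/-- `𝕀_ζ` of the perturbation `h`.  The GHP operators `þ, þ', ð, ð'` only act on `p⁴ ϑΨ₀`, which
has spin and boost weight zero, so that they are the derivatives along `ℓ, n, m, m̄`. -/
def Izeta (κ M a : ℝ) (h : Bilin) (x : Pt) : ℂ :=
  let l := ell M a
  let n := nn M a
  let m := mm a
  let m' := mb a
  let H : VecField → VecField → ℂ := fun u v => contr (toTensor h) ![u, v] x
  let p := pS a x
  let pb := conj p
  let pp := p + pb
  let pm := p - pb
  let ρ := rho M a x
  let ρ' := rho' M a x
  let τ := tau M a x
  let τ' := tau' M a x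
  let Ψ := Psi0 M a x
  let ϑ₀ := varPsi0 κ M a h x
  let ϑ₁ := varPsi1 κ M a h x
  let ϑm := varPsiM1 κ M a h x
  let F : Pt → ℂ := fun y => pS a y ^ 4 * varPsi0 κ M a h y
  (1 / 4) * p * (pm ^ 2 * (ρ' * dirD l F x + ρ * dirD n F x)
      - pp ^ 2 * (τ' * dirD m F x + τ * dirD m' F x))
  + (1 / 4) * (((p ^ 5 * ϑ₀ * (Ψ * (p ^ 2 + pb ^ 2) - 2 * conj Ψ * pb ^ 2
      - 4 * p * (pm * ρ * ρ' - pp * τ * τ'))).re : ℝ) : ℂ)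
  + 2 * Complex.I * (((p ^ 6 * pb * (ϑm * ρ * τ + ϑ₁ * ρ' * τ')).im : ℝ) : ℂ)
  - (3 / 8) * Ψ * p ^ 5 *
    (pm ^ 2 * (H n n * ρ ^ 2 + 2 * H l n * ρ * ρ' + H l l * ρ' ^ 2)
      - 2 * (p ^ 2 + pb ^ 2) * (H n m' * ρ * τ + H l m' * ρ' * τ + H n m * ρ * τ' + H l m * ρ' * τ')
      + pp ^ 2 * (H m' m' * τ ^ 2 + 2 * H m m' * τ * τ' + H m m * τ' ^ 2))

/-! ### Stationary perturbations and their decay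

A stationary symmetric two-tensor is given by its coefficients with respect to
`dt_*, dx¹, dx², dx³`, as functions of `x`. -/

abbrev Space := EuclideanSpace ℝ (Fin 3)

/-- Coefficients of a stationary two-tensor. -/
abbrev Coeff := Space → Matrix (Fin 4) (Fin 4) ℝ

/-- The stationary field with given coefficients. -/
def stationary (H : Coeff) : Bilin := fun p => H !₂[p 1, p 2, p 3]

/-- `H = O(r^{-q})` as a symmetric two-tensor near infinity, together with its derivatives up to
order three: the derivatives of order `k` of the coefficients are `O(r^{-q-k})`. -/
structure DecaysLike (q : ℝ) (H : Coeff) : Prop where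
  symm : ∀ x, (H x).IsSymm
  contDiffAt : ∀ μ ν, ∀ᶠ x in Bornology.cobounded Space, ContDiffAt ℝ 3 (fun y => H y μ ν) x
  isBigO : ∀ μ ν, ∀ k ≤ 3, (fun x => iteratedFDeriv ℝ k (fun y => H y μ ν) x)
    =O[Bornology.cobounded Space] fun x => ‖x‖ ^ (-q - k)

/-- The unit sphere, which is the boundary `∂X` at infinity. -/
abbrev Sphere := Metric.sphere (0 : Space) 1

/-- A smooth symmetric two-tensor on the boundary at infinity, given by its coefficients
with respect to `dt_*, dx¹, dx², dx³`. -/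
structure IsBoundaryTensor (G : Sphere → Matrix (Fin 4) (Fin 4) ℝ) : Prop where
  symm : ∀ y, (G y).IsSymm
  smooth : ∀ μ ν, ContMDiff (𝓡 2) 𝓘(ℝ, ℝ) ∞ fun y => G y μ ν

open Classical in
/-- The coefficients of `g₀ / r`. -/
def overR (G : Sphere → Matrix (Fin 4) (Fin 4) ℝ) : Coeff := fun x =>
  if hx : x ≠ 0 then
    ‖x‖⁻¹ • G ⟨‖x‖⁻¹ • x, by
      rw [mem_sphere_zero_iff_norm, norm_smul, norm_inv, norm_norm,
        inv_mul_cancel₀ (norm_ne_zero_iff.mpr hx)]⟩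
  else 0

/-- The filter of points with `r → ∞`, uniformly in `t_*` and in the angles, off the axis of the
Boyer-Lindquist coordinates. -/
def atInfinity : Filter Pt := comap rad atTop ⊓ 𝓟 {p | cyl p ≠ 0}

/-- The perturbation solves the linearized vacuum Einstein equation `D_g Ric(h) = 0` on Kerr,
for large `r`. -/
def IsLinVacuum (M a : ℝ) (H : Coeff) : Prop :=
  ∀ᶠ p in atInfinity, ∀ μ ν, linRicci (kerr M a) (stationary H) p μ ν = 0

end KerrDecay

end

/-!
The argument counts powers of `r`, and for the sharper bound on the real part shows that the only
term of critical order vanishes on Minkowski space.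

**Order counting.** In the coordinates `(t_*, x)` the Kerr metric, its inverse, its Christoffel
symbols and its tetrad are symbols (`IsSymbol`: each derivative gains a power of `r`) whose leading
parts are those of Minkowski space, with an error one order lower (`Asy`). The vector `m` itself is
singular on the axis, but products of tetrad vectors of total spin weight zero are not
(`asy_frame_prod`), so that `Ψ₀` and `ϑΨ₀` are symbols; of the other scalars only bounds are
needed, not derivatives. Since Minkowski space is flat, `Ψ₀ = O(r⁻³)`. A direct count with `ϱ, ϱ' =
O(r⁻¹)` and `τ, τ' = O(r⁻²)` gives `𝕀_ζ[h] = O(r^(q+2))` for `h` of order `q` (`Izeta_isBigO`).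
This is the bound for `h = g₀/r`, where `q = -1`, and for faster decaying `h`.

**The real part.** The twists of the one-forms `ℓ` and `n` are small: `Im ϱ` and `Im ϱ'` are
`O(r⁻²)` (`rho_im_isBigO`, `rho'_im_isBigO`), and `τ' + τ̄ = O(r⁻³)` (`tau'_add_conj_tau_isBigO`).
In the terms of `Re 𝕀_ζ[h]` which have critical order `r^(q+2)`, the factors and derivations
applied to `Re ϑΨ₀` are therefore imaginary to leading order, and `Re 𝕀_ζ[h]` gains one power of
`r` as soon as `Im ϑΨ₀` does (`re_Izeta_isBigO`).

**The imaginary part of `ϑΨ₀`.** It remains to see that its leading part, computed on Minkowski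
space from `h = g₀/r`, vanishes if `h` is the leading part of a linearized vacuum perturbation. In
a parallel frame the components of `∇∇h` are second partial derivatives (`hat_covD_covD`), and only
the mixed components `w` of `h` (one time and one space index) enter the imaginary part, namely as
a multiple of `x · curl w` (`im_flat_varPsi`). The linearized Ricci tensor of `h` on Minkowski
space is homogeneous of degree `-3`, while by the linearized vacuum equation on Kerr it decays
faster, so it vanishes (`linRicci_mink_eq_zero`); its mixed components say that `curl curl w = 0`
(`curl_curl_timeSpace`).

**Potential theory on the sphere.** So `v = curl w` is homogeneous of degree `-2`, curl-free and
divergence-free (`IsHarmonic`), and the gradient of `x · v` is `-v`. The field `(x · v) (v × x)`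
satisfies `x · curl ((x · v) (v × x)) = |v × x|²`. By Stokes' theorem the integral of the radial
component of a curl over the unit sphere vanishes (`integral_radial_curl`), hence `v × x = 0` and
`x · v` is a constant `c` on the sphere. The field `c w` has `x · curl (c w) = c²` there, so a
second application of Stokes' theorem gives `c = 0` (`radial_curl_eq_zero`).
-/

noncomputable section

namespace KerrDecay
section

/-! ### Symbols near infinity -/

theorem continuous_rad : Continuous rad := by unfold rad; fun_prop
theorem continuous_cyl : Continuous cyl := by unfold cyl; fun_prop

theorem rad_nonneg (p : Pt) : 0 ≤ rad p := Real.sqrt_nonneg _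

theorem eventually_atInfinity {P : Pt → Prop} :
    (∀ᶠ p in atInfinity, P p) ↔ ∃ R : ℝ, 0 < R ∧ ∀ p, R < rad p → cyl p ≠ 0 → P p := by
  have hb : atInfinity.HasBasis (fun _ : ℝ => True)
      (fun R => rad ⁻¹' Set.Ioi R ∩ {p | cyl p ≠ 0}) :=
    ((atTop_basis_Ioi (α := ℝ)).comap rad).inf_principal _
  rw [hb.eventually_iff]
  constructor
  · rintro ⟨R, -, h⟩
    exact ⟨max R 1, by positivity, fun p hp hc => h ⟨(le_max_left _ _).trans_lt hp, hc⟩⟩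
  · rintro ⟨R, -, h⟩
    exact ⟨R, trivial, fun p hp => h p hp.1 hp.2⟩

/-- The filter `atInfinity` is generated by open sets. -/
theorem eventually_nhds_atInfinity {P : Pt → Prop} (h : ∀ᶠ p in atInfinity, P p) :
    ∀ᶠ p in atInfinity, ∀ᶠ q in 𝓝 p, P q := by
  obtain ⟨R, hR, h⟩ := eventually_atInfinity.1 h
  refine eventually_atInfinity.2 ⟨R, hR, fun p hp hc => ?_⟩
  filter_upwards [continuous_rad.continuousAt.eventually (lt_mem_nhds hp),
    continuous_cyl.continuousAt.eventually_ne hc] with q h1 h2 using h q h1 h2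

theorem eventually_rad_gt (R : ℝ) : ∀ᶠ p in atInfinity, R < rad p :=
  eventually_atInfinity.2 ⟨max R 1, by positivity, fun _ hp _ => (le_max_left _ _).trans_lt hp⟩

theorem eventually_cyl_ne : ∀ᶠ p in atInfinity, cyl p ≠ 0 :=
  eventually_atInfinity.2 ⟨1, by positivity, fun _ _ hp => hp⟩

variable {E F : Type*} [NormedAddCommGroup E] [NormedSpace ℝ E]
  [NormedAddCommGroup F] [NormedSpace ℝ F]
  {𝕜 : Type*} [NormedField 𝕜] [NormedAlgebra ℝ 𝕜]

theorem pd_congr {f g : Pt → E} {p : Pt} (h : f =ᶠ[𝓝 p] g) (μ : Fin 4) : pd μ f p = pd μ g p := by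
  unfold pd; rw [h.fderiv_eq]

theorem pd_const (c : E) (μ : Fin 4) (p : Pt) : pd μ (fun _ => c) p = 0 := by simp [pd]

theorem pd_add {f g : Pt → E} {p : Pt} (hf : DifferentiableAt ℝ f p) (hg : DifferentiableAt ℝ g p)
    (μ : Fin 4) : pd μ (fun q => f q + g q) p = pd μ f p + pd μ g p := by
  unfold pd; rw [fderiv_fun_add hf hg]; rfl

theorem pd_sub {f g : Pt → E} {p : Pt} (hf : DifferentiableAt ℝ f p) (hg : DifferentiableAt ℝ g p)
    (μ : Fin 4) : pd μ (fun q => f q - g q) p = pd μ f p - pd μ g p := by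
  unfold pd; rw [fderiv_fun_sub hf hg]; rfl

theorem pd_sum {ι : Type*} (s : Finset ι) {f : ι → Pt → E} {p : Pt}
    (hf : ∀ i ∈ s, DifferentiableAt ℝ (f i) p) (μ : Fin 4) :
    pd μ (fun q => ∑ i ∈ s, f i q) p = ∑ i ∈ s, pd μ (f i) p := by
  unfold pd; rw [fderiv_fun_sum hf]; simp

theorem pd_mul {f g : Pt → 𝕜} {p : Pt} (hf : DifferentiableAt ℝ f p) (hg : DifferentiableAt ℝ g p)
    (μ : Fin 4) : pd μ (fun q => f q * g q) p = f p * pd μ g p + g p * pd μ f p := by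
  unfold pd; rw [fderiv_fun_mul hf hg]; rfl

theorem pd_clm (L : E →L[ℝ] F) {f : Pt → E} {p : Pt} (hf : DifferentiableAt ℝ f p) (μ : Fin 4) :
    pd μ (fun q => L (f q)) p = L (pd μ f p) := by
  unfold pd
  rw [show (fun q => L (f q)) = L ∘ f from rfl, fderiv_comp p L.differentiableAt hf, L.fderiv]
  rfl

theorem pd_ofReal {f : Pt → ℝ} {p : Pt} (hf : DifferentiableAt ℝ f p) (μ : Fin 4) :
    pd μ (fun q => (f q : ℂ)) p = ((pd μ f p : ℝ) : ℂ) := pd_clm Complex.ofRealCLM hf μ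

theorem differentiableAt_ofReal {f : Pt → ℝ} {p : Pt} (hf : DifferentiableAt ℝ f p) :
    DifferentiableAt ℝ (fun q => (f q : ℂ)) p :=
  Complex.ofRealCLM.differentiableAt.comp p hf

theorem pd_inv {f : Pt → 𝕜} {p : Pt} (hf : DifferentiableAt ℝ f p) (h0 : f p ≠ 0) (μ : Fin 4) :
    pd μ (fun q => (f q)⁻¹) p = -((f p)⁻¹ * (f p)⁻¹ * pd μ f p) := by
  have hd : DifferentiableAt ℝ (fun q => (f q)⁻¹) p := hf.inv h0
  have h1 : pd μ (fun q => f q * (f q)⁻¹) p = 0 := by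
    rw [← pd_const (1 : 𝕜) μ p]
    apply pd_congr
    filter_upwards [hf.continuousAt.eventually_ne h0] with q hq using mul_inv_cancel₀ hq
  rw [pd_mul hf hd] at h1
  field_simp at h1 ⊢
  linear_combination h1

/-- `f` is a symbol of order `q` with `n` derivatives: the partial derivatives of order `k ≤ n` are
`O(r^(q-k))` near infinity, uniformly up to the axis. -/
def IsSymbol {E : Type*} [NormedAddCommGroup E] [NormedSpace ℝ E] : ℕ → ℝ → (Pt → E) → Prop
  | 0, q, f => f =O[atInfinity] fun p => rad p ^ q
  | n + 1, q, f => (f =O[atInfinity] fun p => rad p ^ q) ∧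
      (∀ᶠ p in atInfinity, DifferentiableAt ℝ f p) ∧ ∀ μ, IsSymbol n (q - 1) (pd μ f)

theorem rpow_isBigO {q q' : ℝ} (h : q ≤ q') :
    (fun p => rad p ^ q) =O[atInfinity] fun p => rad p ^ q' := by
  apply IsBigO.of_bound 1
  filter_upwards [eventually_rad_gt 1] with p hp
  rw [one_mul, Real.norm_of_nonneg (by positivity [rad_nonneg p]),
    Real.norm_of_nonneg (by positivity [rad_nonneg p])]
  exact Real.rpow_le_rpow_of_exponent_le hp.le h

theorem rpow_mul_rpow (q q' : ℝ) :
    (fun p => rad p ^ q * rad p ^ q') =ᶠ[atInfinity] fun p => rad p ^ (q + q') := by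
  filter_upwards [eventually_rad_gt 0] with p hp
  rw [Real.rpow_add hp]

theorem isBigO_mul {𝕜 : Type*} [NormedField 𝕜] {q q' : ℝ} {f g : Pt → 𝕜}
    (hf : f =O[atInfinity] fun p => rad p ^ q)
    (hg : g =O[atInfinity] fun p => rad p ^ q') :
    (fun p => f p * g p) =O[atInfinity] fun p => rad p ^ (q + q') :=
  (hf.mul hg).trans_eventuallyEq (rpow_mul_rpow q q')

namespace IsSymbol

variable {n : ℕ} {q q' : ℝ} {f g : Pt → E}

theorem isBigO (h : IsSymbol n q f) : f =O[atInfinity] fun p => rad p ^ q := by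
  cases n with
  | zero => exact h
  | succ n => exact h.1

theorem differentiableAt (h : IsSymbol (n + 1) q f) :
    ∀ᶠ p in atInfinity, DifferentiableAt ℝ f p := h.2.1

theorem pd (h : IsSymbol (n + 1) q f) (μ : Fin 4) : IsSymbol n (q - 1) (pd μ f) := h.2.2 μ

theorem of_succ (h : IsSymbol (n + 1) q f) : IsSymbol n q f := by
  induction n generalizing q f with
  | zero => exact h.1
  | succ n ih => exact ⟨h.1, h.2.1, fun μ => ih (h.2.2 μ)⟩

theorem of_le {m : ℕ} (h : IsSymbol n q f) (hm : m ≤ n) : IsSymbol m q f := by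
  induction n, hm using Nat.le_induction with
  | base => exact h
  | succ n _ ih => exact ih h.of_succ

theorem mono (h : IsSymbol n q f) (hq : q ≤ q') : IsSymbol n q' f := by
  induction n generalizing q q' f with
  | zero => exact IsBigO.trans h (rpow_isBigO hq)
  | succ n ih =>
    exact ⟨h.1.trans (rpow_isBigO hq), h.2.1, fun μ => ih (h.2.2 μ) (by linarith)⟩

theorem congr (h : IsSymbol n q f) (hfg : f =ᶠ[atInfinity] g) : IsSymbol n q g := by
  induction n generalizing q f g with
  | zero => exact IsBigO.congr' h hfg EventuallyEq.rfl
  | succ n ih =>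
    have hn := eventually_nhds_atInfinity hfg
    refine ⟨h.1.congr' hfg EventuallyEq.rfl, ?_, fun μ => ih (h.2.2 μ) ?_⟩
    · filter_upwards [hn, h.2.1] with p hp hd using (EventuallyEq.differentiableAt_iff hp).1 hd
    · filter_upwards [hn] with p hp using pd_congr hp μ

theorem add (hf : IsSymbol n q f) (hg : IsSymbol n q g) : IsSymbol n q fun p => f p + g p := by
  induction n generalizing q f g with
  | zero => exact IsBigO.add hf hg
  | succ n ih =>
    refine ⟨hf.1.add hg.1, ?_, fun μ => (ih (hf.2.2 μ) (hg.2.2 μ)).congr ?_⟩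
    · filter_upwards [hf.2.1, hg.2.1] with p h1 h2 using h1.add h2
    · filter_upwards [hf.2.1, hg.2.1] with p h1 h2 using (pd_add h1 h2 μ).symm

theorem clm (hf : IsSymbol n q f) (L : E →L[ℝ] F) : IsSymbol n q fun p => L (f p) := by
  have hb : ∀ {q : ℝ} {f : Pt → E}, (f =O[atInfinity] fun p => rad p ^ q) →
      (fun p => L (f p)) =O[atInfinity] fun p => rad p ^ q :=
    fun h => (L.isBigO_comp _ _).trans h
  induction n generalizing q f with
  | zero => exact hb hf
  | succ n ih =>
    refine ⟨hb hf.1, ?_, fun μ => (ih (hf.2.2 μ)).congr ?_⟩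
    · filter_upwards [hf.2.1] with p h1 using L.differentiableAt.comp p h1
    · filter_upwards [hf.2.1] with p h1 using (pd_clm L h1 μ).symm

theorem neg (hf : IsSymbol n q f) : IsSymbol n q fun p => -f p :=
  hf.clm (-ContinuousLinearMap.id ℝ E)

theorem sub (hf : IsSymbol n q f) (hg : IsSymbol n q g) : IsSymbol n q fun p => f p - g p :=
  (hf.add hg.neg).congr (Eventually.of_forall fun _ => (sub_eq_add_neg _ _).symm)

theorem ofReal {f : Pt → ℝ} (hf : IsSymbol n q f) : IsSymbol n q fun p => (f p : ℂ) :=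
  hf.clm Complex.ofRealCLM

theorem conjugate {f : Pt → ℂ} (hf : IsSymbol n q f) : IsSymbol n q fun p => starRingEnd ℂ (f p) :=
  hf.clm (Complex.conjCLE : ℂ →L[ℝ] ℂ)

theorem im {f : Pt → ℂ} (hf : IsSymbol n q f) : IsSymbol n q fun p => (f p).im :=
  hf.clm Complex.imCLM

theorem re {f : Pt → ℂ} (hf : IsSymbol n q f) : IsSymbol n q fun p => (f p).re :=
  hf.clm Complex.reCLM

theorem zero (n : ℕ) (q : ℝ) : IsSymbol n q fun _ => (0 : E) := by
  induction n generalizing q with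
  | zero => exact isBigO_zero _ _
  | succ n ih =>
    exact ⟨isBigO_zero _ _, by simp, fun μ =>
      (ih (q - 1)).congr (Eventually.of_forall fun p => (pd_const _ μ p).symm)⟩

theorem const (n : ℕ) (c : E) : IsSymbol n 0 fun _ => c := by
  have h0 : (fun _ : Pt => c) =O[atInfinity] fun p => rad p ^ (0 : ℝ) := by
    simpa using isBigO_const_const c (one_ne_zero (α := ℝ)) _
  cases n with
  | zero => exact h0
  | succ n =>
    exact ⟨h0, by simp, fun μ =>
      (zero n _).congr (Eventually.of_forall fun p => (pd_const _ μ p).symm)⟩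

theorem sum {ι : Type*} (s : Finset ι) {f : ι → Pt → E} (h : ∀ i ∈ s, IsSymbol n q (f i)) :
    IsSymbol n q fun p => ∑ i ∈ s, f i p := by
  classical
  induction s using Finset.induction_on with
  | empty => simpa using zero n q
  | insert a s ha ih =>
    simp only [Finset.sum_insert ha]
    exact (h a (by simp)).add (ih fun i hi => h i (by simp [hi]))

section mul
variable {f g : Pt → 𝕜}

theorem mul (hf : IsSymbol n q f) (hg : IsSymbol n q' g) :
    IsSymbol n (q + q') fun p => f p * g p := by
  induction n generalizing q q' f g with
  | zero => exact isBigO_mul hf hg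
  | succ n ih =>
    refine ⟨isBigO_mul hf.1 hg.1, ?_, fun μ => ?_⟩
    · filter_upwards [hf.2.1, hg.2.1] with p h1 h2 using h1.mul h2
    · have h1 := ih hf.of_succ (hg.2.2 μ)
      have h2 := ih hg.of_succ (hf.2.2 μ)
      refine ((h1.mono (by linarith : _ ≤ q + q' - 1)).add
        (h2.mono (by linarith : _ ≤ q + q' - 1))).congr ?_
      filter_upwards [hf.2.1, hg.2.1] with p h1 h2 using (pd_mul h1 h2 μ).symm

theorem const_mul (c : 𝕜) (hf : IsSymbol n q f) : IsSymbol n q fun p => c * f p := by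
  simpa using (const n c).mul hf

theorem pow (hf : IsSymbol n q f) (k : ℕ) : IsSymbol n (k * q) fun p => f p ^ k := by
  induction k with
  | zero => simpa using const n (1 : 𝕜)
  | succ k ih =>
    simp only [pow_succ]
    exact (ih.mul hf).mono (by push_cast; linarith)

theorem inv (hf : IsSymbol n q f) {c : ℝ} (hc : 0 < c)
    (hlow : ∀ᶠ p in atInfinity, c * rad p ^ q ≤ ‖f p‖) : IsSymbol n (-q) fun p => (f p)⁻¹ := by
  have h0 : (fun p => (f p)⁻¹) =O[atInfinity] fun p => rad p ^ (-q) := by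
    apply IsBigO.of_bound c⁻¹
    filter_upwards [hlow, eventually_rad_gt 0] with p hp hr
    have : 0 < rad p ^ q := Real.rpow_pos_of_pos hr q
    rw [norm_inv, Real.norm_of_nonneg (by positivity), Real.rpow_neg hr.le, ← mul_inv]
    exact inv_anti₀ (by positivity) hp
  have hne : ∀ᶠ p in atInfinity, f p ≠ 0 := by
    filter_upwards [hlow, eventually_rad_gt 0] with p hp hr h
    have : 0 < rad p ^ q := Real.rpow_pos_of_pos hr q
    rw [h, norm_zero] at hp
    nlinarith [mul_pos hc this]
  induction n with
  | zero => exact h0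
  | succ n ih =>
    have ih := ih hf.of_succ
    refine ⟨h0, ?_, fun μ => ?_⟩
    · filter_upwards [hf.2.1, hne] with p h1 h2 using h1.inv h2
    · refine (((ih.mul ih).mul (hf.2.2 μ)).neg.mono (by linarith : _ ≤ -q - 1)).congr ?_
      filter_upwards [hf.2.1, hne] with p h1 h2 using (pd_inv h1 h2 μ).symm

end mul
end IsSymbol

/-- `f` and `f₀` are symbols of order `q` which agree up to order `q - δ`. -/
structure Asy {E : Type*} [NormedAddCommGroup E] [NormedSpace ℝ E] (n : ℕ) (δ q : ℝ)
    (f f₀ : Pt → E) : Prop where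
  left : IsSymbol n q f
  right : IsSymbol n q f₀
  diff : IsSymbol n (q - δ) fun p => f p - f₀ p

namespace Asy

variable {n : ℕ} {δ q q' : ℝ} {f g f₀ g₀ : Pt → E}

theorem refl (h : IsSymbol n q f) (δ : ℝ) : Asy n δ q f f :=
  ⟨h, h, (IsSymbol.zero n _).congr (Eventually.of_forall fun _ => (sub_self _).symm)⟩

theorem of_le {m : ℕ} (h : Asy n δ q f f₀) (hm : m ≤ n) : Asy m δ q f f₀ :=
  ⟨h.left.of_le hm, h.right.of_le hm, h.diff.of_le hm⟩

theorem mono_delta {δ' : ℝ} (h : Asy n δ q f f₀) (hd : δ' ≤ δ) : Asy n δ' q f f₀ :=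
  ⟨h.left, h.right, h.diff.mono (by linarith)⟩

theorem mono (h : Asy n δ q f f₀) (hq : q ≤ q') : Asy n δ q' f f₀ :=
  ⟨h.left.mono hq, h.right.mono hq, h.diff.mono (by linarith)⟩

theorem congr (h : Asy n δ q f f₀) (hf : f =ᶠ[atInfinity] g) (hf₀ : f₀ =ᶠ[atInfinity] g₀) :
    Asy n δ q g g₀ :=
  ⟨h.left.congr hf, h.right.congr hf₀, h.diff.congr (hf.sub hf₀)⟩

/-- A symbol of lower order has vanishing leading part. -/
theorem of_lower (h : IsSymbol n (q - δ) f) (hδ : 0 ≤ δ) : Asy n δ q f fun _ => 0 :=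
  ⟨h.mono (by linarith), IsSymbol.zero _ _, by simpa using h⟩

theorem add (hf : Asy n δ q f f₀) (hg : Asy n δ q g g₀) :
    Asy n δ q (fun p => f p + g p) fun p => f₀ p + g₀ p :=
  ⟨hf.left.add hg.left, hf.right.add hg.right,
    (hf.diff.add hg.diff).congr (Eventually.of_forall fun p => by simp; abel)⟩

theorem clm (hf : Asy n δ q f f₀) (L : E →L[ℝ] F) :
    Asy n δ q (fun p => L (f p)) fun p => L (f₀ p) :=
  ⟨hf.left.clm L, hf.right.clm L,
    (hf.diff.clm L).congr (Eventually.of_forall fun p => by simp)⟩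

theorem neg (hf : Asy n δ q f f₀) : Asy n δ q (fun p => -f p) fun p => -f₀ p :=
  hf.clm (-ContinuousLinearMap.id ℝ E)

theorem sub (hf : Asy n δ q f f₀) (hg : Asy n δ q g g₀) :
    Asy n δ q (fun p => f p - g p) fun p => f₀ p - g₀ p := by
  simpa only [sub_eq_add_neg] using hf.add hg.neg

theorem ofReal {f f₀ : Pt → ℝ} (hf : Asy n δ q f f₀) :
    Asy n δ q (fun p => (f p : ℂ)) fun p => (f₀ p : ℂ) := hf.clm Complex.ofRealCLM

theorem const (n : ℕ) (δ : ℝ) (c : E) : Asy n δ 0 (fun _ => c) fun _ => c :=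
  refl (IsSymbol.const n c) δ

theorem sum {ι : Type*} (s : Finset ι) {f f₀ : ι → Pt → E}
    (h : ∀ i ∈ s, Asy n δ q (f i) (f₀ i)) :
    Asy n δ q (fun p => ∑ i ∈ s, f i p) fun p => ∑ i ∈ s, f₀ i p :=
  ⟨IsSymbol.sum s fun i hi => (h i hi).left, IsSymbol.sum s fun i hi => (h i hi).right,
    (IsSymbol.sum s fun i hi => (h i hi).diff).congr
      (Eventually.of_forall fun p => by simp)⟩

theorem pd (h : Asy (n + 1) δ q f f₀) (μ : Fin 4) : Asy n δ (q - 1) (pd μ f) (pd μ f₀) :=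
  ⟨h.left.pd μ, h.right.pd μ, ((h.diff.pd μ).mono (by linarith)).congr (by
    filter_upwards [h.left.differentiableAt, h.right.differentiableAt] with p h1 h2
      using pd_sub h1 h2 μ)⟩

section mul
variable {f g f₀ g₀ : Pt → 𝕜}

theorem mul (hf : Asy n δ q f f₀) (hg : Asy n δ q' g g₀) :
    Asy n δ (q + q') (fun p => f p * g p) fun p => f₀ p * g₀ p :=
  ⟨hf.left.mul hg.left, hf.right.mul hg.right,
    (((hf.diff.mul hg.left).mono (by linarith)).add
      ((hf.right.mul hg.diff).mono (by linarith : _ ≤ q + q' - δ))).congr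
      (Eventually.of_forall fun p => by simp; ring)⟩

theorem const_mul (c : 𝕜) (hf : Asy n δ q f f₀) :
    Asy n δ q (fun p => c * f p) fun p => c * f₀ p := by
  simpa using (const n δ c).mul hf

theorem mul_zero' (hf : Asy n δ 0 f f₀) (hg : Asy n δ q g g₀) :
    Asy n δ q (fun p => f p * g p) fun p => f₀ p * g₀ p := by
  simpa using hf.mul hg

theorem pow (hf : Asy n δ q f f₀) (k : ℕ) :
    Asy n δ (k * q) (fun p => f p ^ k) fun p => f₀ p ^ k := by
  induction k with
  | zero => simpa using const n δ (1 : 𝕜)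
  | succ k ih =>
    simp only [pow_succ]
    exact (ih.mul hf).mono (by push_cast; linarith)

theorem prod {ι : Type*} (s : Finset ι) {f f₀ : ι → Pt → 𝕜}
    (h : ∀ i ∈ s, Asy n δ 0 (f i) (f₀ i)) :
    Asy n δ 0 (fun p => ∏ i ∈ s, f i p) fun p => ∏ i ∈ s, f₀ i p := by
  classical
  induction s using Finset.induction_on with
  | empty => simpa using const n δ (1 : 𝕜)
  | insert a s ha ih =>
    simp only [Finset.prod_insert ha]
    simpa using (h a (by simp)).mul (ih fun i hi => h i (by simp [hi]))

/-- A lower bound for the leading part is inherited, up to a factor. -/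
theorem lower_bound (hf : Asy n δ q f f₀) (hδ : 0 < δ) {c : ℝ} (hc : 0 < c)
    (hlow : ∀ᶠ p in atInfinity, c * rad p ^ q ≤ ‖f₀ p‖) :
    ∀ᶠ p in atInfinity, (c / 2) * rad p ^ q ≤ ‖f p‖ := by
  obtain ⟨K, hK, hb⟩ := (hf.diff.isBigO).exists_pos
  -- beyond this radius the difference `f - f₀` is at most half of the lower bound for `f₀`
  filter_upwards [hlow, hb.bound, eventually_rad_gt ((2 * K / c) ^ δ⁻¹),
    eventually_rad_gt 0] with p h1 h2 h3 hr
  rw [Real.norm_of_nonneg (by positivity), Real.rpow_sub hr] at h2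
  have hq : 0 < rad p ^ q := Real.rpow_pos_of_pos hr q
  have hd : 0 < rad p ^ δ := Real.rpow_pos_of_pos hr δ
  have h4 : 2 * K / c ≤ rad p ^ δ := by
    have := Real.rpow_le_rpow (by positivity) h3.le hδ.le
    rwa [← Real.rpow_mul (by positivity), inv_mul_cancel₀ hδ.ne', Real.rpow_one] at this
  have h5 : K * (rad p ^ q / rad p ^ δ) ≤ (c / 2) * rad p ^ q := by
    rw [div_le_iff₀ hc] at h4
    rw [← mul_div_assoc, div_le_iff₀ hd]
    nlinarith
  have h6 : ‖f₀ p‖ ≤ ‖f p‖ + ‖f p - f₀ p‖ := by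
    have := norm_sub_le (f p) (f p - f₀ p); simpa using this
  linarith

theorem eventually_ne (hf : Asy n δ q f f₀) (hδ : 0 < δ) {c : ℝ} (hc : 0 < c)
    (hlow : ∀ᶠ p in atInfinity, c * rad p ^ q ≤ ‖f₀ p‖) : ∀ᶠ p in atInfinity, f p ≠ 0 := by
  filter_upwards [hf.lower_bound hδ hc hlow, eventually_rad_gt 0] with p hp hr h
  have : 0 < rad p ^ q := Real.rpow_pos_of_pos hr q
  rw [h, norm_zero] at hp
  nlinarith [mul_pos hc this]

theorem inv (hf : Asy n δ q f f₀) (hδ : 0 < δ) {c : ℝ} (hc : 0 < c)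
    (hlow : ∀ᶠ p in atInfinity, c * rad p ^ q ≤ ‖f₀ p‖) :
    Asy n δ (-q) (fun p => (f p)⁻¹) fun p => (f₀ p)⁻¹ := by
  have h1 := hf.left.inv (half_pos hc) (hf.lower_bound hδ hc hlow)
  have h2 := hf.right.inv hc hlow
  refine ⟨h1, h2, ((((h1.mul h2).mul hf.diff).neg).mono (by linarith)).congr ?_⟩
  filter_upwards [hf.eventually_ne hδ hc hlow,
    (refl hf.right δ).eventually_ne hδ hc hlow] with p h1 h2
  field_simp
  ring

end mul
end Asy

end

section

variable {E F : Type*} [NormedAddCommGroup E] [NormedSpace ℝ E]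
  [NormedAddCommGroup F] [NormedSpace ℝ F]
  {𝕜 : Type*} [NormedField 𝕜] [NormedAlgebra ℝ 𝕜]

/-! ### Stationary homogeneous functions -/

/-- The field `f` does not depend on `t_*`. -/
def IsStationary {α : Type*} (f : Pt → α) : Prop :=
  ∀ p (s : ℝ), f (p + Pi.single 0 s) = f p

theorem IsStationary.pd {f : Pt → E} (h : IsStationary f) (μ : Fin 4) :
    IsStationary (pd μ f) := by
  intro p s
  unfold KerrDecay.pd
  have : f = fun q => f (q + Pi.single 0 s) := funext fun q => (h q s).symm
  conv_rhs => rw [this]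
  rw [fderiv_comp_add_right]

theorem IsStationary.pd_zero {f : Pt → E} (h : IsStationary f) (p : Pt) :
    KerrDecay.pd 0 f p = 0 := by
  unfold KerrDecay.pd
  by_cases hd : DifferentiableAt ℝ f p
  · have h1 : HasDerivAt (fun s : ℝ => f (p + s • Pi.single 0 1))
        (fderiv ℝ f p (Pi.single 0 1)) 0 :=
      hd.hasFDerivAt.hasLineDerivAt (Pi.single (0 : Fin 4) (1 : ℝ))
    have h2 : (fun s : ℝ => f (p + s • Pi.single (0 : Fin 4) (1 : ℝ))) = fun _ => f p := by
      funext s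
      rw [← Pi.single_smul, smul_eq_mul, mul_one, h]
    rw [h2] at h1
    exact h1.unique (hasDerivAt_const _ _)
  · rw [fderiv_zero_of_not_differentiableAt hd]; rfl

theorem rad_add_single (p : Pt) (s : ℝ) : rad (p + Pi.single 0 s) = rad p := by
  simp [rad]

theorem rad_sq (p : Pt) : rad p ^ 2 = p 1 ^ 2 + p 2 ^ 2 + p 3 ^ 2 := by
  unfold rad; rw [Real.sq_sqrt]; positivity

theorem cyl_sq (p : Pt) : cyl p ^ 2 = p 1 ^ 2 + p 2 ^ 2 := by
  unfold cyl; rw [Real.sq_sqrt]; positivity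

theorem rad_smul {c : ℝ} (hc : 0 ≤ c) (p : Pt) : rad (c • p) = c * rad p := by
  unfold rad
  simp only [Pi.smul_apply, smul_eq_mul]
  rw [show (c * p 1) ^ 2 + (c * p 2) ^ 2 + (c * p 3) ^ 2
    = c ^ 2 * (p 1 ^ 2 + p 2 ^ 2 + p 3 ^ 2) by ring, Real.sqrt_mul (by positivity),
    Real.sqrt_sq hc]

theorem contDiffAt_rad {p : Pt} (hp : rad p ≠ 0) : ContDiffAt ℝ ∞ rad p := by
  unfold rad
  refine ContDiffAt.sqrt (by fun_prop) fun h => hp ?_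
  unfold rad; rw [h, Real.sqrt_zero]

theorem eventually_rad_ne {p : Pt} (hp : rad p ≠ 0) : ∀ᶠ q in 𝓝 p, rad q ≠ 0 :=
  continuous_rad.continuousAt.eventually_ne hp

theorem pd_comm {f : Pt → E} {p : Pt} (hf : ContDiffAt ℝ 2 f p) (μ ν : Fin 4) :
    pd μ (pd ν f) p = pd ν (pd μ f) p := by
  have h2 : DifferentiableAt ℝ (fderiv ℝ f) p :=
    (hf.fderiv_right (m := 1) (by norm_num)).differentiableAt (by norm_num)
  have key : ∀ μ ν : Fin 4, pd μ (pd ν f) p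
      = fderiv ℝ (fderiv ℝ f) p (Pi.single μ 1) (Pi.single ν 1) := by
    intro μ ν
    unfold pd
    rw [fderiv_clm_apply h2 (differentiableAt_const _)]
    simp
  rw [key, key]
  exact hf.isSymmSndFDerivAt (by simp) _ _

theorem contDiffAt_pd {f : Pt → E} {p : Pt} (hf : ContDiffAt ℝ ∞ f p) (μ : Fin 4) :
    ContDiffAt ℝ ∞ (pd μ f) p :=
  (hf.fderiv_right (m := ∞) (by simp)).clm_apply contDiffAt_const

/-- A stationary function of `t_*, x`, smooth for `x ≠ 0` and positively homogeneous of
degree `d`. -/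
structure IsHomog (d : ℤ) (f : Pt → E) : Prop where
  smooth : ∀ p, rad p ≠ 0 → ContDiffAt ℝ ∞ f p
  scale : ∀ c : ℝ, 0 < c → ∀ p, rad p ≠ 0 → f (c • p) = c ^ d • f p
  stat : IsStationary f

namespace IsHomog

variable {d d' : ℤ} {f g : Pt → E}

theorem differentiableAt (h : IsHomog d f) {p : Pt} (hp : rad p ≠ 0) : DifferentiableAt ℝ f p :=
  (h.smooth p hp).differentiableAt (by simp)

theorem pd (h : IsHomog d f) (μ : Fin 4) : IsHomog (d - 1) (pd μ f) where
  smooth p hp := contDiffAt_pd (h.smooth p hp) μ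
  stat := h.stat.pd μ
  scale c hc p hp := by
    have hcp : rad (c • p) ≠ 0 := by rw [rad_smul hc.le]; positivity
    have h1 : HasFDerivAt (fun q => f (c • q)) ((fderiv ℝ f (c • p)).comp
        (c • ContinuousLinearMap.id ℝ Pt)) p :=
      HasFDerivAt.comp p (h.differentiableAt hcp).hasFDerivAt
        ((hasFDerivAt_id p).const_smul c)
    have h2 : HasFDerivAt (fun q => c ^ d • f q) (c ^ d • fderiv ℝ f p) p :=
      (h.differentiableAt hp).hasFDerivAt.const_smul _
    have h3 : (fun q => f (c • q)) =ᶠ[𝓝 p] fun q => c ^ d • f q := by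
      filter_upwards [eventually_rad_ne hp] with q hq using h.scale c hc q hq
    have h4 := congrArg (fun L => L (Pi.single μ (1 : ℝ))) (h1.unique (h2.congr_of_eventuallyEq h3))
    simp only [ContinuousLinearMap.comp_apply, smul_apply,
      ContinuousLinearMap.id_apply, map_smul] at h4
    change fderiv ℝ f (c • p) (Pi.single μ 1) = c ^ (d - 1) • fderiv ℝ f p (Pi.single μ 1)
    rw [zpow_sub_one₀ hc.ne', mul_comm, mul_smul, ← h4, smul_smul, inv_mul_cancel₀ hc.ne', one_smul]

/-- Euler's relation. -/
theorem euler (h : IsHomog d f) {p : Pt} (hp : rad p ≠ 0) :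
    p 1 • KerrDecay.pd 1 f p + p 2 • KerrDecay.pd 2 f p + p 3 • KerrDecay.pd 3 f p
      = (d : ℝ) • f p := by
  have h1 : HasDerivAt (fun c : ℝ => f (c • p)) (fderiv ℝ f p p) 1 := by
    have h2 : HasDerivAt (fun c : ℝ => c • p) p 1 := by
      simpa using (hasDerivAt_id (1 : ℝ)).smul_const p
    have h3 : HasFDerivAt f (fderiv ℝ f p) ((1 : ℝ) • p) := by
      rw [one_smul]; exact (h.differentiableAt hp).hasFDerivAt
    exact h3.comp_hasDerivAt 1 h2
  have h2 : HasDerivAt (fun c : ℝ => c ^ d • f p) ((d : ℝ) • f p) 1 := by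
    simpa using (hasDerivAt_zpow d (1 : ℝ) (Or.inl one_ne_zero)).smul_const (f p)
  have h3 : (fun c : ℝ => f (c • p)) =ᶠ[𝓝 1] fun c => c ^ d • f p := by
    filter_upwards [lt_mem_nhds (zero_lt_one' ℝ)] with c hc using h.scale c hc p hp
  rw [← h1.unique (h2.congr_of_eventuallyEq h3)]
  have h4 : p = p 0 • Pi.single 0 1 + p 1 • Pi.single 1 1 + p 2 • Pi.single 2 1
      + p 3 • Pi.single 3 (1 : ℝ) := by
    ext i; fin_cases i <;> simp
  have h5 := h.stat.pd_zero p
  unfold KerrDecay.pd at h5 ⊢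
  have h6 := congrArg (fderiv ℝ f p) h4
  rw [h6]
  simp only [map_add, map_smul, h5, smul_zero, zero_add]

theorem isBigO (h : IsHomog d f) : f =O[atInfinity] fun p => rad p ^ (d : ℝ) := by
  let S : Set Pt := {p | p 0 = 0 ∧ rad p = 1}
  have hS : IsCompact S := by
    apply Metric.isCompact_of_isClosed_isBounded
    · exact (isClosed_eq (continuous_apply 0) continuous_const).inter
        (isClosed_eq continuous_rad continuous_const)
    · rw [isBounded_iff_forall_norm_le]
      refine ⟨1, fun p ⟨h0, h1⟩ => (pi_norm_le_iff_of_nonneg zero_le_one).2 fun i => ?_⟩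
      have h2 := rad_sq p
      rw [h1] at h2
      rw [Real.norm_eq_abs, abs_le_one_iff_mul_self_le_one]
      fin_cases i
      · simp [h0]
      all_goals
        simp only [Fin.reduceFinMk, Fin.mk_one]
        nlinarith [sq_nonneg (p 1), sq_nonneg (p 2), sq_nonneg (p 3)]
  obtain ⟨C, hC⟩ := hS.exists_bound_of_continuousOn (f := f) fun p hp =>
    (h.smooth p (by rw [hp.2]; exact one_ne_zero)).continuousAt.continuousWithinAt
  apply IsBigO.of_bound C
  filter_upwards [eventually_rad_gt 0] with p hp
  set q : Pt := (rad p)⁻¹ • p + Pi.single 0 (-((rad p)⁻¹ * p 0)) with hq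
  have hr : rad ((rad p)⁻¹ • p) = 1 := by
    rw [rad_smul (by positivity), inv_mul_cancel₀ hp.ne']
  have h1 : f p = rad p ^ d • f q := by
    rw [hq, h.stat, ← h.scale _ hp _ (by rw [hr]; exact one_ne_zero), smul_smul,
      mul_inv_cancel₀ hp.ne', one_smul]
  have h2 : q ∈ S := ⟨by simp [hq], by rw [hq, rad_add_single, hr]⟩
  rw [h1, norm_smul, Real.rpow_intCast, mul_comm]
  exact mul_le_mul_of_nonneg_right (hC q h2) (norm_nonneg _)

theorem isSymbol (h : IsHomog d f) (n : ℕ) : IsSymbol n d f := by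
  induction n generalizing d f with
  | zero => exact h.isBigO
  | succ n ih =>
    refine ⟨h.isBigO, ?_, fun μ => (ih (h.pd μ)).mono (by push_cast; rfl)⟩
    filter_upwards [eventually_rad_gt 0] with p hp using h.differentiableAt hp.ne'

theorem const (c : E) : IsHomog 0 fun _ => c :=
  ⟨fun _ _ => contDiffAt_const, fun _ _ _ _ => by simp, fun _ _ => rfl⟩

theorem add (hf : IsHomog d f) (hg : IsHomog d g) : IsHomog d fun p => f p + g p :=
  ⟨fun p hp => (hf.smooth p hp).add (hg.smooth p hp),
    fun c hc p hp => by rw [hf.scale c hc p hp, hg.scale c hc p hp, smul_add],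
    fun p s => by rw [hf.stat, hg.stat]⟩

theorem clm (hf : IsHomog d f) (L : E →L[ℝ] F) : IsHomog d fun p => L (f p) :=
  ⟨fun p hp => L.contDiff.contDiffAt.comp p (hf.smooth p hp),
    fun c hc p hp => by rw [hf.scale c hc p hp, map_smul],
    fun p s => by rw [hf.stat]⟩

theorem neg (hf : IsHomog d f) : IsHomog d fun p => -f p :=
  hf.clm (-ContinuousLinearMap.id ℝ E)

theorem sub (hf : IsHomog d f) (hg : IsHomog d g) : IsHomog d fun p => f p - g p := by
  simpa only [sub_eq_add_neg] using hf.add hg.neg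

theorem sum {ι : Type*} (s : Finset ι) {f : ι → Pt → E} (h : ∀ i ∈ s, IsHomog d (f i)) :
    IsHomog d fun p => ∑ i ∈ s, f i p :=
  ⟨fun p hp => ContDiffAt.sum fun i hi => (h i hi).smooth p hp,
    fun c hc p hp => by
      rw [Finset.smul_sum]
      exact Finset.sum_congr rfl fun i hi => (h i hi).scale c hc p hp,
    fun p s' => Finset.sum_congr rfl fun i hi => (h i hi).stat p s'⟩

theorem mul {f g : Pt → 𝕜} (hf : IsHomog d f) (hg : IsHomog d' g) :
    IsHomog (d + d') fun p => f p * g p :=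
  ⟨fun p hp => (hf.smooth p hp).mul (hg.smooth p hp),
    fun c hc p hp => by
      rw [hf.scale c hc p hp, hg.scale c hc p hp, zpow_add₀ hc.ne', smul_mul_smul_comm],
    fun p s => by rw [hf.stat, hg.stat]⟩

theorem const_mul {f : Pt → 𝕜} (c : 𝕜) (hf : IsHomog d f) : IsHomog d fun p => c * f p := by
  simpa using (const c).mul hf

/-- A homogeneous function which decays faster than its degree allows vanishes off the axis. -/
theorem eq_zero_of_isBigO {q : ℝ} (h : IsHomog d f) (hq : q < d)
    (hO : f =O[atInfinity] fun p => rad p ^ q) {p : Pt} (hp : rad p ≠ 0) (hc : cyl p ≠ 0) :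
    f p = 0 := by
  have hr : 0 < rad p := lt_of_le_of_ne (rad_nonneg p) hp.symm
  obtain ⟨K, hK, hb⟩ := hO.exists_pos
  obtain ⟨R, hR, hb⟩ := eventually_atInfinity.1 hb.bound
  have h1 : ∀ᶠ c : ℝ in atTop, ‖f p‖ ≤ K * rad p ^ q * c ^ (-(d - q)) := by
    filter_upwards [eventually_gt_atTop (R / rad p), eventually_gt_atTop 0] with c h1 h2
    have h3 : rad (c • p) = c * rad p := rad_smul h2.le p
    have h4 : cyl (c • p) ≠ 0 := by
      intro h0
      have h5 := cyl_sq (c • p)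
      rw [h0] at h5
      have h6 := cyl_sq p
      simp only [Pi.smul_apply, smul_eq_mul] at h5
      have : c ^ 2 * cyl p ^ 2 = 0 := by rw [h6]; linarith
      simp [hc, h2.ne'] at this
    have h5 := hb (c • p) (by rw [h3]; rwa [div_lt_iff₀ hr] at h1) h4
    rw [h.scale c h2 p hp, h3, norm_smul, Real.norm_of_nonneg (by positivity),
      Real.norm_of_nonneg (by positivity), Real.mul_rpow h2.le hr.le] at h5
    rw [neg_sub, Real.rpow_sub h2, Real.rpow_intCast]
    have h6 : 0 < c ^ d := zpow_pos h2 d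
    rw [← mul_div_assoc, le_div_iff₀ h6]
    linarith
  have h2 : Tendsto (fun c : ℝ => K * rad p ^ q * c ^ (-(d - q))) atTop (𝓝 0) := by
    simpa using (tendsto_rpow_neg_atTop (sub_pos.2 hq)).const_mul (K * rad p ^ q)
  exact norm_le_zero_iff.1 (ge_of_tendsto h2 h1)

/-- Vanishing off the axis extends to the axis by continuity. -/
theorem eq_zero_of_off_axis (h : IsHomog d f)
    (h0 : ∀ p, rad p ≠ 0 → cyl p ≠ 0 → f p = 0) {p : Pt} (hp : rad p ≠ 0) : f p = 0 := by
  by_cases hc : cyl p = 0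
  · have h12 : p 1 ^ 2 + p 2 ^ 2 = 0 := by rw [← cyl_sq, hc]; ring
    have h1 : p 1 = 0 := by nlinarith [sq_nonneg (p 1), sq_nonneg (p 2)]
    have hcont : Tendsto (fun s : ℝ => f (p + Pi.single 1 s)) (𝓝[≠] 0) (𝓝 (f p)) := by
      have h2 : Tendsto (fun s : ℝ => p + Pi.single (1 : Fin 4) s) (𝓝 0) (𝓝 p) := by
        have : Continuous fun s : ℝ => p + Pi.single (1 : Fin 4) s :=
          continuous_const.add (continuous_single (A := fun _ : Fin 4 => ℝ) 1)
        simpa using this.tendsto 0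
      exact ((h.smooth p hp).continuousAt.tendsto.comp h2).mono_left nhdsWithin_le_nhds
    have hz : (fun s : ℝ => f (p + Pi.single 1 s)) =ᶠ[𝓝[≠] 0] fun _ => 0 := by
      filter_upwards [self_mem_nhdsWithin] with s hs
      have h3 : cyl (p + Pi.single 1 s) ≠ 0 := by
        intro h
        have := cyl_sq (p + Pi.single 1 s)
        rw [h] at this
        simp [h1] at this
        have hs' : s ≠ 0 := hs
        have := sq_pos_of_ne_zero hs'
        nlinarith [sq_nonneg (p 2)]
      refine h0 _ (fun hr => ?_) h3
      have h4 := rad_sq (p + Pi.single 1 s)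
      rw [hr] at h4
      have h5 := cyl_sq (p + Pi.single 1 s)
      have := sq_pos_of_ne_zero h3
      nlinarith [sq_nonneg ((p + Pi.single 1 s : Pt) 3)]
    exact tendsto_nhds_unique (hcont.congr' hz) tendsto_const_nhds
  · exact h0 p hp hc

end IsHomog

theorem isHomog_coord {i : Fin 4} (hi : i ≠ 0) : IsHomog 1 fun p : Pt => p i :=
  ⟨fun _ _ => by fun_prop, fun c _ p _ => by simp, fun p s => by simp [hi]⟩

theorem isHomog_rad : IsHomog 1 rad :=
  ⟨fun _ hp => contDiffAt_rad hp, fun c hc p _ => by simp [rad_smul hc.le],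
    fun p s => rad_add_single p s⟩

theorem isHomog_rad_inv : IsHomog (-1) fun p => (rad p)⁻¹ :=
  ⟨fun _ hp => (contDiffAt_rad hp).inv hp,
    fun c hc p _ => by simp [rad_smul hc.le, mul_comm],
    fun p s => by rw [rad_add_single]⟩

theorem isHomog_dr (i : Fin 4) : IsHomog 0 fun p => dr p i := by
  have key : ∀ i : Fin 4, i ≠ 0 → IsHomog 0 fun p : Pt => p i / rad p := fun i hi =>
    (isHomog_coord hi).mul isHomog_rad_inv
  fin_cases i
  · exact IsHomog.const 0
  · exact key 1 (by decide)
  · exact key 2 (by decide)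
  · exact key 3 (by decide)

theorem pd_rad {p : Pt} (hp : rad p ≠ 0) (i : Fin 4) : pd i rad p = dr p i := by
  have h1 : HasFDerivAt rad (fderiv ℝ rad p) p :=
    ((contDiffAt_rad hp).differentiableAt (by simp)).hasFDerivAt
  have h2 := congrArg (fun L => L (Pi.single i (1 : ℝ))) ((h1.pow 2).unique
    ((((hasFDerivAt_apply (𝕜 := ℝ) (1 : Fin 4) p).pow 2).add
    ((hasFDerivAt_apply (𝕜 := ℝ) (2 : Fin 4) p).pow 2)).add
    ((hasFDerivAt_apply (𝕜 := ℝ) (3 : Fin 4) p).pow 2) |>.congr_of_eventuallyEq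
      (Eventually.of_forall fun q => by
        simpa using rad_sq q)))
  unfold pd
  fin_cases i <;> simp [dr] at h2 ⊢
  · exact h2.resolve_left hp
  all_goals
    field_simp
    linarith

end

section

/-! ### The Minkowski metric in retarded time -/

/-- The one-form `dt_* + dr`, the differential of the Minkowski time. -/
def dtime (p : Pt) : Fin 4 → ℝ := ![1, 0, 0, 0] + dr p

/-- The Euclidean metric of space. -/
def spatial : Matrix (Fin 4) (Fin 4) ℝ := Matrix.diagonal ![0, 1, 1, 1]

/-- The Minkowski metric `(dt_* + dr)² - dx²`. -/
def mink : Bilin := fun p => sq (dtime p) - spatial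

/-- The inverse of the Minkowski metric in the coordinates `(t_*, x)`. -/
def minkInv (p : Pt) : Matrix (Fin 4) (Fin 4) ℝ :=
  !![0, dr p 1, dr p 2, dr p 3; dr p 1, -1, 0, 0; dr p 2, 0, -1, 0; dr p 3, 0, 0, -1]

theorem two_le_infty : (2 : WithTop ℕ∞) ≤ ∞ := ENat.LEInfty.out

theorem dr_sq {p : Pt} (hp : rad p ≠ 0) : dr p 1 ^ 2 + dr p 2 ^ 2 + dr p 3 ^ 2 = 1 := by
  have := rad_sq p
  simp only [dr, Matrix.cons_val]
  field_simp
  linarith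

theorem dr_zero (p : Pt) : dr p 0 = 0 := rfl

theorem mink_apply (p : Pt) (μ ν : Fin 4) :
    mink p μ ν = dtime p μ * dtime p ν - spatial μ ν := rfl

theorem mink_symm (p : Pt) (μ ν : Fin 4) : mink p μ ν = mink p ν μ := by
  rw [mink_apply, mink_apply, mul_comm, spatial, ← Matrix.diagonal_transpose,
    Matrix.transpose_apply, Matrix.diagonal_transpose]

theorem mink_eq (p : Pt) : mink p =
    !![1, dr p 1, dr p 2, dr p 3;
      dr p 1, dr p 1 ^ 2 - 1, dr p 1 * dr p 2, dr p 1 * dr p 3;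
      dr p 2, dr p 1 * dr p 2, dr p 2 ^ 2 - 1, dr p 2 * dr p 3;
      dr p 3, dr p 1 * dr p 3, dr p 2 * dr p 3, dr p 3 ^ 2 - 1] := by
  ext μ ν
  rw [mink_apply]
  fin_cases μ <;> fin_cases ν <;> simp [dtime, spatial, dr_zero] <;> ring

theorem mink_mul_minkInv {p : Pt} (hp : rad p ≠ 0) : mink p * minkInv p = 1 := by
  have h := dr_sq hp
  rw [mink_eq, minkInv]
  ext μ ν
  fin_cases μ <;> fin_cases ν <;> simp [Matrix.mul_apply, Fin.sum_univ_four] <;> first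
    | ring1
    | linear_combination h
    | linear_combination (dr p 1) * h
    | linear_combination (dr p 2) * h
    | linear_combination (dr p 3) * h

theorem mink_inv {p : Pt} (hp : rad p ≠ 0) : (mink p)⁻¹ = minkInv p :=
  Matrix.inv_eq_right_inv (mink_mul_minkInv hp)

theorem det_mink {p : Pt} (hp : rad p ≠ 0) : (mink p).det = -1 := by
  have h := dr_sq hp
  rw [mink_eq]
  simp [Matrix.det_succ_row_zero, Fin.sum_univ_succ, Fin.succAbove]
  ring

/-- The gradient of the Minkowski time is `∂_{t_*}`. -/
theorem sum_mink_inv_dtime {p : Pt} (hp : rad p ≠ 0) (c : Fin 4) :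
    ∑ d, (mink p)⁻¹ c d * dtime p d = if c = 0 then 1 else 0 := by
  have h := dr_sq hp
  rw [mink_inv hp, minkInv]
  fin_cases c <;> simp [Fin.sum_univ_four, dtime, dr_zero]
  linear_combination h

theorem isHomog_dtime (i : Fin 4) : IsHomog 0 fun p => dtime p i :=
  (IsHomog.const ((![1, 0, 0, 0] : Fin 4 → ℝ) i)).add (isHomog_dr i)

theorem isHomog_mink (μ ν : Fin 4) : IsHomog 0 fun p => mink p μ ν :=
  ((isHomog_dtime μ).mul (isHomog_dtime ν)).sub (IsHomog.const (spatial μ ν))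

theorem pd_dtime {p : Pt} (hp : rad p ≠ 0) (a i : Fin 4) :
    pd a (fun q => dtime q i) p = pd a (pd i rad) p := by
  have h1 : (fun q => dtime q i) =ᶠ[𝓝 p] fun q => (![1, 0, 0, 0] : Fin 4 → ℝ) i + pd i rad q := by
    filter_upwards [eventually_rad_ne hp] with q hq
    rw [pd_rad hq]; rfl
  rw [pd_congr h1, pd_add (differentiableAt_const _), pd_const, zero_add]
  exact (isHomog_rad.pd i).differentiableAt hp

/-- In the coordinates `(t_*, x)` the only Christoffel symbols of Minkowski space are those of
`t_*`, namely the second derivatives of `r`. -/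
theorem christoffel_mink {p : Pt} (hp : rad p ≠ 0) (c a b : Fin 4) :
    christoffel mink c a b p = if c = 0 then pd a (pd b rad) p else 0 := by
  have hg : ∀ a d b, pd a (fun q => mink q d b) p
      = dtime p d * pd a (pd b rad) p + dtime p b * pd a (pd d rad) p := by
    intro a d b
    have h1 : (fun q => mink q d b) = fun q => dtime q d * dtime q b - spatial d b := rfl
    have hd := (isHomog_dtime d).differentiableAt hp
    have hb := (isHomog_dtime b).differentiableAt hp
    rw [h1, pd_sub (hd.fun_mul hb) (differentiableAt_const _), pd_const, sub_zero, pd_mul hd hb,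
      pd_dtime hp, pd_dtime hp]
  have hs : ∀ a b, pd a (pd b rad) p = pd b (pd a rad) p :=
    pd_comm ((contDiffAt_rad hp).of_le two_le_infty)
  unfold christoffel
  simp only [hg]
  have h2 : ∀ d, (mink p)⁻¹ c d * (dtime p d * pd a (pd b rad) p + dtime p b * pd a (pd d rad) p
      + (dtime p d * pd b (pd a rad) p + dtime p a * pd b (pd d rad) p)
      - (dtime p a * pd d (pd b rad) p + dtime p b * pd d (pd a rad) p))
      = 2 * pd a (pd b rad) p * ((mink p)⁻¹ c d * dtime p d) := by
    intro d
    rw [hs b a, hs d a, hs d b]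
    ring
  rw [Finset.sum_congr rfl fun d _ => h2 d, ← Finset.mul_sum, sum_mink_inv_dtime hp]
  split_ifs <;> ring

/-- Minkowski space is flat. -/
theorem riem_mink {p : Pt} (hp : rad p ≠ 0) (a b c d : Fin 4) : riem mink p a b c d = 0 := by
  have h0 : ∀ k c b, christoffel mink k c b =ᶠ[𝓝 p]
      fun q => if k = 0 then pd c (pd b rad) q else 0 := by
    intro k c b
    filter_upwards [eventually_rad_ne hp] with q hq using christoffel_mink hq k c b
  have h00 : ∀ c, pd c (pd 0 rad) p = 0 := by
    intro c
    rw [pd_comm ((contDiffAt_rad hp).of_le two_le_infty)]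
    exact (isHomog_rad.stat.pd c).pd_zero p
  unfold riem
  rw [neg_eq_zero]
  refine Finset.sum_eq_zero fun k _ => ?_
  rw [pd_congr (h0 k b d), pd_congr (h0 k b c)]
  simp only [christoffel_mink hp]
  by_cases hk : k = 0
  · subst hk
    simp only [if_true, Fin.sum_univ_four]
    have hs : ∀ a b, pd a (pd b rad) =ᶠ[𝓝 p] pd b (pd a rad) := fun a b => by
      filter_upwards [eventually_rad_ne hp] with q hq
      exact pd_comm ((contDiffAt_rad hq).of_le two_le_infty) a b
    have h3 : pd c (pd b (pd d rad)) p = pd d (pd b (pd c rad)) p := by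
      rw [pd_congr (hs b d), pd_congr (hs b c)]
      exact pd_comm (((isHomog_rad.pd b).smooth p hp).of_le two_le_infty) c d
    have h3' : pd c (fun q => pd b (pd d rad) q) p = pd d (fun q => pd b (pd c rad) q) p := h3
    rw [h3']
    simp [h00]
  · simp [hk, pd_const]

/-! ### The Kerr metric near infinity -/

theorem isSymbol_rad (n : ℕ) : IsSymbol n 1 rad := by simpa using isHomog_rad.isSymbol n
theorem isSymbol_dr (n : ℕ) (i : Fin 4) : IsSymbol n 0 fun p => dr p i := by
  simpa using (isHomog_dr i).isSymbol n

theorem isSymbol_cosθ (n : ℕ) : IsSymbol n 0 cosθ := isSymbol_dr n 3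

theorem isSymbol_rad_sq (n : ℕ) : IsSymbol n 2 fun p => rad p ^ 2 := by
  simpa using (isSymbol_rad n).pow 2

variable {n : ℕ} (M a : ℝ)

theorem asy_Del : Asy n 1 2 (Del M a) fun p => rad p ^ 2 := by
  refine ⟨?_, isSymbol_rad_sq n, ?_⟩
  · unfold Del
    exact ((isSymbol_rad_sq n).sub (((isSymbol_rad n).const_mul (2 * M)).mono (by norm_num))).add
      ((IsSymbol.const n _).mono (by norm_num))
  · refine ((((isSymbol_rad n).const_mul (-(2 * M))).mono (by norm_num)).add
      ((IsSymbol.const n (a ^ 2)).mono (by norm_num : (0 : ℝ) ≤ 2 - 1))).congr ?_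
    exact Eventually.of_forall fun p => by simp only [Del]; ring

theorem asy_Sig : Asy n 2 2 (Sig a) fun p => rad p ^ 2 := by
  have h : IsSymbol n 0 fun p => a ^ 2 * cosθ p ^ 2 := by
    simpa using ((isSymbol_cosθ n).pow 2).const_mul (a ^ 2)
  refine ⟨(isSymbol_rad_sq n).add (h.mono (by norm_num)), isSymbol_rad_sq n, ?_⟩
  exact (h.mono (by norm_num)).congr (Eventually.of_forall fun p => by simp only [Sig]; ring)

theorem asy_rad_sq_add : Asy n 2 2 (fun p => rad p ^ 2 + a ^ 2) fun p => rad p ^ 2 := by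
  refine ⟨(isSymbol_rad_sq n).add ((IsSymbol.const n _).mono (by norm_num)),
    isSymbol_rad_sq n, ?_⟩
  exact ((IsSymbol.const n (a ^ 2)).mono (by norm_num)).congr
    (Eventually.of_forall fun p => by ring)

theorem rad_sq_lower : ∀ᶠ p in atInfinity, 1 * rad p ^ (2 : ℝ) ≤ ‖rad p ^ 2‖ := by
  filter_upwards with p
  rw [one_mul, Real.norm_of_nonneg (by positivity)]
  simp

theorem asy_Del_inv : Asy n 1 (-2) (fun p => (Del M a p)⁻¹) fun p => (rad p ^ 2)⁻¹ :=
  (asy_Del M a).inv one_pos one_pos rad_sq_lower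

theorem asy_Sig_inv : Asy n 2 (-2) (fun p => (Sig a p)⁻¹) fun p => (rad p ^ 2)⁻¹ :=
  (asy_Sig a).inv two_pos one_pos rad_sq_lower

theorem rad_sq_mul_inv :
    (fun p => rad p ^ 2 * (rad p ^ 2)⁻¹) =ᶠ[atInfinity] fun _ => (1 : ℝ) := by
  filter_upwards [eventually_rad_gt 0] with p hp
  field_simp

theorem Asy.div_one {f g : Pt → ℝ} {δ : ℝ} (hf : Asy n δ 2 f fun p => rad p ^ 2)
    (hg : Asy n δ (-2) (fun p => (g p)⁻¹) fun p => (rad p ^ 2)⁻¹) :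
    Asy n δ 0 (fun p => f p / g p) fun _ => (1 : ℝ) := by
  have h := hf.mul hg
  norm_num at h
  exact h.congr (Eventually.of_forall fun p => (div_eq_mul_inv _ _).symm) rad_sq_mul_inv

theorem asy_Del_div_Sig : Asy n 1 0 (fun p => Del M a p / Sig a p) fun _ => (1 : ℝ) :=
  (asy_Del M a).div_one ((asy_Sig_inv a).mono_delta (by norm_num))

theorem asy_Sig_div_Del : Asy n 1 0 (fun p => Sig a p / Del M a p) fun _ => (1 : ℝ) :=
  ((asy_Sig a).mono_delta (by norm_num)).div_one (asy_Del_inv M a)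

theorem asy_R_div_Del : Asy n 1 0 (fun p => (rad p ^ 2 + a ^ 2) / Del M a p) fun _ => (1 : ℝ) :=
  ((asy_rad_sq_add a).mono_delta (by norm_num)).div_one (asy_Del_inv M a)

theorem asy_R_div_Sig : Asy n 2 0 (fun p => (rad p ^ 2 + a ^ 2) / Sig a p) fun _ => (1 : ℝ) :=
  (asy_rad_sq_add a).div_one (asy_Sig_inv a)

/-- The one-form `sin² θ dφ = (x¹ dx² - x² dx¹) / r²`. -/
def sdφ (p : Pt) : Fin 4 → ℝ := (rad p ^ 2)⁻¹ • ![0, -p 2, p 1, 0]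

theorem isHomog_sdφ (i : Fin 4) : IsHomog (-1) fun p => sdφ p i := by
  have h2 : IsHomog (-2) fun p => (rad p ^ 2)⁻¹ := by
    have h := isHomog_rad_inv.mul isHomog_rad_inv
    simp only [← pow_two, inv_pow] at h
    exact h
  have h0 : ∀ i : Fin 4, IsHomog 1 fun p : Pt => (![0, -p 2, p 1, 0] : Fin 4 → ℝ) i := by
    intro i
    fin_cases i
    · refine ⟨fun _ _ => contDiffAt_const, fun _ _ _ _ => by simp, fun _ _ => rfl⟩
    · exact (isHomog_coord (by decide)).neg
    · exact isHomog_coord (by decide)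
    · refine ⟨fun _ _ => contDiffAt_const, fun _ _ _ _ => by simp, fun _ _ => rfl⟩
  exact h2.mul (h0 i)

theorem isSymbol_sdφ (n : ℕ) (i : Fin 4) : IsSymbol n (-1) fun p => sdφ p i := by
  simpa using (isHomog_sdφ i).isSymbol n

theorem sinθ_sq {p : Pt} (hp : rad p ≠ 0) : sinθ p ^ 2 = 1 - cosθ p ^ 2 := by
  have h1 := rad_sq p
  have h2 := cyl_sq p
  simp only [sinθ, cosθ, div_pow]
  field_simp
  linarith

theorem sinθ_sq_smul_dφ {p : Pt} (hp : rad p ≠ 0) (hc : cyl p ≠ 0) (i : Fin 4) :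
    sinθ p ^ 2 * dφ p i = sdφ p i := by
  simp only [sinθ, dφ, sdφ, Pi.smul_apply, smul_eq_mul]
  field_simp

/-- The round metric `dθ² + sin² θ dφ²`, with the part along `dφ` moved to the other side. -/
theorem dθ_mul_dθ {p : Pt} (hp : rad p ≠ 0) (hc : cyl p ≠ 0) (i j : Fin 4) :
    dθ p i * dθ p j = (spatial i j - dr p i * dr p j) / rad p ^ 2
      - sinθ p ^ 2 * dφ p i * dφ p j := by
  have h1 := rad_sq p
  have h2 := cyl_sq p
  have h3 : rad p ^ 2 = cyl p ^ 2 + p 3 ^ 2 := by linarith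
  fin_cases i <;> fin_cases j <;>
    simp [dθ, dr, dφ, spatial, sinθ, cosθ] <;> field_simp <;>
    · simp only [h3, h2]
      ring

/-- The Kerr metric without the coordinate singularity on the axis. -/
theorem kerr_apply {p : Pt} (hp : rad p ≠ 0) (hc : cyl p ≠ 0) (hS : Sig a p ≠ 0)
    (hD : Del M a p ≠ 0) (i j : Fin 4) :
    kerr M a p i j = Del M a p / Sig a p * ((dt M a p i - a * sdφ p i) * (dt M a p j - a * sdφ p j))
      - Sig a p / Del M a p * (dr p i * dr p j)
      - Sig a p / rad p ^ 2 * (spatial i j - dr p i * dr p j)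
      - a ^ 2 * ((rad p ^ 2 + a ^ 2) / Sig a p + 1) * (sdφ p i * sdφ p j)
      + a * ((rad p ^ 2 + a ^ 2) / Sig a p) * (dt M a p i * sdφ p j + sdφ p i * dt M a p j)
      - a ^ 2 * (1 - cosθ p ^ 2) * (Sig a p)⁻¹ * (dt M a p i * dt M a p j) := by
  simp only [kerr, sq, Matrix.vecMulVec, Matrix.sub_apply, Matrix.smul_apply, Matrix.of_apply,
    Matrix.add_apply, smul_eq_mul, Pi.sub_apply, Pi.smul_apply]
  rw [dθ_mul_dθ hp hc, ← sinθ_sq_smul_dφ hp hc, ← sinθ_sq_smul_dφ hp hc, ← sinθ_sq hp]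
  have hR : rad p ^ 2 + a ^ 2 = Sig a p + a ^ 2 * sinθ p ^ 2 := by
    rw [sinθ_sq hp, Sig]; ring
  rw [hR]
  field_simp
  ring

theorem eventually_Del_ne : ∀ᶠ p in atInfinity, Del M a p ≠ 0 :=
  (asy_Del (n := 0) M a).eventually_ne one_pos one_pos rad_sq_lower

theorem Sig_pos {p : Pt} (hp : rad p ≠ 0) : 0 < Sig a p := by
  unfold Sig
  have := sq_pos_of_ne_zero hp
  positivity

theorem asy_dt (i : Fin 4) : Asy n 1 0 (fun p => dt M a p i) fun p => dtime p i := by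
  have h := (asy_R_div_Del (n := n) M a).mul_zero' (Asy.refl (isSymbol_dr n i) 1)
  exact ((Asy.const n 1 ((![1, 0, 0, 0] : Fin 4 → ℝ) i)).add h).congr
    (Eventually.of_forall fun p => rfl) (Eventually.of_forall fun p => by simp [dtime])

theorem asy_a_sdφ (i : Fin 4) : Asy n 1 0 (fun p => a * sdφ p i) fun _ => (0 : ℝ) :=
  Asy.of_lower (((isSymbol_sdφ n i).const_mul a).mono (by norm_num)) (by norm_num)

/-- The Kerr metric tends to the Minkowski metric. -/
theorem asy_kerr (i j : Fin 4) : Asy n 1 0 (fun p => kerr M a p i j) fun p => mink p i j := by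
  have hR := (asy_R_div_Sig (n := n) a)
  have hω : ∀ i, Asy n 1 0 (fun p => sdφ p i) fun _ => (0 : ℝ) := fun i =>
    Asy.of_lower ((isSymbol_sdφ n i).mono (by norm_num)) (by norm_num)
  have hX : ∀ i, Asy n 1 0 (fun p => dr p i) fun p => dr p i := fun i =>
    Asy.refl (isSymbol_dr n i) 1
  have hS : Asy n 1 0 (fun p => Sig a p / rad p ^ 2) fun _ => (1 : ℝ) :=
    ((asy_Sig a).mono_delta (by norm_num)).div_one
      (((Asy.refl (isSymbol_rad_sq n) 1)).inv one_pos one_pos rad_sq_lower)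
  have hSi : Asy n 1 0 (fun p => (Sig a p)⁻¹) fun _ => (0 : ℝ) :=
    Asy.of_lower ((asy_Sig_inv a).left.mono (by norm_num)) (by norm_num)
  have hc : Asy n 1 0 (fun p => a ^ 2 * (1 - cosθ p ^ 2)) fun p => a ^ 2 * (1 - cosθ p ^ 2) := by
    refine Asy.refl ?_ 1
    have h1 : IsSymbol n 0 fun p => cosθ p ^ 2 := by simpa using (isSymbol_cosθ n).pow 2
    exact ((IsSymbol.const n 1).sub h1).const_mul _
  have ht := fun i => (asy_dt (n := n) M a i).sub (asy_a_sdφ a i)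
  have h1 := (asy_Del_div_Sig M a).mul_zero' ((ht i).mul_zero' (ht j))
  have h2 := (asy_Sig_div_Del M a).mul_zero' ((hX i).mul_zero' (hX j))
  have h3 := hS.mul_zero' ((Asy.const n 1 (spatial i j)).sub ((hX i).mul_zero' (hX j)))
  have h4 := (((hR.mono_delta one_le_two).add (Asy.const n 1 1)).const_mul (a ^ 2)).mul_zero'
    ((hω i).mul_zero' (hω j))
  have h5 := ((hR.mono_delta one_le_two).const_mul a).mul_zero'
    (((asy_dt M a i).mul_zero' (hω j)).add ((hω i).mul_zero' (asy_dt M a j)))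
  have h6 := (hc.mul_zero' hSi).mul_zero' ((asy_dt M a i).mul_zero' (asy_dt M a j))
  refine (((((h1.sub h2).sub h3).sub h4).add h5).sub h6).congr ?_ ?_
  · filter_upwards [eventually_rad_gt 0, eventually_cyl_ne, eventually_Del_ne M a] with p hp hc hD
    exact (kerr_apply M a hp.ne' hc (Sig_pos a hp.ne').ne' hD i j).symm
  · filter_upwards with p
    rw [mink_apply]
    ring

theorem Asy.det {δ : ℝ} {ι : Type*} [Fintype ι] [DecidableEq ι] {A A₀ : Pt → Matrix ι ι ℝ}
    (h : ∀ i j, Asy n δ 0 (fun p => A p i j) fun p => A₀ p i j) :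
    Asy n δ 0 (fun p => (A p).det) fun p => (A₀ p).det := by
  simp only [Matrix.det_apply']
  exact Asy.sum _ fun σ _ => (Asy.prod _ fun i _ => h _ _).const_mul _

theorem Asy.adjugate {δ : ℝ} {ι : Type*} [Fintype ι] [DecidableEq ι] {A A₀ : Pt → Matrix ι ι ℝ}
    (h : ∀ i j, Asy n δ 0 (fun p => A p i j) fun p => A₀ p i j) (i j : ι) :
    Asy n δ 0 (fun p => (A p).adjugate i j) fun p => (A₀ p).adjugate i j := by
  simp only [Matrix.adjugate_apply]
  refine Asy.det fun k l => ?_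
  by_cases hk : k = j
  · subst hk
    simpa only [Matrix.updateRow_self] using Asy.const n δ _
  · simpa only [Matrix.updateRow_ne hk] using h k l

theorem asy_kerr_det : Asy n 1 0 (fun p => (kerr M a p).det) fun p => (mink p).det :=
  Asy.det fun i j => asy_kerr M a i j

theorem det_mink_lower : ∀ᶠ p in atInfinity, 1 * rad p ^ (0 : ℝ) ≤ ‖(mink p).det‖ := by
  filter_upwards [eventually_rad_gt 0] with p hp
  rw [det_mink hp.ne']
  simp

theorem asy_kerr_inv (i j : Fin 4) :
    Asy n 1 0 (fun p => (kerr M a p)⁻¹ i j) fun p => (mink p)⁻¹ i j := by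
  have h1 := (asy_kerr_det (n := n) M a).inv one_pos one_pos det_mink_lower
  rw [neg_zero] at h1
  have h2 := h1.mul_zero' (Asy.adjugate (fun i j => asy_kerr (n := n) M a i j) i j)
  simpa only [Matrix.inv_def, Ring.inverse_eq_inv', Matrix.smul_apply, smul_eq_mul] using h2

theorem eventually_kerr_det_ne : ∀ᶠ p in atInfinity, (kerr M a p).det ≠ 0 :=
  (asy_kerr_det (n := 0) M a).eventually_ne one_pos one_pos det_mink_lower

theorem asy_christoffel (c i j : Fin 4) :
    Asy n 1 (-1) (christoffel (kerr M a) c i j) (christoffel mink c i j) := by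
  have h : ∀ i j k, Asy n 1 (-1) (pd i fun q => kerr M a q j k) (pd i fun q => mink q j k) := by
    intro i j k
    simpa using (asy_kerr M a j k).pd i
  exact (Asy.sum _ fun d _ => (asy_kerr_inv M a c d).mul_zero'
    (((h i d j).add (h j d i)).sub (h d i j))).const_mul (1 / 2)

theorem asy_riem (i j k l : Fin 4) :
    Asy n 1 (-2) (fun p => riem (kerr M a) p i j k l) fun p => riem mink p i j k l := by
  have h1 : ∀ k c i j, Asy n 1 (-2) (pd k (christoffel (kerr M a) c i j))
      (pd k (christoffel mink c i j)) := fun k c i j =>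
    ((asy_christoffel M a c i j).pd k).mono (by norm_num)
  have h2 : ∀ c i j c' i' j', Asy n 1 (-2)
      (fun p => christoffel (kerr M a) c i j p * christoffel (kerr M a) c' i' j' p)
      (fun p => christoffel mink c i j p * christoffel mink c' i' j' p) := fun c i j c' i' j' =>
    ((asy_christoffel M a c i j).mul (asy_christoffel M a c' i' j')).mono (by norm_num)
  exact (Asy.sum _ fun m _ => (asy_kerr M a i m).mul_zero' (((h1 k m j l).sub (h1 l m j k)).add
    (Asy.sum _ fun e _ => (h2 m k e e j l).sub (h2 m l e e j k)))).neg

/-- Since Minkowski space is flat, the curvature of Kerr is smaller by one order than the count of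
derivatives gives. -/
theorem isSymbol_riem (i j k l : Fin 4) :
    IsSymbol n (-3) fun p => riem (kerr M a) p i j k l := by
  refine ((asy_riem M a i j k l).diff.mono (by norm_num)).congr ?_
  filter_upwards [eventually_rad_gt 0] with p hp
  rw [riem_mink hp.ne', sub_zero]

theorem isSymbol_weyl (i : Fin 4 → Fin 4) : IsSymbol n (-3) fun p => weyl (kerr M a) p i := by
  have hg := fun i j => (asy_kerr (n := n) M a i j).left
  have hgi := fun i j => (asy_kerr_inv (n := n) M a i j).left
  have hric : ∀ b d, IsSymbol n (-3) fun p => ric (kerr M a) p b d := fun b d =>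
    IsSymbol.sum _ fun i _ => IsSymbol.sum _ fun j _ =>
      ((hgi i j).mul (isSymbol_riem M a i b j d)).mono (by norm_num)
  have hscal : IsSymbol n (-3) fun p => scal (kerr M a) p :=
    IsSymbol.sum _ fun i _ => IsSymbol.sum _ fun j _ =>
      ((hgi i j).mul (hric i j)).mono (by norm_num)
  have hgr : ∀ a' c b d, IsSymbol n (-3) fun p => kerr M a p a' c * ric (kerr M a) p b d :=
    fun a' c b d => ((hg a' c).mul (hric b d)).mono (by norm_num)
  have hgg : ∀ a' c b d, IsSymbol n 0 fun p => kerr M a p a' c * kerr M a p b d :=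
    fun a' c b d => ((hg a' c).mul (hg b d)).mono (by norm_num)
  refine IsSymbol.ofReal (((isSymbol_riem M a _ _ _ _).sub
    (((((hgr _ _ _ _).sub (hgr _ _ _ _)).sub (hgr _ _ _ _)).add (hgr _ _ _ _)).const_mul
      (1 / 2))).add ?_)
  have := (hscal.const_mul (1 / 6)).mul ((hgg (i 0) (i 2) (i 1) (i 3)).sub
    (hgg (i 0) (i 3) (i 1) (i 2)))
  refine (this.mono (by norm_num)).congr (Eventually.of_forall fun p => by ring)

/-- The covariant derivative lowers the order by one, and to leading order it is that of
Minkowski space. -/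
theorem Asy.covD {δ q : ℝ} (hδ : δ ≤ 1) {m : ℕ} {T T₀ : Tensor m}
    (h : ∀ i, Asy (n + 1) δ q (fun p => T p i) fun p => T₀ p i) (i : Fin (m + 1) → Fin 4) :
    Asy n δ (q - 1) (fun p => covD (kerr M a) T p i) fun p => covD mink T₀ p i := by
  refine ((h _).pd (i 0)).sub (Asy.sum _ fun j _ => Asy.sum _ fun c _ => ?_)
  exact ((((asy_christoffel M a c _ _).ofReal).mono_delta hδ).mul
    ((h _).of_le n.le_succ)).mono (by linarith)

end

section

/-! ### The tetrad near infinity -/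

variable {n : ℕ} (M a : ℝ)

theorem isHomog_vφ (i : Fin 4) : IsHomog 1 fun p => vφ p i := by
  fin_cases i
  · refine ⟨fun _ _ => contDiffAt_const, fun _ _ _ _ => by simp [vφ], fun _ _ => rfl⟩
  · exact (isHomog_coord (by decide)).neg
  · exact isHomog_coord (by decide)
  · refine ⟨fun _ _ => contDiffAt_const, fun _ _ _ _ => by simp [vφ], fun _ _ => rfl⟩

theorem isSymbol_vφ (n : ℕ) (i : Fin 4) : IsSymbol n 1 fun p => vφ p i := by
  simpa using (isHomog_vφ i).isSymbol n

/-- The real components of `ℓ`. -/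
def ellR (p : Pt) (μ : Fin 4) : ℝ :=
  (rad p ^ 2 + a ^ 2) / Del M a p * vt p μ + vr M a p μ + a / Del M a p * vφ p μ

/-- The real components of `n`. -/
def nnR (p : Pt) (μ : Fin 4) : ℝ :=
  (rad p ^ 2 + a ^ 2) / (2 * Sig a p) * vt p μ - Del M a p / (2 * Sig a p) * vr M a p μ
    + a / (2 * Sig a p) * vφ p μ

theorem ell_eq (p : Pt) (μ : Fin 4) : ell M a p μ = (ellR M a p μ : ℂ) := rfl
theorem nn_eq (p : Pt) (μ : Fin 4) : nn M a p μ = (nnR M a p μ : ℂ) := rfl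

theorem vr_eq (p : Pt) (μ : Fin 4) :
    vr M a p μ = dr p μ - (rad p ^ 2 + a ^ 2) / Del M a p * vt p μ := by
  fin_cases μ <;> simp [vr, dr, vt]

theorem ellR_eq (p : Pt) (μ : Fin 4) : ellR M a p μ = dr p μ + a / Del M a p * vφ p μ := by
  rw [ellR, vr_eq]; ring

theorem ellR_zero (p : Pt) : ellR M a p 0 = 0 := by
  rw [ellR_eq]; simp [dr, vφ]

variable {M a} in
theorem nnR_eq {p : Pt} (hS : Sig a p ≠ 0) (hD : Del M a p ≠ 0) (μ : Fin 4) :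
    nnR M a p μ = (rad p ^ 2 + a ^ 2) / Sig a p * vt p μ - (1 / 2) * (Del M a p / Sig a p * dr p μ)
      + (1 / 2) * (a * (Sig a p)⁻¹ * vφ p μ) := by
  rw [nnR, vr_eq]; field_simp; ring

theorem asy_ellR (μ : Fin 4) : Asy n 1 0 (fun p => ellR M a p μ) fun p => dr p μ := by
  have h : IsSymbol n (-1) fun p => a / Del M a p * vφ p μ := by
    have := (((asy_Del_inv (n := n) M a).left.const_mul a).mul (isSymbol_vφ n μ))
    exact (this.mono (by norm_num)).congr (Eventually.of_forall fun p => by simp [div_eq_mul_inv])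
  exact ((Asy.refl (isSymbol_dr n μ) 1).add (Asy.of_lower (h.mono (by norm_num)) zero_le_one)).congr
    (Eventually.of_forall fun p => (ellR_eq M a p μ).symm) (Eventually.of_forall fun p => by simp)

theorem asy_nnR (μ : Fin 4) :
    Asy n 1 0 (fun p => nnR M a p μ) fun p => vt p μ - (1 / 2) * dr p μ := by
  have h : IsSymbol n (-1) fun p => (1 / 2) * (a * (Sig a p)⁻¹ * vφ p μ) :=
    ((((asy_Sig_inv (n := n) a).left.const_mul a).mul (isSymbol_vφ n μ)).const_mul _).mono
      (by norm_num)
  refine (((((asy_R_div_Sig a).mono_delta one_le_two).mul_zero'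
    (Asy.const n 1 ((![1, 0, 0, 0] : Fin 4 → ℝ) μ))).sub
    (((asy_Del_div_Sig M a).mul_zero' (Asy.refl (isSymbol_dr n μ) 1)).const_mul (1 / 2))).add
    (Asy.of_lower (h.mono (by norm_num)) zero_le_one)).congr ?_ ?_
  · filter_upwards [eventually_rad_gt 0, eventually_Del_ne M a] with p hp hD
    exact (nnR_eq (Sig_pos a hp.ne').ne' hD μ).symm
  · filter_upwards with p
    simp [vt]

/-- The Minkowski limit of `m`. -/
def mm₀ (p : Pt) (μ : Fin 4) : ℂ :=
  ((vθ p μ / rad p : ℝ) + Complex.I * (vφ p μ / cyl p : ℝ)) / (√2 : ℝ)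

theorem sqrt_two_sq : ((√2 : ℝ) : ℂ) * ((√2 : ℝ) : ℂ) = 2 := by
  rw [← Complex.ofReal_mul, Real.mul_self_sqrt (by norm_num)]; norm_num

theorem sqrt_two_ne : ((√2 : ℝ) : ℂ) ≠ 0 := by
  intro h; have := sqrt_two_sq; rw [h] at this; norm_num at this

theorem pS_mul_conj (p : Pt) : pS a p * conj (pS a p) = (Sig a p : ℂ) := by
  simp only [pS, map_sub, map_mul, Complex.conj_ofReal, Complex.conj_I, Sig]
  push_cast
  linear_combination (-(a : ℂ) ^ 2 * (cosθ p : ℂ) ^ 2) * Complex.I_sq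

theorem pS_ne {p : Pt} (hp : rad p ≠ 0) : pS a p ≠ 0 := by
  intro h
  have h1 := pS_mul_conj a p
  rw [h, zero_mul] at h1
  exact (Sig_pos a hp).ne' (by exact_mod_cast h1.symm)

theorem mm_eq {p : Pt} (hp : rad p ≠ 0) (hc : cyl p ≠ 0) (μ : Fin 4) :
    mm a p μ = (conj (pS a p))⁻¹ *
      (rad p * mm₀ p μ + Complex.I * a / (√2 : ℝ) * sinθ p * vt p μ) := by
  have h1 := pS_ne a hp
  have h2 : conj (pS a p) ≠ 0 := (map_ne_zero _).2 h1
  have h3 := sqrt_two_ne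
  have hp' : (rad p : ℂ) ≠ 0 := by exact_mod_cast hp
  have hc' : (cyl p : ℂ) ≠ 0 := by exact_mod_cast hc
  simp only [mm, mm₀, sinθ]
  push_cast
  field_simp
  ring

/-- The area form of the unit sphere as an antisymmetric matrix on space. -/
def area (p : Pt) : Matrix (Fin 4) (Fin 4) ℝ :=
  !![0, 0, 0, 0; 0, 0, dr p 3, -dr p 2; 0, -dr p 3, 0, dr p 1; 0, dr p 2, -dr p 1, 0]

/-- Off the axis `m m̄` is a combination of the metric and the area form of the sphere, so that it
extends smoothly across the axis. -/
theorem mm₀_mul_conj {p : Pt} (hp : rad p ≠ 0) (hc : cyl p ≠ 0) (μ ν : Fin 4) :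
    mm₀ p μ * conj (mm₀ p ν) = (1 / 2 : ℂ) * (((spatial μ ν - dr p μ * dr p ν : ℝ) : ℂ)
      - Complex.I * (area p μ ν : ℂ)) := by
  have h1 : rad p ^ 2 = p 1 ^ 2 + p 2 ^ 2 + p 3 ^ 2 := rad_sq p
  have h2 := cyl_sq p
  have hre : vθ p μ / rad p * (vθ p ν / rad p) + vφ p μ / cyl p * (vφ p ν / cyl p)
      = spatial μ ν - dr p μ * dr p ν := by
    fin_cases μ <;> fin_cases ν <;> simp [vθ, vφ, spatial, dr] <;> field_simp
    all_goals
      simp only [h1, h2]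
      ring
  have him : vθ p μ / rad p * (vφ p ν / cyl p) - vφ p μ / cyl p * (vθ p ν / rad p)
      = area p μ ν := by
    fin_cases μ <;> fin_cases ν <;> simp [vθ, vφ, area, dr] <;> field_simp
    all_goals
      simp only [h2]
      ring
  rw [← hre, ← him]
  simp only [mm₀, map_div₀, map_add, map_mul, Complex.conj_ofReal, Complex.conj_I]
  have h3 := sqrt_two_ne
  have h4 := sqrt_two_sq
  rw [div_mul_div_comm, h4]
  push_cast
  linear_combination (-(1 / 2 : ℂ) * ((vφ p μ : ℂ) / cyl p * (vφ p ν / cyl p))) * Complex.I_sq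

theorem isHomog_area (μ ν : Fin 4) : IsHomog 0 fun p => area p μ ν := by
  have h := isHomog_dr
  have h0 := IsHomog.const (0 : ℝ)
  fin_cases μ <;> fin_cases ν <;> first
    | exact h0
    | exact h 1
    | exact h 2
    | exact h 3
    | exact (h 1).neg
    | exact (h 2).neg
    | exact (h 3).neg

theorem isSymbol_mm₀_mul_conj (μ ν : Fin 4) :
    IsSymbol n 0 fun p => mm₀ p μ * conj (mm₀ p ν) := by
  have h1 : IsHomog 0 fun p => spatial μ ν - dr p μ * dr p ν :=
    (IsHomog.const _).sub ((isHomog_dr μ).mul (isHomog_dr ν))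
  have h2 := (((h1.isSymbol n).ofReal).sub
    (((isHomog_area μ ν).isSymbol n).ofReal.const_mul Complex.I)).const_mul (1 / 2)
  refine (h2.mono (by norm_num)).congr ?_
  filter_upwards [eventually_rad_gt 0, eventually_cyl_ne] with p hp hc
  rw [mm₀_mul_conj hp.ne' hc]

/-- The factor `sin θ` removes the singularity of `m` on the axis. -/
theorem isSymbol_sinθ_mul_mm₀ (μ : Fin 4) : IsSymbol n 0 fun p => sinθ p * mm₀ p μ := by
  have h1 : IsHomog 0 fun p => vφ p μ / rad p := (isHomog_vφ μ).mul isHomog_rad_inv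
  have h2 : IsHomog 0 fun p => dr p 3 * dr p μ - spatial 3 μ :=
    ((isHomog_dr 3).mul (isHomog_dr μ)).sub (IsHomog.const _)
  have h3 := (((h2.isSymbol n).ofReal).add
    ((h1.isSymbol n).ofReal.const_mul Complex.I)).const_mul (((√2 : ℝ) : ℂ)⁻¹)
  refine (h3.mono (by norm_num)).congr ?_
  filter_upwards [eventually_rad_gt 0, eventually_cyl_ne] with p hp hc
  have h4 := rad_sq p
  have h5 := cyl_sq p
  have h6 : sinθ p * (vθ p μ / rad p) = dr p 3 * dr p μ - spatial 3 μ := by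
    fin_cases μ <;> simp [vθ, spatial, dr, sinθ] <;> field_simp
    linarith
  have h7 : sinθ p * (vφ p μ / cyl p) = vφ p μ / rad p := by
    simp only [sinθ]; field_simp
  rw [← h6, ← h7, mm₀]
  push_cast
  ring

theorem isSymbol_sinθ_sq : IsSymbol n 0 fun p => sinθ p ^ 2 := by
  have h1 : IsSymbol n 0 fun p => 1 - cosθ p ^ 2 :=
    (IsSymbol.const n 1).sub (by simpa using (isSymbol_cosθ n).pow 2)
  refine h1.congr ?_
  filter_upwards [eventually_rad_gt 0] with p hp using (sinθ_sq hp.ne').symm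

theorem asy_pS : Asy n 1 1 (pS a) fun p => (rad p : ℂ) := by
  have h : IsSymbol n 0 fun p => -(Complex.I * a * cosθ p) :=
    (((isSymbol_cosθ n).ofReal).const_mul (Complex.I * a)).neg
  have hr := (isSymbol_rad n).ofReal
  refine ⟨(hr.add (h.mono zero_le_one)).congr (Eventually.of_forall fun p => ?_), hr,
    (h.mono (by norm_num)).congr (Eventually.of_forall fun p => ?_)⟩ <;>
  · simp only [pS]; ring

theorem asy_rad_sq_div_Sig : Asy n 1 0 (fun p => rad p ^ 2 / Sig a p) fun _ => (1 : ℝ) :=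
  (Asy.refl (isSymbol_rad_sq n) 1).div_one ((asy_Sig_inv a).mono_delta one_le_two)

theorem asy_mm_mul_mb (μ ν : Fin 4) :
    Asy n 1 0 (fun p => mm a p μ * mb a p ν) fun p => mm₀ p μ * conj (mm₀ p ν) := by
  have hS : IsSymbol n (-1) fun p => (rad p * (Sig a p)⁻¹) :=
    ((isSymbol_rad n).mul (asy_Sig_inv a).left).mono (by norm_num)
  have hS2 : IsSymbol n (-1) fun p => (Sig a p)⁻¹ := (asy_Sig_inv a).left.mono (by norm_num)
  have hv : ∀ μ, IsSymbol n 0 fun p => (vt p μ : ℂ) := fun μ =>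
    IsSymbol.const n (((![1, 0, 0, 0] : Fin 4 → ℝ) μ : ℂ))
  set k : ℂ := Complex.I * a / (√2 : ℝ) with hk
  have h1 := (asy_rad_sq_div_Sig (n := n) a).ofReal.mul_zero'
    (Asy.refl (isSymbol_mm₀_mul_conj (n := n) μ ν) 1)
  have h2 := (hS.ofReal.mul (((isSymbol_sinθ_mul_mm₀ (n := n) μ).mul (hv ν)).const_mul (conj k)))
  have h3 := (hS.ofReal.mul
    (((isSymbol_sinθ_mul_mm₀ (n := n) ν).conjugate.mul (hv μ)).const_mul k))
  have h4 := (hS2.ofReal.mul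
    (((isSymbol_sinθ_sq (n := n)).ofReal.mul ((hv μ).mul (hv ν))).const_mul (k * conj k)))
  refine (h1.add (Asy.of_lower (((h2.mono (by norm_num)).add (h3.mono (by norm_num))).add
    (h4.mono (by norm_num) : IsSymbol n (0 - 1) _)) zero_le_one)).congr ?_
    (Eventually.of_forall fun p => by simp)
  filter_upwards [eventually_rad_gt 0, eventually_cyl_ne] with p hp hc
  have h5 := pS_ne a hp.ne'
  have h6 : conj (pS a p) ≠ 0 := (map_ne_zero _).2 h5
  have h7 := pS_mul_conj a p
  rw [mb, mm_eq a hp.ne' hc, mm_eq a hp.ne' hc, ← hk]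
  simp only [map_mul, map_add, map_inv₀, Complex.conj_conj, Complex.conj_ofReal]
  push_cast
  rw [← h7]
  field_simp
  ring

theorem mm_isBigO (μ : Fin 4) : (fun p => mm a p μ) =O[atInfinity] fun _ => (1 : ℝ) := by
  have h := (asy_mm_mul_mb (n := 0) a μ μ).left.isBigO
  simp only [Real.rpow_zero] at h
  have h2 : (fun p => ‖mm a p μ‖ ^ 2) =O[atInfinity] fun _ => (1 : ℝ) ^ 2 :=
    h.norm_left.congr (fun p => by simp [mb, pow_two]) fun _ => by norm_num
  exact (IsBigO.of_pow two_ne_zero h2).of_norm_left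

theorem mb_isBigO (μ : Fin 4) : (fun p => mb a p μ) =O[atInfinity] fun _ => (1 : ℝ) :=
  (IsBigO.congr_left (mm_isBigO a μ).norm_left fun p => by simp [mb]).of_norm_left

/-- The component of `m̄` along `∂_{t_*}` is proportional to `a sin θ / p`. -/
theorem mb_zero_isBigO : (fun p => mb a p 0) =O[atInfinity] fun p => rad p ^ (-1 : ℝ) := by
  have h1 := ((asy_pS (n := 0) a).inv one_pos one_pos (by
    filter_upwards with p
    rw [one_mul, Real.rpow_one, Complex.norm_real, Real.norm_of_nonneg (rad_nonneg p)])).left.isBigO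
  have h2 : (fun p => (sinθ p : ℂ)) =O[atInfinity] fun _ => (1 : ℝ) := by
    apply IsBigO.of_bound 1
    filter_upwards [eventually_rad_gt 0] with p hp
    have := sinθ_sq hp.ne'
    rw [Complex.norm_real, Real.norm_eq_abs, norm_one, mul_one]
    exact abs_le_one_iff_mul_self_le_one.2 (by nlinarith [sq_nonneg (cosθ p)])
  have h3 := (h1.mul (h2.const_mul_left (-(Complex.I * a / (√2 : ℝ)))))
  simp only [mul_one] at h3
  refine h3.congr' ?_ EventuallyEq.rfl
  filter_upwards [eventually_rad_gt 0, eventually_cyl_ne] with p hp hc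
  have hr : (rad p : ℂ) ≠ 0 := by exact_mod_cast hp.ne'
  rw [mb, mm_eq a hp.ne' hc]
  simp [mm₀, vθ, vφ, vt]
  ring

end

section

/-! ### Contractions and covariant derivatives of one-forms -/

theorem sum_fin_cons {n : ℕ} (f : (Fin (n + 1) → Fin 4) → ℂ) :
    ∑ i, f i = ∑ i₀, ∑ i : Fin n → Fin 4, f (Fin.cons i₀ i) := by
  rw [← (Fin.consEquiv fun _ : Fin (n + 1) => Fin 4).sum_comp, Fintype.sum_prod_type]
  rfl

theorem contr_two (T : Tensor 2) (u v : VecField) (p : Pt) :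
    contr T ![u, v] p = ∑ i, ∑ j, T p ![i, j] * (u p i * v p j) := by
  simp only [contr, sum_fin_cons, Finset.univ_unique, Finset.sum_singleton, Fin.prod_univ_two]
  rfl

theorem contr_four (T : Tensor 4) (u v w z : VecField) (p : Pt) :
    contr T ![u, v, w, z] p = ∑ i, ∑ j, ∑ k, ∑ l,
      T p ![i, j, k, l] * (u p i * v p j * w p k * z p l) := by
  simp only [contr, sum_fin_cons, Finset.univ_unique, Finset.sum_singleton, Fin.prod_univ_four]
  rfl

/-- A tensor field with real components. -/
def IsRealTensor {n : ℕ} (T : Tensor n) : Prop := ∀ p i, conj (T p i) = T p i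

theorem pd_conj (f : Pt → ℂ) (μ : Fin 4) (p : Pt) :
    pd μ (fun q => conj (f q)) p = conj (pd μ f p) := by
  unfold pd
  have := Complex.conjCLE.comp_fderiv (f := f) (x := p)
  exact congrArg (fun L => L (Pi.single μ 1)) this

theorem IsRealTensor.covD {n : ℕ} {T : Tensor n} (g : Bilin) (h : IsRealTensor T) :
    IsRealTensor (covD g T) := by
  intro p i
  unfold KerrDecay.covD
  rw [map_sub, ← pd_conj, map_sum]
  simp only [map_sum, map_mul, Complex.conj_ofReal, h p]
  simp only [h _ _]

theorem christoffel_symm {g : Bilin} (hg : ∀ p μ ν, g p μ ν = g p ν μ) (c a b : Fin 4) (p : Pt) :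
    christoffel g c a b p = christoffel g c b a p := by
  unfold christoffel
  congr 1
  refine Finset.sum_congr rfl fun d _ => ?_
  rw [show (fun q => g q a b) = fun q => g q b a from funext fun q => hg q a b]
  ring

theorem covD_one (g : Bilin) (T : Tensor 1) (p : Pt) (b a : Fin 4) :
    covD g T p ![b, a] = pd b (fun q => T q ![a]) p
      - ∑ c, (christoffel g c b a p : ℂ) * T p ![c] := by
  have h1 : Fin.tail ![b, a] = ![a] := by ext i; fin_cases i; rfl
  have h2 : ∀ c, Function.update ![a] 0 c = ![c] := fun c => by ext i; fin_cases i; rfl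
  simp only [covD, h1, h2, Finset.univ_unique, Fin.default_eq_zero, Finset.sum_singleton]
  rfl

/-- The antisymmetrized covariant derivative of a one-form is its exterior derivative. -/
theorem covD_one_sub_swap {g : Bilin} (hg : ∀ p μ ν, g p μ ν = g p ν μ) (T : Tensor 1) (p : Pt)
    (b a : Fin 4) : covD g T p ![b, a] - covD g T p ![a, b]
      = pd b (fun q => T q ![a]) p - pd a (fun q => T q ![b]) p := by
  rw [covD_one, covD_one]
  simp only [christoffel_symm hg _ a b]
  ring

/-- The covariant derivative of a lowered vector field, expressed through first derivatives of the
metric only. -/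
theorem covD_lower {g : Bilin} (hg : ∀ p μ ν, g p μ ν = g p ν μ) {v : VecField} {p : Pt}
    (hd : (g p).det ≠ 0) (hgd : ∀ μ ν, DifferentiableAt ℝ (fun q => g q μ ν) p)
    (hvd : ∀ μ, DifferentiableAt ℝ (fun q => v q μ) p) (b a : Fin 4) :
    covD g (lower g v) p ![b, a] = ∑ c, ((g p a c : ℂ) * pd b (fun q => v q c) p
      + (1 / 2) * ((pd b (fun q => g q a c) p - pd a (fun q => g q c b) p
        + pd c (fun q => g q b a) p : ℝ) : ℂ) * v p c) := by
  have h1 : pd b (fun q => lower g v q ![a]) p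
      = ∑ c, ((g p a c : ℂ) * pd b (fun q => v q c) p
        + v p c * ((pd b (fun q => g q a c) p : ℝ) : ℂ)) := by
    change pd b (fun q => ∑ c, (g q a c : ℂ) * v q c) p = _
    rw [pd_sum _ fun c _ => (differentiableAt_ofReal (hgd a c)).fun_mul (hvd c)]
    refine Finset.sum_congr rfl fun c _ => ?_
    rw [pd_mul (differentiableAt_ofReal (hgd a c)) (hvd c), pd_ofReal (hgd a c)]
  have hinv : ∀ d e, ∑ c, (g p)⁻¹ c d * g p c e = if d = e then 1 else 0 := by
    intro d e
    have h2 := congrFun (congrFun (Matrix.mul_nonsing_inv (g p) (isUnit_iff_ne_zero.2 hd)) e) d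
    have h3 : ∀ c, (g p)⁻¹ c d = (g p)⁻¹ d c := by
      intro c
      have h4 : (g p).transpose = g p := by ext i j; exact hg p j i
      conv_lhs => rw [← h4, ← Matrix.transpose_nonsing_inv]
      rfl
    have h5 := congrFun (congrFun (Matrix.nonsing_inv_mul (g p) (isUnit_iff_ne_zero.2 hd)) d) e
    simp only [Matrix.mul_apply, Matrix.one_apply] at h5
    simp only [h3]
    exact h5
  have h2 : ∑ c, (christoffel g c b a p : ℂ) * lower g v p ![c]
      = ∑ d, (1 / 2) * ((pd b (fun q => g q d a) p + pd a (fun q => g q d b) p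
        - pd d (fun q => g q b a) p : ℝ) : ℂ) * v p d := by
    set K : Fin 4 → ℝ := fun d => pd b (fun q => g q d a) p + pd a (fun q => g q d b) p
        - pd d (fun q => g q b a) p with hK
    change ∑ c, (((1 / 2) * ∑ d, (g p)⁻¹ c d * K d : ℝ) : ℂ) * ∑ e, (g p c e : ℂ) * v p e = _
    calc _ = ∑ c, ∑ d, ∑ e,
          (1 / 2 : ℂ) * (K d : ℂ) * v p e * (((g p)⁻¹ c d * g p c e : ℝ) : ℂ) := by
          refine Finset.sum_congr rfl fun c _ => ?_
          push_cast
          rw [mul_assoc, Finset.sum_mul_sum, Finset.mul_sum]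
          refine Finset.sum_congr rfl fun d _ => ?_
          rw [Finset.mul_sum]
          exact Finset.sum_congr rfl fun e _ => by ring
      _ = ∑ d, ∑ e, (1 / 2 : ℂ) * (K d : ℂ) * v p e * ((∑ c, (g p)⁻¹ c d * g p c e : ℝ) : ℂ) := by
          rw [Finset.sum_comm]
          refine Finset.sum_congr rfl fun d _ => ?_
          rw [Finset.sum_comm]
          refine Finset.sum_congr rfl fun e _ => ?_
          rw [Complex.ofReal_sum, Finset.mul_sum]
      _ = _ := by
          simp only [hinv]
          refine Finset.sum_congr rfl fun d _ => ?_
          rw [Finset.sum_eq_single d (fun e _ he => by simp [he.symm]) (by simp)]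
          simp only [if_true, hK]
          push_cast
          ring
  rw [covD_one, h1, h2, ← Finset.sum_sub_distrib]
  refine Finset.sum_congr rfl fun c _ => ?_
  rw [show (fun q => g q c a) = fun q => g q a c from funext fun q => hg q c a]
  push_cast
  ring

/-- Two vector fields with constant inner product: `u^a ∇_b v_a + v^a ∇_b u_a = 0`. -/
theorem covD_lower_add {g : Bilin} (hg : ∀ p μ ν, g p μ ν = g p ν μ) {u v : VecField} {p : Pt}
    (hd : (g p).det ≠ 0) (hgd : ∀ μ ν, DifferentiableAt ℝ (fun q => g q μ ν) p)
    (hud : ∀ μ, DifferentiableAt ℝ (fun q => u q μ) p)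
    (hvd : ∀ μ, DifferentiableAt ℝ (fun q => v q μ) p) {k : ℂ}
    (huv : (fun q => ∑ a, ∑ c, (g q a c : ℂ) * (u q a * v q c)) =ᶠ[𝓝 p] fun _ => k) (b : Fin 4) :
    ∑ a, u p a * covD g (lower g v) p ![b, a] + ∑ a, v p a * covD g (lower g u) p ![b, a] = 0 := by
  have h1 := pd_congr huv b
  have hguv : ∀ a c, DifferentiableAt ℝ (fun q => (g q a c : ℂ) * (u q a * v q c)) p := fun a c =>
    (differentiableAt_ofReal (hgd a c)).fun_mul ((hud a).fun_mul (hvd c))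
  rw [pd_const, pd_sum _ fun a _ => DifferentiableAt.fun_sum fun c _ => hguv a c] at h1
  have h2 : ∀ a, pd b (fun q => ∑ c, (g q a c : ℂ) * (u q a * v q c)) p
      = ∑ c, ((g p a c : ℂ) * (u p a * pd b (fun q => v q c) p + v p c * pd b (fun q => u q a) p)
        + u p a * v p c * ((pd b (fun q => g q a c) p : ℝ) : ℂ)) := by
    intro a
    rw [pd_sum _ fun c _ => hguv a c]
    refine Finset.sum_congr rfl fun c _ => ?_
    rw [pd_mul (differentiableAt_ofReal (hgd a c)) ((hud a).fun_mul (hvd c)),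
      pd_mul (hud a) (hvd c), pd_ofReal (hgd a c)]
  simp only [h2] at h1
  rw [← h1]
  simp only [covD_lower hg hd hgd hud, covD_lower hg hd hgd hvd, Finset.mul_sum]
  rw [Finset.sum_comm (f := fun a c => v p a * _), ← Finset.sum_add_distrib]
  refine Finset.sum_congr rfl fun a _ => ?_
  rw [← Finset.sum_add_distrib]
  refine Finset.sum_congr rfl fun c _ => ?_
  rw [show (fun q => g q c a) = fun q => g q a c from funext fun q => hg q c a,
    show (fun q => g q c b) = fun q => g q b c from funext fun q => hg q c b,
    show (fun q => g q b a) = fun q => g q a b from funext fun q => hg q b a, hg p c a]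
  push_cast
  ring

/-! ### Spin coefficients near infinity -/

variable {n : ℕ} (M a : ℝ)

theorem kerr_symm (p : Pt) (μ ν : Fin 4) : kerr M a p μ ν = kerr M a p ν μ := by
  simp only [kerr, sq, Matrix.vecMulVec, Matrix.sub_apply, Matrix.smul_apply, Matrix.of_apply,
    Matrix.add_apply, smul_eq_mul]
  ring

theorem sum_dr_mul (p : Pt) (v : Fin 4 → ℝ) :
    ∑ μ, dr p μ * v μ = (p 1 * v 1 + p 2 * v 2 + p 3 * v 3) / rad p := by
  simp [Fin.sum_univ_four, dr]; ring

/-- Pairings of the Boyer-Lindquist one-forms with a vector `k₀ ∂_t + k₁ X + k₂ ∂_φ`, where `X` is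
the radial field at fixed `t_*`. -/
theorem dr_pairing {p : Pt} (hp : rad p ≠ 0) (k₀ k₁ k₂ : ℝ) :
    ∑ μ, dr p μ * (k₀ * vt p μ + k₁ * dr p μ + k₂ * vφ p μ) = k₁ := by
  have h := rad_sq p
  rw [sum_dr_mul]
  simp [vt, dr, vφ]
  field_simp
  linear_combination (-k₁) * h

theorem dθ_pairing {p : Pt} (hp : rad p ≠ 0) (hc : cyl p ≠ 0) (k₀ k₁ k₂ : ℝ) :
    ∑ μ, dθ p μ * (k₀ * vt p μ + k₁ * dr p μ + k₂ * vφ p μ) = 0 := by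
  have h := rad_sq p
  simp [Fin.sum_univ_four, dθ, vt, dr, vφ, cosθ]
  field_simp
  linear_combination (-p 3 * k₁) * h

theorem dφ_pairing {p : Pt} (hp : rad p ≠ 0) (hc : cyl p ≠ 0) (k₀ k₁ k₂ : ℝ) :
    ∑ μ, dφ p μ * (k₀ * vt p μ + k₁ * dr p μ + k₂ * vφ p μ) = k₂ := by
  have h := cyl_sq p
  simp [Fin.sum_univ_four, dφ, vt, dr, vφ]
  field_simp
  linear_combination (-(k₂ * rad p)) * h

theorem dt_pairing {p : Pt} (hp : rad p ≠ 0) (k₀ k₁ k₂ : ℝ) :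
    ∑ μ, dt M a p μ * (k₀ * vt p μ + k₁ * dr p μ + k₂ * vφ p μ)
      = k₀ + (rad p ^ 2 + a ^ 2) / Del M a p * k₁ := by
  set v : Fin 4 → ℝ := fun μ => k₀ * vt p μ + k₁ * dr p μ + k₂ * vφ p μ with hv
  have h : ∑ μ, dr p μ * v μ = k₁ := dr_pairing hp k₀ k₁ k₂
  have h2 : ∀ μ, dt M a p μ = vt p μ + (rad p ^ 2 + a ^ 2) / Del M a p * dr p μ := fun μ => rfl
  have h3 : ∑ μ, vt p μ * v μ = k₀ := by simp [hv, Fin.sum_univ_four, vt, dr_zero, vφ]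
  change ∑ μ, dt M a p μ * v μ = _
  simp only [h2, add_mul, mul_assoc, Finset.sum_add_distrib, ← Finset.mul_sum]
  rw [h, h3]

/-- Lowering an index of `k₀ ∂_t + k₁ X + k₂ ∂_φ` with the Kerr metric. -/
theorem kerr_pairing {p : Pt} (hp : rad p ≠ 0) (hc : cyl p ≠ 0) (k₀ k₁ k₂ : ℝ) (μ : Fin 4) :
    ∑ ν, kerr M a p μ ν * (k₀ * vt p ν + k₁ * dr p ν + k₂ * vφ p ν)
      = Del M a p / Sig a p * (dt M a p μ - a * sdφ p μ)
          * (k₀ + (rad p ^ 2 + a ^ 2) / Del M a p * k₁ - a * sinθ p ^ 2 * k₂)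
        - Sig a p / Del M a p * dr p μ * k₁
        - (Sig a p)⁻¹ * (a * sinθ p ^ 2 * dt M a p μ - (rad p ^ 2 + a ^ 2) * sdφ p μ)
          * (a * (k₀ + (rad p ^ 2 + a ^ 2) / Del M a p * k₁) - (rad p ^ 2 + a ^ 2) * k₂) := by
  set v : Fin 4 → ℝ := fun ν => k₀ * vt p ν + k₁ * dr p ν + k₂ * vφ p ν with hv
  have h1 : ∑ ν, dr p ν * v ν = _ := dr_pairing hp k₀ k₁ k₂
  have h2 : ∑ ν, dθ p ν * v ν = _ := dθ_pairing hp hc k₀ k₁ k₂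
  have h3 : ∑ ν, dφ p ν * v ν = _ := dφ_pairing hp hc k₀ k₁ k₂
  have h4 : ∑ ν, dt M a p ν * v ν = _ := dt_pairing M a hp k₀ k₁ k₂
  change ∑ ν, kerr M a p μ ν * v ν = _
  have h5 : ∑ ν, kerr M a p μ ν * v ν
      = Del M a p / Sig a p * (dt M a p μ - a * sinθ p ^ 2 * dφ p μ)
          * (∑ ν, dt M a p ν * v ν - a * sinθ p ^ 2 * ∑ ν, dφ p ν * v ν)
        - Sig a p * ((Del M a p)⁻¹ * dr p μ * ∑ ν, dr p ν * v ν + dθ p μ * ∑ ν, dθ p ν * v ν)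
        - sinθ p ^ 2 / Sig a p * (a * dt M a p μ - (rad p ^ 2 + a ^ 2) * dφ p μ)
          * (a * ∑ ν, dt M a p ν * v ν - (rad p ^ 2 + a ^ 2) * ∑ ν, dφ p ν * v ν) := by
    simp only [kerr, sq, Matrix.vecMulVec, Matrix.sub_apply, Matrix.smul_apply, Matrix.of_apply,
      Matrix.add_apply, smul_eq_mul, Pi.sub_apply, Pi.smul_apply, Fin.sum_univ_four]
    ring
  rw [h5, h1, h2, h3, h4, ← sinθ_sq_smul_dφ hp hc]
  ring

/-- The one-form `ℓ = dt_* - a sin² θ dφ + (a² sin² θ / Δ) dr`. -/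
theorem lower_ell {p : Pt} (hp : rad p ≠ 0) (hc : cyl p ≠ 0) (hD : Del M a p ≠ 0) (μ : Fin 4) :
    lower (kerr M a) (ell M a) p ![μ] = ((vt p μ - a * sdφ p μ
      + a ^ 2 * sinθ p ^ 2 * (Del M a p)⁻¹ * dr p μ : ℝ) : ℂ) := by
  have hS := (Sig_pos a hp).ne'
  have h1 : ∀ ν, ellR M a p ν = 0 * vt p ν + 1 * dr p ν + a / Del M a p * vφ p ν := fun ν => by
    rw [ellR_eq]; ring
  have h2 : ∀ ν, dt M a p ν = vt p ν + (rad p ^ 2 + a ^ 2) / Del M a p * dr p ν := fun ν => rfl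
  have hR : rad p ^ 2 + a ^ 2 = Sig a p + a ^ 2 * sinθ p ^ 2 := by
    rw [sinθ_sq hp, Sig]; ring
  change ∑ ν, (kerr M a p μ ν : ℂ) * ell M a p ν = _
  simp only [ell_eq, ← Complex.ofReal_mul, ← Complex.ofReal_sum]
  rw [Complex.ofReal_inj]
  simp only [h1]
  rw [kerr_pairing M a hp hc, h2, hR]
  field_simp
  ring

/-- The one-form `n`. -/
theorem lower_nn {p : Pt} (hp : rad p ≠ 0) (hc : cyl p ≠ 0) (hD : Del M a p ≠ 0) (μ : Fin 4) :
    lower (kerr M a) (nn M a) p ![μ] = (((1 / 2) * (Del M a p / Sig a p * (vt p μ - a * sdφ p μ)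
      + ((rad p ^ 2 + a ^ 2) / Sig a p + 1) * dr p μ) : ℝ) : ℂ) := by
  have hS := (Sig_pos a hp).ne'
  have h1 : ∀ ν, nnR M a p ν = (rad p ^ 2 + a ^ 2) / Sig a p * vt p ν
      + (-(1 / 2) * (Del M a p / Sig a p)) * dr p ν + (1 / 2) * (a * (Sig a p)⁻¹) * vφ p ν :=
    fun ν => by rw [nnR_eq hS hD]; ring
  have h2 : ∀ ν, dt M a p ν = vt p ν + (rad p ^ 2 + a ^ 2) / Del M a p * dr p ν := fun ν => rfl
  have hR : rad p ^ 2 + a ^ 2 = Sig a p + a ^ 2 * sinθ p ^ 2 := by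
    rw [sinθ_sq hp, Sig]; ring
  change ∑ ν, (kerr M a p μ ν : ℂ) * nn M a p ν = _
  simp only [nn_eq, ← Complex.ofReal_mul, ← Complex.ofReal_sum]
  rw [Complex.ofReal_inj]
  simp only [h1]
  rw [kerr_pairing M a hp hc, h2, hR]
  field_simp
  ring

/-- The normalization `ℓ · n = 1`. -/
theorem kerr_ell_nn {p : Pt} (hp : rad p ≠ 0) (hc : cyl p ≠ 0) (hD : Del M a p ≠ 0) :
    ∑ μ, ∑ ν, (kerr M a p μ ν : ℂ) * (nn M a p μ * ell M a p ν) = 1 := by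
  have hS := (Sig_pos a hp).ne'
  have hR : rad p ^ 2 + a ^ 2 = Sig a p + a ^ 2 * sinθ p ^ 2 := by
    rw [sinθ_sq hp, Sig]; ring
  have h0 : ∑ μ, ∑ ν, (kerr M a p μ ν : ℂ) * (nn M a p μ * ell M a p ν)
      = ∑ μ, lower (kerr M a) (ell M a) p ![μ] * nn M a p μ := by
    refine Finset.sum_congr rfl fun μ _ => ?_
    change _ = (∑ ν, (kerr M a p μ ν : ℂ) * ell M a p ν) * _
    rw [Finset.sum_mul]
    exact Finset.sum_congr rfl fun ν _ => by ring
  rw [h0]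
  simp only [lower_ell M a hp hc hD, nn_eq, ← Complex.ofReal_mul, ← Complex.ofReal_sum]
  rw [← Complex.ofReal_one, Complex.ofReal_inj]
  have h1 : ∀ ν, nnR M a p ν = (rad p ^ 2 + a ^ 2) / Sig a p * vt p ν
      + (-(1 / 2) * (Del M a p / Sig a p)) * dr p ν + (1 / 2) * (a * (Sig a p)⁻¹) * vφ p ν :=
    fun ν => by rw [nnR_eq hS hD]; ring
  have h2 := dr_pairing hp ((rad p ^ 2 + a ^ 2) / Sig a p) (-(1 / 2) * (Del M a p / Sig a p))
    ((1 / 2) * (a * (Sig a p)⁻¹))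
  have h3 := dφ_pairing hp hc ((rad p ^ 2 + a ^ 2) / Sig a p) (-(1 / 2) * (Del M a p / Sig a p))
    ((1 / 2) * (a * (Sig a p)⁻¹))
  simp only [← h1] at h2 h3
  have h4 : ∑ μ, vt p μ * nnR M a p μ = (rad p ^ 2 + a ^ 2) / Sig a p := by
    simp only [h1]
    simp [Fin.sum_univ_four, vt, dr_zero, vφ]
  have h5 : ∑ μ, (vt p μ - a * sdφ p μ + a ^ 2 * sinθ p ^ 2 * (Del M a p)⁻¹ * dr p μ) * nnR M a p μ
      = ∑ μ, vt p μ * nnR M a p μ - a * sinθ p ^ 2 * ∑ μ, dφ p μ * nnR M a p μ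
        + a ^ 2 * sinθ p ^ 2 * (Del M a p)⁻¹ * ∑ μ, dr p μ * nnR M a p μ := by
    simp only [← sinθ_sq_smul_dφ hp hc, Fin.sum_univ_four]
    ring
  rw [h5, h2, h3, h4, hR]
  field_simp
  ring

theorem isRealTensor_lower_ell : IsRealTensor (lower (kerr M a) (ell M a)) := fun p i => by
  simp [lower, ell_eq, map_sum]

theorem isRealTensor_lower_nn : IsRealTensor (lower (kerr M a) (nn M a)) := fun p i => by
  simp [lower, nn_eq, map_sum]

/-- The expansion `ℓ = dt_* - a sin² θ dφ + O(r⁻²)` of the one-form `ℓ`. -/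
theorem isSymbol_lower_ell_sub (μ : Fin 4) : IsSymbol n (-2)
    fun p => lower (kerr M a) (ell M a) p ![μ] - ((vt p μ - a * sdφ p μ : ℝ) : ℂ) := by
  have h1 := ((((isSymbol_sinθ_sq (n := n)).const_mul (a ^ 2)).mul
    (asy_Del_inv M a).left).mul (isSymbol_dr n μ)).ofReal
  refine (h1.mono (by norm_num)).congr ?_
  filter_upwards [eventually_rad_gt 0, eventually_cyl_ne, eventually_Del_ne M a] with p hp hc hD
  rw [lower_ell M a hp.ne' hc hD, ← Complex.ofReal_sub]
  congr 1
  ring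

/-- The expansion `n = (1/2 - M/r) dt_* + dr - (a/2) sin² θ dφ + O(r⁻²)` of the one-form `n`. -/
theorem isSymbol_lower_nn_sub (μ : Fin 4) : IsSymbol n (-2)
    fun p => lower (kerr M a) (nn M a) p ![μ]
      - (((1 / 2 - M * (rad p)⁻¹) * vt p μ + dr p μ - a / 2 * sdφ p μ : ℝ) : ℂ) := by
  have hS := (asy_Sig_inv (n := n) a).left
  have hi : IsSymbol n (-1) fun p => (rad p)⁻¹ := by simpa using isHomog_rad_inv.isSymbol n
  have hcos : IsSymbol n 0 fun p => cosθ p ^ 2 := by simpa using (isSymbol_cosθ n).pow 2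
  -- `Δ/Σ - 1 + 2M/r` is of order `-2`
  have h1 : IsSymbol n (-2) fun p => Del M a p / Sig a p - 1 + 2 * M * (rad p)⁻¹ := by
    have h2 := ((((isSymbol_sinθ_sq (n := n)).const_mul (a ^ 2)).mul hS).mono
      (by norm_num : (0 : ℝ) + -2 ≤ -2)).add
      ((((hcos.mul hi).const_mul (2 * M * a ^ 2)).mul hS).mono (by norm_num))
    refine h2.congr ?_
    filter_upwards [eventually_rad_gt 0] with p hp
    have hS := (Sig_pos a hp.ne').ne'
    rw [sinθ_sq hp.ne', div_eq_mul_inv]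
    have h3 : Del M a p = Sig a p + a ^ 2 * (1 - cosθ p ^ 2) - 2 * M * rad p := by
      simp only [Del, Sig]; ring
    have h4 : 2 * M * rad p = 2 * M * (rad p)⁻¹ * (Sig a p - a ^ 2 * cosθ p ^ 2) := by
      simp only [Sig]; field_simp; ring
    rw [h3, h4]
    field_simp
    ring
  have h2 : IsSymbol n (-1) fun p => Del M a p / Sig a p - 1 :=
    (asy_Del_div_Sig M a).diff.mono (by norm_num)
  have h3 : IsSymbol n (-2) fun p => (rad p ^ 2 + a ^ 2) / Sig a p - 1 :=
    (asy_R_div_Sig a).diff.mono (by norm_num)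
  have hv : IsSymbol n 0 fun p => vt p μ := IsSymbol.const n ((![1, 0, 0, 0] : Fin 4 → ℝ) μ)
  have h4 := ((((h1.mul hv).mono (by norm_num : _ ≤ (-2 : ℝ))).sub
    (((h2.mul (isSymbol_sdφ n μ)).const_mul a).mono (by norm_num))).add
    ((h3.mul (isSymbol_dr n μ)).mono (by norm_num))).const_mul (1 / 2)
  refine h4.ofReal.congr ?_
  filter_upwards [eventually_rad_gt 0, eventually_cyl_ne, eventually_Del_ne M a] with p hp hc hD
  rw [lower_nn M a hp.ne' hc hD, ← Complex.ofReal_sub]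
  congr 1
  ring

theorem isSymbol_vt (n : ℕ) (μ : Fin 4) : IsSymbol n 0 fun p => vt p μ :=
  IsSymbol.const n ((![1, 0, 0, 0] : Fin 4 → ℝ) μ)

/-- Lowering an index with the Kerr metric tends to lowering it with the Minkowski metric. -/
theorem asy_lower {v : VecField} {v₀ : VecField}
    (hv : ∀ μ, Asy n 1 0 (fun p => v p μ) fun p => v₀ p μ) (i : Fin 1 → Fin 4) :
    Asy n 1 0 (fun p => lower (kerr M a) v p i) fun p => lower mink v₀ p i :=
  Asy.sum _ fun b _ => (asy_kerr M a (i 0) b).ofReal.mul_zero' (hv b)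

/-- The Minkowski limit of `ℓ`. -/
def ell₀ : VecField := fun p μ => (dr p μ : ℂ)

/-- The Minkowski limit of `n`. -/
def nn₀ : VecField := fun p μ => ((vt p μ - (1 / 2) * dr p μ : ℝ) : ℂ)

theorem asy_ell (μ : Fin 4) : Asy n 1 0 (fun p => ell M a p μ) fun p => ell₀ p μ :=
  (asy_ellR M a μ).ofReal

theorem asy_nn (μ : Fin 4) : Asy n 1 0 (fun p => nn M a p μ) fun p => nn₀ p μ :=
  (asy_nnR M a μ).ofReal

theorem asy_covD_ell (b c : Fin 4) : Asy n 1 (-1)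
    (fun p => covD (kerr M a) (lower (kerr M a) (ell M a)) p ![b, c])
    fun p => covD mink (lower mink ell₀) p ![b, c] :=
  (Asy.covD M a le_rfl (asy_lower M a (asy_ell M a)) ![b, c]).mono (by norm_num)

theorem asy_covD_nn (b c : Fin 4) : Asy n 1 (-1)
    (fun p => covD (kerr M a) (lower (kerr M a) (nn M a)) p ![b, c])
    fun p => covD mink (lower mink nn₀) p ![b, c] :=
  (Asy.covD M a le_rfl (asy_lower M a (asy_nn M a)) ![b, c]).mono (by norm_num)

/-- Contracting a tensor of rank two with bounded vectors does not change its order. -/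
theorem contr_two_isBigO {T : Tensor 2} {u v : VecField} {q q' q'' : ℝ}
    (hT : ∀ i j, (fun p => T p ![i, j]) =O[atInfinity] fun p => rad p ^ q)
    (hu : ∀ i, (fun p => u p i) =O[atInfinity] fun p => rad p ^ q')
    (hv : ∀ i, (fun p => v p i) =O[atInfinity] fun p => rad p ^ q'') :
    contr T ![u, v] =O[atInfinity] fun p => rad p ^ (q + (q' + q'')) := by
  refine IsBigO.congr_left ?_ fun p => (contr_two T u v p).symm
  exact IsBigO.fun_sum fun i _ => IsBigO.fun_sum fun j _ =>
    isBigO_mul (hT i j) (isBigO_mul (hu i) (hv j))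

theorem mm_isBigO' (μ : Fin 4) : (fun p => mm a p μ) =O[atInfinity] fun p => rad p ^ (0 : ℝ) := by
  simpa using mm_isBigO a μ

theorem mb_isBigO' (μ : Fin 4) : (fun p => mb a p μ) =O[atInfinity] fun p => rad p ^ (0 : ℝ) := by
  simpa using mb_isBigO a μ

theorem rho_isBigO : rho M a =O[atInfinity] fun p => rad p ^ (-1 : ℝ) := by
  unfold rho
  simpa using contr_two_isBigO (fun i j => (asy_covD_ell (n := 0) M a i j).left.isBigO)
    (mb_isBigO' a) (mm_isBigO' a)

theorem rho'_isBigO : rho' M a =O[atInfinity] fun p => rad p ^ (-1 : ℝ) := by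
  unfold rho'
  simpa using contr_two_isBigO (fun i j => (asy_covD_nn (n := 0) M a i j).left.isBigO)
    (mm_isBigO' a) (mb_isBigO' a)

/-- The exterior derivative of the one-form `ℓ`, to leading order. -/
theorem curl_ell (b c : Fin 4) :
    IsSymbol n (-3) fun p => covD (kerr M a) (lower (kerr M a) (ell M a)) p ![b, c]
      - covD (kerr M a) (lower (kerr M a) (ell M a)) p ![c, b]
      - ((-a * (pd b (fun q => sdφ q c) p - pd c (fun q => sdφ q b) p) : ℝ) : ℂ) := by
  have h := fun μ => isSymbol_lower_ell_sub (n := n + 1) M a μ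
  have h1 := ((h c).pd b).sub ((h b).pd c)
  refine (h1.mono (by norm_num)).congr ?_
  filter_upwards [eventually_rad_gt 0, (asy_lower M a (asy_ell M a) ![b]).left.differentiableAt
    (n := 0), (asy_lower M a (asy_ell M a) ![c]).left.differentiableAt (n := 0)] with p hp h2 h3
  have h4 : ∀ μ, DifferentiableAt ℝ (fun q => sdφ q μ) p := fun μ =>
    (isHomog_sdφ μ).differentiableAt hp.ne'
  have h5 : ∀ μ, DifferentiableAt ℝ (fun q => vt q μ - a * sdφ q μ) p := fun μ =>
    (differentiableAt_const (vt 0 μ)).fun_sub ((h4 μ).const_mul a)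
  have h6 : ∀ ν μ, pd ν (fun q => vt q μ - a * sdφ q μ) p = -a * pd ν (fun q => sdφ q μ) p := by
    intro ν μ
    rw [show (fun q => vt q μ - a * sdφ q μ) = fun q => vt 0 μ - a * sdφ q μ from rfl,
      pd_sub (differentiableAt_const _) ((h4 μ).const_mul a), pd_const,
      pd_mul (differentiableAt_const _) (h4 μ), pd_const]
    ring
  rw [covD_one_sub_swap (kerr_symm M a), pd_sub h3 (differentiableAt_ofReal (h5 c)),
    pd_sub h2 (differentiableAt_ofReal (h5 b)), pd_ofReal (h5 c), pd_ofReal (h5 b), h6, h6]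
  push_cast
  ring

/-- The exterior derivative of the one-form `n`, to leading order. -/
theorem curl_nn (b c : Fin 4) :
    IsSymbol n (-3) fun p => covD (kerr M a) (lower (kerr M a) (nn M a)) p ![b, c]
      - covD (kerr M a) (lower (kerr M a) (nn M a)) p ![c, b]
      - ((M * (rad p ^ 2)⁻¹ * (dr p b * vt p c - dr p c * vt p b)
        - a / 2 * (pd b (fun q => sdφ q c) p - pd c (fun q => sdφ q b) p) : ℝ) : ℂ) := by
  have h := fun μ => isSymbol_lower_nn_sub (n := n + 1) M a μ
  have h1 := ((h c).pd b).sub ((h b).pd c)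
  refine (h1.mono (by norm_num)).congr ?_
  filter_upwards [eventually_rad_gt 0, (asy_lower M a (asy_nn M a) ![b]).left.differentiableAt
    (n := 0), (asy_lower M a (asy_nn M a) ![c]).left.differentiableAt (n := 0)] with p hp h2 h3
  have h4 : ∀ μ, DifferentiableAt ℝ (fun q => sdφ q μ) p := fun μ =>
    (isHomog_sdφ μ).differentiableAt hp.ne'
  have h4' : ∀ μ, DifferentiableAt ℝ (fun q => dr q μ) p := fun μ =>
    (isHomog_dr μ).differentiableAt hp.ne'
  have hr : DifferentiableAt ℝ rad p := isHomog_rad.differentiableAt hp.ne'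
  have hi : DifferentiableAt ℝ (fun q => M * (rad q)⁻¹) p := (hr.fun_inv hp.ne').const_mul M
  have hi2 : DifferentiableAt ℝ (fun q => 1 / 2 - M * (rad q)⁻¹) p :=
    (differentiableAt_const _).fun_sub hi
  have h5a : ∀ μ, DifferentiableAt ℝ (fun q => (1 / 2 - M * (rad q)⁻¹) * vt q μ) p := fun μ =>
    hi2.mul_const _
  have h5b : ∀ μ, DifferentiableAt ℝ (fun q => (1 / 2 - M * (rad q)⁻¹) * vt q μ + dr q μ) p :=
    fun μ => (h5a μ).fun_add (h4' μ)
  have h5 : ∀ μ, DifferentiableAt ℝ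
      (fun q => (1 / 2 - M * (rad q)⁻¹) * vt q μ + dr q μ - a / 2 * sdφ q μ) p := fun μ =>
    (h5b μ).fun_sub ((h4 μ).const_mul _)
  have h6 : ∀ ν μ, pd ν (fun q => (1 / 2 - M * (rad q)⁻¹) * vt q μ + dr q μ - a / 2 * sdφ q μ) p
      = M * (rad p ^ 2)⁻¹ * dr p ν * vt p μ + pd ν (pd μ rad) p
        - a / 2 * pd ν (fun q => sdφ q μ) p := by
    intro ν μ
    have h7 : pd ν (fun q => dr q μ) p = pd ν (pd μ rad) p := by
      apply pd_congr
      filter_upwards [eventually_rad_ne hp.ne'] with q hq using (pd_rad hq μ).symm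
    rw [pd_sub (h5b μ) ((h4 μ).const_mul _), pd_add (h5a μ) (h4' μ),
      pd_mul (differentiableAt_const _) (h4 μ), pd_const, h7,
      show (fun q => (1 / 2 - M * (rad q)⁻¹) * vt q μ)
        = fun q => (1 / 2 - M * (rad q)⁻¹) * vt p μ from rfl,
      pd_mul hi2 (differentiableAt_const _), pd_const, pd_sub (differentiableAt_const _) hi,
      pd_const, pd_mul (differentiableAt_const _) (hr.fun_inv hp.ne'), pd_const,
      pd_inv hr hp.ne', pd_rad hp.ne', pow_two, mul_inv]
    ring
  rw [covD_one_sub_swap (kerr_symm M a), pd_sub h3 (differentiableAt_ofReal (h5 c)),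
    pd_sub h2 (differentiableAt_ofReal (h5 b)), pd_ofReal (h5 c), pd_ofReal (h5 b), h6, h6,
    pd_comm ((contDiffAt_rad hp.ne').of_le two_le_infty) c b]
  push_cast
  ring

end

section

variable {n : ℕ} (M a : ℝ)

theorem isSymbol_pd_sdφ (b c : Fin 4) : IsSymbol n (-2) fun p => pd b (fun q => sdφ q c) p :=
  ((isSymbol_sdφ (n + 1) c).pd b).mono (by norm_num)

theorem curl_ell_isBigO (b c : Fin 4) :
    (fun p => covD (kerr M a) (lower (kerr M a) (ell M a)) p ![b, c]
      - covD (kerr M a) (lower (kerr M a) (ell M a)) p ![c, b])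
      =O[atInfinity] fun p => rad p ^ (-2 : ℝ) := by
  have h := ((curl_ell (n := 0) M a b c).mono (by norm_num : (-3 : ℝ) ≤ -2)).add
    (((isSymbol_pd_sdφ b c).sub (isSymbol_pd_sdφ c b)).const_mul (-a)).ofReal
  exact h.isBigO.congr_left fun p => by ring

theorem curl_nn_isBigO (b c : Fin 4) :
    (fun p => covD (kerr M a) (lower (kerr M a) (nn M a)) p ![b, c]
      - covD (kerr M a) (lower (kerr M a) (nn M a)) p ![c, b])
      =O[atInfinity] fun p => rad p ^ (-2 : ℝ) := by
  have hi : IsSymbol 0 (-2) fun p => M * (rad p ^ 2)⁻¹ :=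
    ((asy_Sig_inv (n := 0) 0).right).const_mul M
  have hv : ∀ b c, IsSymbol 0 0 fun p => dr p b * vt p c := fun b c =>
    ((isSymbol_dr 0 b).mul (isSymbol_vt 0 c)).mono (by norm_num)
  have h := ((curl_nn (n := 0) M a b c).mono (by norm_num : (-3 : ℝ) ≤ -2)).add
    (((hi.mul ((hv b c).sub (hv c b))).mono (by norm_num)).sub
      (((isSymbol_pd_sdφ b c).sub (isSymbol_pd_sdφ c b)).const_mul (a / 2))).ofReal
  exact h.isBigO.congr_left fun p => by ring

theorem contr_two_conj_swap {T : Tensor 2} (hT : IsRealTensor T) (u v : VecField) (p : Pt) :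
    conj (contr T ![u, v] p) = contr T ![fun q i => conj (u q i), fun q i => conj (v q i)] p := by
  simp only [contr_two, map_sum, map_mul, hT p]

theorem im_isBigO_of_sub_conj {f : Pt → ℂ} {q : ℝ}
    (h : (fun p => f p - conj (f p)) =O[atInfinity] fun p => rad p ^ q) :
    (fun p => (f p).im) =O[atInfinity] fun p => rad p ^ q := by
  have h1 : (fun p => (f p).im) =O[atInfinity] fun p => f p - conj (f p) := by
    refine IsBigO.of_bound' (Eventually.of_forall fun p => ?_)
    rw [Complex.sub_conj, norm_mul, Complex.norm_I, mul_one, Complex.norm_real, Real.norm_eq_abs,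
      Real.norm_eq_abs, abs_mul]
    norm_num
    linarith [abs_nonneg (f p).im]
  exact h1.trans h

/-- The twist `ϱ - ϱ̄`, a component of the exterior derivative of the one-form `ℓ`, is `O(r⁻²)`. -/
theorem rho_im_isBigO :
    (fun p => (rho M a p).im) =O[atInfinity] fun p => rad p ^ (-2 : ℝ) := by
  apply im_isBigO_of_sub_conj
  set L := covD (kerr M a) (lower (kerr M a) (ell M a)) with hL
  have hreal : IsRealTensor L := (isRealTensor_lower_ell M a).covD _
  have h := contr_two_isBigO (T := fun p i => L p ![i 0, i 1] - L p ![i 1, i 0])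
    (fun i j => curl_ell_isBigO M a i j) (mb_isBigO' a) (mm_isBigO' a)
  simp only [add_zero] at h
  refine h.congr_left fun p => ?_
  have h1 : conj (contr L ![mb a, mm a] p) = ∑ i, ∑ j, L p ![j, i] * (mb a p i * mm a p j) := by
    rw [contr_two_conj_swap hreal, contr_two, Finset.sum_comm]
    exact Finset.sum_congr rfl fun i _ => Finset.sum_congr rfl fun j _ => by
      simp only [mb, Complex.conj_conj]
      ring
  rw [rho, ← hL, h1, contr_two, contr_two, ← Finset.sum_sub_distrib]
  refine Finset.sum_congr rfl fun i _ => ?_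
  rw [← Finset.sum_sub_distrib]
  exact Finset.sum_congr rfl fun j _ => by simp; ring

/-- The twist `ϱ' - ϱ̄'`, a component of the exterior derivative of the one-form `n`, is `O(r⁻²)`.
-/
theorem rho'_im_isBigO :
    (fun p => (rho' M a p).im) =O[atInfinity] fun p => rad p ^ (-2 : ℝ) := by
  apply im_isBigO_of_sub_conj
  set L := covD (kerr M a) (lower (kerr M a) (nn M a)) with hL
  have hreal : IsRealTensor L := (isRealTensor_lower_nn M a).covD _
  have h := contr_two_isBigO (T := fun p i => L p ![i 0, i 1] - L p ![i 1, i 0])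
    (fun i j => curl_nn_isBigO M a i j) (mm_isBigO' a) (mb_isBigO' a)
  simp only [add_zero] at h
  refine h.congr_left fun p => ?_
  have h1 : conj (contr L ![mm a, mb a] p) = ∑ i, ∑ j, L p ![j, i] * (mm a p i * mb a p j) := by
    rw [contr_two_conj_swap hreal, contr_two, Finset.sum_comm]
    exact Finset.sum_congr rfl fun i _ => Finset.sum_congr rfl fun j _ => by
      simp only [mb, Complex.conj_conj]
      ring
  rw [rho', ← hL, h1, contr_two, contr_two, ← Finset.sum_sub_distrib]
  refine Finset.sum_congr rfl fun i _ => ?_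
  rw [← Finset.sum_sub_distrib]
  exact Finset.sum_congr rfl fun j _ => by simp; ring

theorem lower_mink_ell₀ {p : Pt} (hp : rad p ≠ 0) (μ : Fin 4) :
    lower mink ell₀ p ![μ] = (vt p μ : ℂ) := by
  have h := dr_sq hp
  change ∑ ν, (mink p μ ν : ℂ) * ((dr p ν : ℝ) : ℂ) = _
  simp only [← Complex.ofReal_mul, ← Complex.ofReal_sum, mink_eq]
  rw [Complex.ofReal_inj]
  fin_cases μ <;> simp [Fin.sum_univ_four, vt, dr_zero]
  · linear_combination h
  · linear_combination (dr p 1) * h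
  · linear_combination (dr p 2) * h
  · linear_combination (dr p 3) * h

/-- On Minkowski space the covariant derivative of the one-form `ℓ = dt_*` is minus the Hessian of
`r`. -/
theorem covD_lower_mink_ell₀ {p : Pt} (hp : rad p ≠ 0) (b c : Fin 4) :
    covD mink (lower mink ell₀) p ![b, c] = -((pd b (pd c rad) p : ℝ) : ℂ) := by
  have h1 : (fun q => lower mink ell₀ q ![c]) =ᶠ[𝓝 p] fun _ => ((vt p c : ℝ) : ℂ) := by
    filter_upwards [eventually_rad_ne hp] with q hq using lower_mink_ell₀ hq c
  rw [covD_one, pd_congr h1, pd_const]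
  simp only [christoffel_mink hp, lower_mink_ell₀ hp]
  simp [Fin.sum_univ_four, vt]

/-- On Minkowski space `τ` vanishes, because the Hessian of `r` annihilates `∂_{t_*}` and the
radial direction. -/
theorem tau_isBigO : tau M a =O[atInfinity] fun p => rad p ^ (-2 : ℝ) := by
  set L := covD (kerr M a) (lower (kerr M a) (ell M a)) with hL
  -- the leading part of `n^b ∇_b ℓ_c` vanishes by Euler's relation
  have h1 : ∀ c, IsSymbol 0 (-2) fun p => ∑ b, nn M a p b * L p ![b, c] := by
    intro c
    have h := Asy.sum Finset.univ fun b _ =>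
      (asy_nn (n := 0) M a b).mul_zero' (asy_covD_ell M a b c)
    refine (h.diff.mono (by norm_num)).congr ?_
    filter_upwards [eventually_rad_gt 0] with p hp
    have he := (isHomog_rad.pd c).euler hp.ne'
    have h0 := (isHomog_rad.stat.pd c).pd_zero p
    have h2 : ∑ b, nn₀ p b * covD mink (lower mink ell₀) p ![b, c] = 0 := by
      simp only [covD_lower_mink_ell₀ hp.ne', nn₀, ← Complex.ofReal_mul, ← Complex.ofReal_neg,
        ← Complex.ofReal_sum]
      norm_num at he
      rw [Complex.ofReal_eq_zero]
      simp [Fin.sum_univ_four, vt, dr, h0]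
      field_simp
      linear_combination he
    rw [h2, sub_zero]
  have h2 : (fun p => ∑ c, mm a p c * ∑ b, nn M a p b * L p ![b, c])
      =O[atInfinity] fun p => rad p ^ (-2 : ℝ) :=
    IsBigO.fun_sum fun c _ => by simpa using isBigO_mul (mm_isBigO' a c) (h1 c).isBigO
  refine h2.congr_left fun p => ?_
  rw [tau, ← hL, contr_two, Finset.sum_comm]
  refine Finset.sum_congr rfl fun c _ => ?_
  rw [Finset.mul_sum]
  exact Finset.sum_congr rfl fun b _ => by ring

/-- The sum `n^b ∇_b ℓ_c + ℓ^b ∇_b n_c` only involves the exterior derivatives of the one-forms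
`ℓ` and `n`, since `ℓ · n = 1`. -/
theorem nn_covD_ell_add {p : Pt} (hd : (kerr M a p).det ≠ 0)
    (hgd : ∀ μ ν, DifferentiableAt ℝ (fun q => kerr M a q μ ν) p)
    (hld : ∀ μ, DifferentiableAt ℝ (fun q => ell M a q μ) p)
    (hnd : ∀ μ, DifferentiableAt ℝ (fun q => nn M a q μ) p)
    (hln : (fun q => ∑ μ, ∑ ν, (kerr M a q μ ν : ℂ) * (nn M a q μ * ell M a q ν)) =ᶠ[𝓝 p]
      fun _ => 1) (c : Fin 4) :
    ∑ b, nn M a p b * covD (kerr M a) (lower (kerr M a) (ell M a)) p ![b, c]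
      + ∑ b, ell M a p b * covD (kerr M a) (lower (kerr M a) (nn M a)) p ![b, c]
    = ∑ b, nn M a p b * (covD (kerr M a) (lower (kerr M a) (ell M a)) p ![b, c]
        - covD (kerr M a) (lower (kerr M a) (ell M a)) p ![c, b])
      + ∑ b, ell M a p b * (covD (kerr M a) (lower (kerr M a) (nn M a)) p ![b, c]
        - covD (kerr M a) (lower (kerr M a) (nn M a)) p ![c, b]) := by
  have h := covD_lower_add (kerr_symm M a) hd hgd hnd hld hln c
  simp only [mul_sub, Finset.sum_sub_distrib]
  linear_combination h

/-- The sum `τ' + τ̄` is a component of `n ⌟ dℓ + ℓ ⌟ dn`, to which the terms with `d(sin² θ dφ)`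
contribute `-a (n + ℓ/2) ⌟ d(sin² θ dφ)`. This vanishes to leading order, since `n + ℓ/2` tends to
`∂_{t_*}`. The term with the mass is a multiple of `dt_*`, which `m̄` annihilates to leading order.
-/
theorem tau'_add_conj_tau_isBigO :
    (fun p => tau' M a p + conj (tau M a p)) =O[atInfinity] fun p => rad p ^ (-3 : ℝ) := by
  set L := covD (kerr M a) (lower (kerr M a) (ell M a)) with hL
  set N := covD (kerr M a) (lower (kerr M a) (nn M a)) with hN
  have hLreal : IsRealTensor L := (isRealTensor_lower_ell M a).covD _
  set dω : Fin 4 → Fin 4 → Pt → ℝ := fun b c p =>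
    pd b (fun q => sdφ q c) p - pd c (fun q => sdφ q b) p with hdω
  have hdω0 : ∀ c p, dω 0 c p = 0 := by
    intro c p
    have h1 : (fun q => sdφ q 0) = fun _ => (0 : ℝ) := by funext q; simp [sdφ]
    rw [hdω]
    simp only [(isHomog_sdφ c).stat.pd_zero p, h1, pd_const, sub_zero]
  have hdωS : ∀ b c, IsSymbol 0 (-2) (dω b c) := fun b c =>
    (isSymbol_pd_sdφ b c).sub (isSymbol_pd_sdφ c b)
  have hi : IsSymbol 0 (-2) fun p => M * (rad p ^ 2)⁻¹ :=
    ((asy_Sig_inv (n := 0) 0).right).const_mul M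
  -- remainder terms
  have hR1 := fun c => IsSymbol.sum Finset.univ fun b _ =>
    ((asy_nn (n := 0) M a b).left.mul (curl_ell (n := 0) M a b c)).mono
      (by norm_num : (0 : ℝ) + -3 ≤ -3)
  have hR2 := fun c => IsSymbol.sum Finset.univ fun b _ =>
    ((asy_ell (n := 0) M a b).left.mul (curl_nn (n := 0) M a b c)).mono
      (by norm_num : (0 : ℝ) + -3 ≤ -3)
  -- `n + ℓ/2` is `∂_t` to leading order, which is annihilated by `dω`
  have hR3 : ∀ c, IsSymbol 0 (-3) fun p => ∑ b, (nnR M a p b + (1 / 2) * ellR M a p b - vt p b)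
      * (-a * dω b c p) := fun c => IsSymbol.sum _ fun b _ => by
    have h1 := ((asy_nnR (n := 0) M a b).add ((asy_ellR M a b).const_mul (1 / 2))).diff
    have h2 : IsSymbol 0 (-1) fun p => nnR M a p b + (1 / 2) * ellR M a p b - vt p b :=
      (h1.mono (by norm_num)).congr (Eventually.of_forall fun p => by ring)
    exact (h2.mul ((hdωS b c).const_mul (-a))).mono (by norm_num)
  have hR4 : (fun p => ((M * (rad p ^ 2)⁻¹ * ∑ b, ellR M a p b * dr p b : ℝ) : ℂ) * mb a p 0)
      =O[atInfinity] fun p => rad p ^ (-3 : ℝ) := by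
    have h1 : IsSymbol 0 0 fun p => ∑ b, ellR M a p b * dr p b :=
      IsSymbol.sum _ fun b _ => ((asy_ellR M a b).left.mul (isSymbol_dr 0 b)).mono (by norm_num)
    have h2 := isBigO_mul (hi.mul h1).ofReal.isBigO (mb_zero_isBigO a)
    refine (h2.trans (rpow_isBigO (by norm_num))).congr_left fun p => ?_
    push_cast
    rfl
  have hmain := (IsBigO.fun_sum (s := Finset.univ) fun c _ =>
    isBigO_mul (mb_isBigO' a c) (((hR1 c).add (hR2 c)).add (hR3 c).ofReal).isBigO)
  simp only [zero_add] at hmain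
  refine (hmain.add hR4).congr' ?_ EventuallyEq.rfl
  have hev : ∀ᶠ p in atInfinity,
      ∑ μ, ∑ ν, (kerr M a p μ ν : ℂ) * (nn M a p μ * ell M a p ν) = 1 := by
    filter_upwards [eventually_rad_gt 0, eventually_cyl_ne, eventually_Del_ne M a] with p hp hc hD
      using kerr_ell_nn M a hp.ne' hc hD
  have hgd := fun μ ν => (asy_kerr (n := 1) M a μ ν).left.differentiableAt
  have hld := fun μ => (asy_ell (n := 1) M a μ).left.differentiableAt
  have hnd := fun μ => (asy_nn (n := 1) M a μ).left.differentiableAt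
  simp only [← eventually_all] at hgd hld hnd
  filter_upwards [eventually_kerr_det_ne M a, hgd, hld, hnd, eventually_nhds_atInfinity hev]
    with p h1 h2 h3 h4 h5
  have hsum : tau' M a p + conj (tau M a p)
      = ∑ c, mb a p c * (∑ b, nn M a p b * L p ![b, c] + ∑ b, ell M a p b * N p ![b, c]) := by
    rw [tau, contr_two_conj_swap hLreal, tau', ← hN, contr_two, contr_two,
      Finset.sum_comm, Finset.sum_comm (f := fun i j => L p ![i, j] * _), ← Finset.sum_add_distrib]
    refine Finset.sum_congr rfl fun c _ => ?_
    rw [mul_add, Finset.mul_sum, Finset.mul_sum, add_comm]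
    congr 1 <;> refine Finset.sum_congr rfl fun b _ => ?_
    · simp [mb, nn_eq]; ring
    · ring
  rw [hsum]
  have hkey : ∀ c, ∑ b, nn M a p b * L p ![b, c] + ∑ b, ell M a p b * N p ![b, c]
    = (∑ b, nn M a p b * (L p ![b, c] - L p ![c, b] - ((-a * dω b c p : ℝ) : ℂ))
      + ∑ b, ell M a p b * (N p ![b, c] - N p ![c, b]
        - ((M * (rad p ^ 2)⁻¹ * (dr p b * vt p c - dr p c * vt p b) - a / 2 * dω b c p : ℝ) : ℂ))
      + ((∑ b, (nnR M a p b + (1 / 2) * ellR M a p b - vt p b) * (-a * dω b c p) : ℝ) : ℂ))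
      + ((M * (rad p ^ 2)⁻¹ * ∑ b, ellR M a p b * dr p b : ℝ) : ℂ) * vt p c := by
    intro c
    rw [nn_covD_ell_add M a h1 h2 h3 h4 h5 c]
    have h6 := hdω0 c p
    have h7 := ellR_zero M a p
    simp only [Fin.sum_univ_four, ell_eq, nn_eq, h6, h7, vt, Matrix.cons_val]
    push_cast
    ring
  simp only [hkey, mul_add (mb a p _) _ (_ * ((vt p _ : ℝ) : ℂ)), Finset.sum_add_distrib]
  congr 1
  simp [Fin.sum_univ_four, vt]
  ring

end

section

/-! ### Linearized Weyl scalars near infinity -/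

variable {n : ℕ} (M a κ : ℝ)

/-- The contraction of a tensor `K_{abcd}` which `spinHess` applies to `∇_a ∇_b h_{cd}`, for a
general tetrad `f`. -/
def spinContr (K : Tensor 4) (f : Fin 2 → Fin 2 → VecField) (A : Fin 4 → Fin 2) (p : Pt) : ℂ :=
  ∑ a₁ : Fin 2, ∑ b₁ : Fin 2, ∑ a₂ : Fin 2, ∑ b₂ : Fin 2,
    spinEps a₁ a₂ * spinEps b₁ b₂ *
      contr K ![f (A 0) a₁, f (A 1) b₁, f (A 2) a₂, f (A 3) b₂] p

/-- The Minkowski limit of the tetrad. -/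
def frame₀ : Fin 2 → Fin 2 → VecField :=
  ![![ell₀, mm₀], ![fun p μ => conj (mm₀ p μ), nn₀]]

/-- The second covariant derivative of the trace-free part of `h`. -/
def hess (g h : Bilin) : Tensor 4 := covD g (covD g (toTensor (traceFree g h)))

/-- The convergence of products of tetrad vectors is invariant under permutations of the factors. -/
theorem asy_frame_of_perm {X Y X' Y' : Fin 4 → Fin 2} (σ : Equiv.Perm (Fin 4))
    (hX : ∀ j, X' j = X (σ j)) (hY : ∀ j, Y' j = Y (σ j))
    (h : ∀ i : Fin 4 → Fin 4, Asy n 1 0 (fun p => ∏ j, frame M a (X j) (Y j) p (i j))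
      fun p => ∏ j, frame₀ (X j) (Y j) p (i j)) (i : Fin 4 → Fin 4) :
    Asy n 1 0 (fun p => ∏ j, frame M a (X' j) (Y' j) p (i j))
      fun p => ∏ j, frame₀ (X' j) (Y' j) p (i j) := by
  refine (h (i ∘ σ.symm)).congr (Eventually.of_forall fun p => ?_)
    (Eventually.of_forall fun p => ?_) <;>
  · refine (Equiv.prod_comp σ _).symm.trans (Finset.prod_congr rfl fun j _ => ?_)
    simp [hX, hY]

/-- Products of tetrad vectors of total spin weight zero tend to their Minkowski limits, uniformly
up to the axis. The hypotheses say that the spinor indices of either kind form two pairs of an `o`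
and an `ι`. -/
theorem asy_frame_prod {X Y : Fin 4 → Fin 2} (hX : X 0 + X 2 = 1 ∧ X 1 + X 3 = 1 ∨
    X 0 + X 1 = 1 ∧ X 2 + X 3 = 1 ∨ X 0 + X 3 = 1 ∧ X 1 + X 2 = 1)
    (hY : Y 0 + Y 2 = 1 ∧ Y 1 + Y 3 = 1 ∨
    Y 0 + Y 1 = 1 ∧ Y 2 + Y 3 = 1 ∨ Y 0 + Y 3 = 1 ∧ Y 1 + Y 2 = 1) (i : Fin 4 → Fin 4) :
    Asy n 1 0 (fun p => ∏ j, frame M a (X j) (Y j) p (i j))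
      fun p => ∏ j, frame₀ (X j) (Y j) p (i j) := by
  have hl := fun μ => asy_ell (n := n) M a μ
  have hn := fun μ => asy_nn (n := n) M a μ
  have hm := fun μ ν => asy_mm_mul_mb (n := n) a μ ν
  have h0 : ∀ i : Fin 4 → Fin 4, Asy n 1 0
      (fun p => ∏ j, frame M a (![0, 0, 1, 1] j) (![0, 0, 1, 1] j) p (i j))
      fun p => ∏ j, frame₀ (![0, 0, 1, 1] j) (![0, 0, 1, 1] j) p (i j) := fun i => by
    refine (((hl (i 0)).mul_zero' (hl (i 1))).mul_zero' ((hn (i 2)).mul_zero' (hn (i 3)))).congr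
      (Eventually.of_forall fun p => ?_) (Eventually.of_forall fun p => ?_) <;>
    · simp [Fin.prod_univ_four, frame, frame₀]; ring
  have h1 : ∀ i : Fin 4 → Fin 4, Asy n 1 0
      (fun p => ∏ j, frame M a (![0, 0, 1, 1] j) (![0, 1, 0, 1] j) p (i j))
      fun p => ∏ j, frame₀ (![0, 0, 1, 1] j) (![0, 1, 0, 1] j) p (i j) := fun i => by
    refine (((hl (i 0)).mul_zero' (hn (i 3))).mul_zero' (hm (i 1) (i 2))).congr
      (Eventually.of_forall fun p => ?_) (Eventually.of_forall fun p => ?_) <;>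
    · simp [Fin.prod_univ_four, frame, frame₀]; ring
  have h2 : ∀ i : Fin 4 → Fin 4, Asy n 1 0
      (fun p => ∏ j, frame M a (![0, 0, 1, 1] j) (![1, 1, 0, 0] j) p (i j))
      fun p => ∏ j, frame₀ (![0, 0, 1, 1] j) (![1, 1, 0, 0] j) p (i j) := fun i => by
    refine ((hm (i 0) (i 2)).mul_zero' (hm (i 1) (i 3))).congr
      (Eventually.of_forall fun p => ?_) (Eventually.of_forall fun p => ?_) <;>
    · simp [Fin.prod_univ_four, frame, frame₀]; ring
  have key : ∀ X Y : Fin 4 → Fin 2, (X 0 + X 2 = 1 ∧ X 1 + X 3 = 1 ∨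
      X 0 + X 1 = 1 ∧ X 2 + X 3 = 1 ∨ X 0 + X 3 = 1 ∧ X 1 + X 2 = 1) →
      (Y 0 + Y 2 = 1 ∧ Y 1 + Y 3 = 1 ∨
      Y 0 + Y 1 = 1 ∧ Y 2 + Y 3 = 1 ∨ Y 0 + Y 3 = 1 ∧ Y 1 + Y 2 = 1) →
      ∃ σ : Equiv.Perm (Fin 4), (∀ j, X j = ![0, 0, 1, 1] (σ j)) ∧
        ((∀ j, Y j = ![0, 0, 1, 1] (σ j)) ∨ (∀ j, Y j = ![0, 1, 0, 1] (σ j)) ∨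
        ∀ j, Y j = ![1, 1, 0, 0] (σ j)) := by
    decide
  obtain ⟨σ, hXσ, hYσ | hYσ | hYσ⟩ := key X Y hX hY
  · exact asy_frame_of_perm M a σ hXσ hYσ h0 i
  · exact asy_frame_of_perm M a σ hXσ hYσ h1 i
  · exact asy_frame_of_perm M a σ hXσ hYσ h2 i

theorem Asy.contr {m : ℕ} {δ q : ℝ} (hδ : δ ≤ 1) {K K₀ : Tensor m} {v v₀ : Fin m → VecField}
    (hK : ∀ i, Asy n δ q (fun p => K p i) fun p => K₀ p i)
    (hv : ∀ i : Fin m → Fin 4, Asy n 1 0 (fun p => ∏ j, v j p (i j)) fun p => ∏ j, v₀ j p (i j)) :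
    Asy n δ q (contr K v) (contr K₀ v₀) :=
  Asy.sum _ fun i _ => by simpa using (hK i).mul ((hv i).mono_delta hδ)

/-- In the contraction for the spinor indices `oo ι ι` all products of tetrad vectors have spin
weight zero, so that it is a symbol with a Minkowski limit. -/
theorem asy_spinContr {δ q : ℝ} (hδ : δ ≤ 1) {K K₀ : Tensor 4}
    (hK : ∀ i, Asy n δ q (fun p => K p i) fun p => K₀ p i) (s : Equiv.Perm (Fin 4)) :
    Asy n δ q (spinContr K (frame M a) (![0, 0, 1, 1] ∘ s))
      (spinContr K₀ frame₀ (![0, 0, 1, 1] ∘ s)) := by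
  set A : Fin 4 → Fin 2 := ![0, 0, 1, 1] ∘ s with hA
  have hA' : A 0 + A 2 = 1 ∧ A 1 + A 3 = 1 ∨ A 0 + A 1 = 1 ∧ A 2 + A 3 = 1 ∨
      A 0 + A 3 = 1 ∧ A 1 + A 2 = 1 := by
    have key : ∀ s : Equiv.Perm (Fin 4), ∀ A : Fin 4 → Fin 2, A = ![0, 0, 1, 1] ∘ s →
        (A 0 + A 2 = 1 ∧ A 1 + A 3 = 1 ∨ A 0 + A 1 = 1 ∧ A 2 + A 3 = 1 ∨
        A 0 + A 3 = 1 ∧ A 1 + A 2 = 1) := by decide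
    exact key s A hA
  refine Asy.sum _ fun a₁ _ => Asy.sum _ fun b₁ _ => Asy.sum _ fun a₂ _ => Asy.sum _ fun b₂ _ => ?_
  by_cases h : a₁ + a₂ = 1 ∧ b₁ + b₂ = 1
  · refine (Asy.contr hδ hK fun i => ?_).const_mul _
    refine (asy_frame_prod M a (X := A) (Y := ![a₁, b₁, a₂, b₂]) hA' (Or.inl h) i).congr
      (Eventually.of_forall fun p => ?_) (Eventually.of_forall fun p => ?_) <;>
    simp [Fin.prod_univ_four]
  · have h0 : spinEps a₁ a₂ * spinEps b₁ b₂ = 0 := by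
      fin_cases a₁ <;> fin_cases a₂ <;> fin_cases b₁ <;> fin_cases b₂ <;>
        simp [spinEps] at h ⊢
    simp only [h0, zero_mul]
    exact Asy.refl (IsSymbol.zero _ _) _

theorem frame_isBigO (A A' : Fin 2) (μ : Fin 4) :
    (fun p => frame M a A A' p μ) =O[atInfinity] fun p => rad p ^ (0 : ℝ) := by
  fin_cases A <;> fin_cases A'
  · exact (asy_ell (n := 0) M a μ).left.isBigO
  · exact mm_isBigO' a μ
  · exact mb_isBigO' a μ
  · exact (asy_nn (n := 0) M a μ).left.isBigO

theorem contr_four_isBigO {K : Tensor 4} {q : ℝ} {u v w z : VecField}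
    (hK : ∀ i, (fun p => K p i) =O[atInfinity] fun p => rad p ^ q)
    (hu : ∀ i, (fun p => u p i) =O[atInfinity] fun p => rad p ^ (0 : ℝ))
    (hv : ∀ i, (fun p => v p i) =O[atInfinity] fun p => rad p ^ (0 : ℝ))
    (hw : ∀ i, (fun p => w p i) =O[atInfinity] fun p => rad p ^ (0 : ℝ))
    (hz : ∀ i, (fun p => z p i) =O[atInfinity] fun p => rad p ^ (0 : ℝ)) :
    contr K ![u, v, w, z] =O[atInfinity] fun p => rad p ^ q := by
  refine IsBigO.congr_left ?_ fun p => (contr_four K u v w z p).symm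
  refine IsBigO.fun_sum fun i _ => IsBigO.fun_sum fun j _ => IsBigO.fun_sum fun k _ =>
    IsBigO.fun_sum fun l _ => ?_
  simpa using isBigO_mul (hK ![i, j, k, l])
    (isBigO_mul (isBigO_mul (isBigO_mul (hu i) (hv j)) (hw k)) (hz l))

theorem spinContr_isBigO {K : Tensor 4} {q : ℝ}
    (hK : ∀ i, (fun p => K p i) =O[atInfinity] fun p => rad p ^ q) (A : Fin 4 → Fin 2) :
    spinContr K (frame M a) A =O[atInfinity] fun p => rad p ^ q := by
  refine IsBigO.fun_sum fun a₁ _ => IsBigO.fun_sum fun b₁ _ => IsBigO.fun_sum fun a₂ _ =>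
    IsBigO.fun_sum fun b₂ _ => IsBigO.const_mul_left ?_ _
  exact contr_four_isBigO hK (frame_isBigO M a _ _) (frame_isBigO M a _ _) (frame_isBigO M a _ _)
    (frame_isBigO M a _ _)

/-- `Ψ₀ = O(r⁻³)`; the product `ℓ m m̄ n` has spin weight zero. -/
theorem isSymbol_Psi0 : IsSymbol n (-3) (Psi0 M a) := by
  refine (Asy.contr (K := weyl (kerr M a)) (K₀ := weyl (kerr M a))
    (v₀ := ![ell₀, mm₀, fun p μ => conj (mm₀ p μ), nn₀]) le_rfl
    (fun i => Asy.refl (isSymbol_weyl M a i) 1) fun i => ?_).left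
  refine (asy_frame_prod M a (X := ![0, 0, 1, 1]) (Y := ![0, 1, 0, 1]) (by decide) (by decide)
    i).congr (Eventually.of_forall fun p => ?_) (Eventually.of_forall fun p => ?_) <;>
  · simp [Fin.prod_univ_four, frame, frame₀]

theorem Psi1_isBigO : Psi1 M a =O[atInfinity] fun p => rad p ^ (-3 : ℝ) :=
  contr_four_isBigO (fun i => (isSymbol_weyl (n := 0) M a i).isBigO) (frame_isBigO M a 0 0)
    (frame_isBigO M a 1 1) (frame_isBigO M a 0 0) (frame_isBigO M a 0 1)

theorem PsiM1_isBigO : PsiM1 M a =O[atInfinity] fun p => rad p ^ (-3 : ℝ) :=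
  contr_four_isBigO (fun i => (isSymbol_weyl (n := 0) M a i).isBigO) (frame_isBigO M a 0 0)
    (frame_isBigO M a 1 1) (frame_isBigO M a 1 0) (frame_isBigO M a 1 1)

section perturbation

variable {h h₀ : Bilin} {δ q : ℝ}

theorem asy_tr (hδ : δ ≤ 1) (hh : ∀ μ ν, Asy n δ q (fun p => h p μ ν) fun p => h₀ p μ ν) :
    Asy n δ q (tr (kerr M a) h) (tr mink h₀) :=
  Asy.sum _ fun i _ => Asy.sum _ fun j _ =>
    ((asy_kerr_inv M a i j).mono_delta hδ).mul_zero' (hh i j)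

theorem asy_traceFree (hδ : δ ≤ 1)
    (hh : ∀ μ ν, Asy n δ q (fun p => h p μ ν) fun p => h₀ p μ ν) (μ ν : Fin 4) :
    Asy n δ q (fun p => traceFree (kerr M a) h p μ ν) fun p => traceFree mink h₀ p μ ν := by
  have h1 := ((asy_kerr (n := n) M a μ ν).mono_delta hδ).mul_zero' (asy_tr M a hδ hh)
  refine ((hh μ ν).sub (h1.const_mul (1 / 4))).congr (Eventually.of_forall fun p => ?_)
    (Eventually.of_forall fun p => ?_) <;>
  · simp only [traceFree, Matrix.sub_apply, Matrix.smul_apply, smul_eq_mul]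
    ring

theorem asy_covD_covD (hδ : δ ≤ 1)
    (hh : ∀ μ ν, Asy (n + 2) δ q (fun p => h p μ ν) fun p => h₀ p μ ν) (i : Fin 4 → Fin 4) :
    Asy n δ (q - 2) (fun p => covD (kerr M a) (covD (kerr M a) (toTensor h)) p i)
      fun p => covD mink (covD mink (toTensor h₀)) p i :=
  (Asy.covD M a hδ (Asy.covD M a hδ (T := toTensor h) (T₀ := toTensor h₀)
    fun i => (hh (i 0) (i 1)).ofReal) i).mono (by linarith)

theorem asy_hess (hδ : δ ≤ 1)
    (hh : ∀ μ ν, Asy (n + 2) δ q (fun p => h p μ ν) fun p => h₀ p μ ν) (i : Fin 4 → Fin 4) :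
    Asy n δ (q - 2) (fun p => hess (kerr M a) h p i) fun p => hess mink h₀ p i :=
  asy_covD_covD M a hδ (asy_traceFree M a hδ hh) i

/-- The linearized Weyl scalar of weight zero, with its Minkowski limit. -/
theorem asy_spinHessSym (hδ : δ ≤ 1)
    (hh : ∀ μ ν, Asy (n + 2) δ q (fun p => h p μ ν) fun p => h₀ p μ ν) :
    Asy n δ (q - 2) (spinHessSym M a h ![0, 0, 1, 1]) fun p => (1 / 24) *
      ∑ s : Equiv.Perm (Fin 4), spinContr (hess mink h₀) frame₀ (![0, 0, 1, 1] ∘ s) p :=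
  (Asy.sum _ fun s _ => asy_spinContr M a hδ (asy_hess M a hδ hh) s).const_mul (1 / 24)

/-- The scalar `ϑΨ₀` with its Minkowski limit, to which the trace term does not contribute because
of the decay of `Ψ₀`. -/
theorem asy_varPsi0 (hδ0 : 0 ≤ δ) (hδ : δ ≤ 1)
    (hh : ∀ μ ν, Asy (n + 2) δ q (fun p => h p μ ν) fun p => h₀ p μ ν) :
    Asy n δ (q - 2) (varPsi0 κ M a h) fun p => (1 / 2) * ((1 / 24) *
      ∑ s : Equiv.Perm (Fin 4), spinContr (hess mink h₀) frame₀ (![0, 0, 1, 1] ∘ s) p) := by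
  have h1 := (asy_spinHessSym M a hδ hh).const_mul (1 / 2)
  have h2 := ((((asy_tr M a hδ hh).left.of_le (n.le_add_right 2)).ofReal).const_mul
    (κ : ℂ)).mul (isSymbol_Psi0 (n := n) M a)
  exact (h1.add (Asy.of_lower (h2.mono (by linarith)) hδ0)).congr
    (Eventually.of_forall fun p => by simp only [varPsi0]) (Eventually.of_forall fun p => by simp)

theorem spinHessSym_isBigO (hh : ∀ μ ν, IsSymbol 2 q fun p => h p μ ν) (A : Fin 4 → Fin 2) :
    spinHessSym M a h A =O[atInfinity] fun p => rad p ^ (q - 2) := by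
  refine IsBigO.const_mul_left (IsBigO.fun_sum fun s _ => ?_) _
  exact spinContr_isBigO M a (fun i => (asy_hess (n := 0) M a le_rfl
    (fun μ ν => Asy.refl (hh μ ν) 1) i).left.isBigO) _

theorem tr_mul_isBigO (hh : ∀ μ ν, IsSymbol 2 q fun p => h p μ ν) {Ψ : Pt → ℂ}
    (hΨ : Ψ =O[atInfinity] fun p => rad p ^ (-3 : ℝ)) :
    (fun p => κ * tr (kerr M a) h p * Ψ p) =O[atInfinity] fun p => rad p ^ (q - 2) := by
  have h1 := ((asy_tr M a le_rfl fun μ ν => Asy.refl (hh μ ν) 1).left.ofReal.const_mul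
    (κ : ℂ)).isBigO
  exact (isBigO_mul h1 hΨ).trans (rpow_isBigO (by linarith))

theorem varPsi1_isBigO (hh : ∀ μ ν, IsSymbol 2 q fun p => h p μ ν) :
    varPsi1 κ M a h =O[atInfinity] fun p => rad p ^ (q - 2) :=
  ((spinHessSym_isBigO M a hh _).const_mul_left _).add
    (tr_mul_isBigO M a κ hh (Psi1_isBigO M a))

theorem varPsiM1_isBigO (hh : ∀ μ ν, IsSymbol 2 q fun p => h p μ ν) :
    varPsiM1 κ M a h =O[atInfinity] fun p => rad p ^ (q - 2) :=
  ((spinHessSym_isBigO M a hh _).const_mul_left _).add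
    (tr_mul_isBigO M a κ hh (PsiM1_isBigO M a))

end perturbation

end

section

/-! ### Order counting for `𝕀_ζ` -/

/-- `f = O(r^q)` near infinity. -/
def HasOrder (q : ℝ) (f : Pt → ℂ) : Prop := f =O[atInfinity] fun p => rad p ^ q

namespace HasOrder

variable {q q' : ℝ} {f g : Pt → ℂ}

theorem mul (hf : HasOrder q f) (hg : HasOrder q' g) : HasOrder (q + q') fun p => f p * g p :=
  isBigO_mul hf hg

theorem mono (hf : HasOrder q f) (h : q ≤ q') : HasOrder q' f := IsBigO.trans hf (rpow_isBigO h)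

theorem add (hf : HasOrder q f) (hg : HasOrder q g) : HasOrder q fun p => f p + g p :=
  IsBigO.add hf hg

theorem sub (hf : HasOrder q f) (hg : HasOrder q g) : HasOrder q fun p => f p - g p :=
  IsBigO.sub hf hg

theorem const_mul (c : ℂ) (hf : HasOrder q f) : HasOrder q fun p => c * f p :=
  IsBigO.const_mul_left hf c

theorem pow (hf : HasOrder q f) (k : ℕ) : HasOrder (k * q) fun p => f p ^ k := by
  induction k with
  | zero =>
    simp only [pow_zero, Nat.cast_zero, zero_mul]
    exact (IsSymbol.const 0 (1 : ℂ)).isBigO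
  | succ k ih =>
    simp only [pow_succ]
    exact (ih.mul hf).mono (by push_cast; linarith)

theorem conjugate (hf : HasOrder q f) : HasOrder q fun p => starRingEnd ℂ (f p) :=
  (IsBigO.congr_left (IsBigO.norm_left hf) fun p => by simp).of_norm_left

theorem re (hf : HasOrder q f) : HasOrder q fun p => ((f p).re : ℂ) :=
  (IsBigO.of_bound' (Eventually.of_forall fun p => by
    rw [Complex.norm_real]; exact Complex.abs_re_le_norm _)).trans hf

theorem im (hf : HasOrder q f) : HasOrder q fun p => ((f p).im : ℂ) :=
  (IsBigO.of_bound' (Eventually.of_forall fun p => by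
    rw [Complex.norm_real]; exact Complex.abs_im_le_norm _)).trans hf

theorem congr (hf : HasOrder q f) (h : ∀ᶠ p in atInfinity, f p = g p) : HasOrder q g :=
  IsBigO.congr' hf h EventuallyEq.rfl

/-- Replacing a factor by its leading part changes the real part only by lower order terms. -/
theorem re_mul_congr {f₀ : Pt → ℂ} (hf : HasOrder q fun p => f p - f₀ p) (hg : HasOrder q' g)
    (h : HasOrder (q + q') fun p => ((f₀ p * g p).re : ℂ)) :
    HasOrder (q + q') fun p => ((f p * g p).re : ℂ) := by
  refine ((hf.mul hg).re.add h).congr (Eventually.of_forall fun p => ?_)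
  rw [← Complex.ofReal_add, ← Complex.add_re]
  congr 2
  ring

end HasOrder

theorem IsSymbol.hasOrder {n : ℕ} {q : ℝ} {f : Pt → ℂ} (h : IsSymbol n q f) : HasOrder q f :=
  h.isBigO

theorem hasOrder_contr_two {h : Bilin} {u v : VecField} {q : ℝ}
    (hh : ∀ μ ν, IsSymbol 0 q fun p => h p μ ν) (hu : ∀ i, HasOrder 0 fun p => u p i)
    (hv : ∀ i, HasOrder 0 fun p => v p i) : HasOrder q (contr (toTensor h) ![u, v]) := by
  have := contr_two_isBigO (T := toTensor h) (fun i j => (hh i j).ofReal.isBigO) hu hv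
  rw [add_zero, add_zero] at this
  exact this

theorem hasOrder_dirD {v : VecField} {F : Pt → ℂ} {q : ℝ} (hv : ∀ i, HasOrder 0 fun p => v p i)
    (hF : IsSymbol 1 q F) : HasOrder (q - 1) (dirD v F) :=
  IsBigO.fun_sum fun i _ => by simpa using isBigO_mul (hv i) (hF.pd i).isBigO

section terms

variable (κ M a : ℝ) (h : Bilin)

/-- The part of `𝕀_ζ` with derivatives along `ℓ` and `n`. -/
def termRadial (x : Pt) : ℂ :=
  (1 / 4) * pS a x * ((pS a x - conj (pS a x)) ^ 2 *
    (rho' M a x * dirD (ell M a) (fun y => pS a y ^ 4 * varPsi0 κ M a h y) x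
      + rho M a x * dirD (nn M a) (fun y => pS a y ^ 4 * varPsi0 κ M a h y) x))

/-- The part of `𝕀_ζ` with derivatives along `m` and `m̄`. -/
def termAngular (x : Pt) : ℂ :=
  (1 / 4) * pS a x * ((pS a x + conj (pS a x)) ^ 2 *
    (tau' M a x * dirD (mm a) (fun y => pS a y ^ 4 * varPsi0 κ M a h y) x
      + tau M a x * dirD (mb a) (fun y => pS a y ^ 4 * varPsi0 κ M a h y) x))

/-- The coefficient of `p⁵ ϑΨ₀` in the second line of `𝕀_ζ`. -/
def bracket (x : Pt) : ℂ :=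
  Psi0 M a x * (pS a x ^ 2 + conj (pS a x) ^ 2) - 2 * conj (Psi0 M a x) * conj (pS a x) ^ 2
    - 4 * pS a x * ((pS a x - conj (pS a x)) * rho M a x * rho' M a x
      - (pS a x + conj (pS a x)) * tau M a x * tau' M a x)

/-- The part of `𝕀_ζ` without derivatives of `h`. -/
def termMetric (x : Pt) : ℂ :=
  let H : VecField → VecField → ℂ := fun u v => contr (toTensor h) ![u, v] x
  (3 / 8) * Psi0 M a x * pS a x ^ 5 *
    ((pS a x - conj (pS a x)) ^ 2 * (H (nn M a) (nn M a) * rho M a x ^ 2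
        + 2 * H (ell M a) (nn M a) * rho M a x * rho' M a x
        + H (ell M a) (ell M a) * rho' M a x ^ 2)
      - 2 * (pS a x ^ 2 + conj (pS a x) ^ 2) * (H (nn M a) (mb a) * rho M a x * tau M a x
        + H (ell M a) (mb a) * rho' M a x * tau M a x
        + H (nn M a) (mm a) * rho M a x * tau' M a x
        + H (ell M a) (mm a) * rho' M a x * tau' M a x)
      + (pS a x + conj (pS a x)) ^ 2 * (H (mb a) (mb a) * tau M a x ^ 2
        + 2 * H (mm a) (mb a) * tau M a x * tau' M a x + H (mm a) (mm a) * tau' M a x ^ 2))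

/-- The splitting of `𝕀_ζ` into terms which are estimated separately. -/
theorem Izeta_eq (x : Pt) : Izeta κ M a h x = termRadial κ M a h x - termAngular κ M a h x
    + (1 / 4) * (((pS a x ^ 5 * varPsi0 κ M a h x * bracket M a x).re : ℝ) : ℂ)
    + 2 * Complex.I * (((pS a x ^ 6 * conj (pS a x) * (varPsiM1 κ M a h x * rho M a x * tau M a x
      + varPsi1 κ M a h x * rho' M a x * tau' M a x)).im : ℝ) : ℂ)
    - termMetric M a h x := by
  simp only [Izeta, termRadial, termAngular, bracket, termMetric]
  ring

end terms

variable (κ M a : ℝ)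

theorem hasOrder_pS : HasOrder 1 (pS a) := (asy_pS (n := 0) a).left.hasOrder

theorem hasOrder_conj_pS : HasOrder 1 fun p => conj (pS a p) := (hasOrder_pS a).conjugate

theorem hasOrder_pS_add : HasOrder 1 fun p => pS a p + conj (pS a p) :=
  (hasOrder_pS a).add (hasOrder_conj_pS a)

theorem pS_sub_conj (p : Pt) :
    pS a p - conj (pS a p) = Complex.I * ((-2 * a * cosθ p : ℝ) : ℂ) := by
  simp [pS]; ring

theorem pS_add_conj (p : Pt) : pS a p + conj (pS a p) = 2 * (rad p : ℂ) := by
  simp [pS]; ring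

theorem hasOrder_pS_sub : HasOrder 0 fun p => pS a p - conj (pS a p) := by
  simp only [pS_sub_conj]
  exact ((((isSymbol_cosθ 0).const_mul (-2 * a)).ofReal).const_mul Complex.I).hasOrder

theorem hasOrder_tau' : HasOrder (-2) (tau' M a) := by
  have h1 : HasOrder (-2) fun p => conj (tau M a p) := HasOrder.conjugate (tau_isBigO M a)
  have h2 : HasOrder (-3) _ := tau'_add_conj_tau_isBigO M a
  exact ((h2.mono (by norm_num)).sub h1).congr (Eventually.of_forall fun p => by ring)

theorem hasOrder_bracket : HasOrder (-1) (bracket M a) := by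
  have hΨ : HasOrder (-3) (Psi0 M a) := (isSymbol_Psi0 (n := 0) M a).hasOrder
  have hρ : HasOrder (-1) (rho M a) := rho_isBigO M a
  have hρ' : HasOrder (-1) (rho' M a) := rho'_isBigO M a
  have hτ : HasOrder (-2) (tau M a) := tau_isBigO M a
  have hp2 := (hasOrder_pS a).pow 2
  have hpb2 := (hasOrder_conj_pS a).pow 2
  have h1 := (hΨ.mul (hp2.add hpb2)).mono (by norm_num : _ ≤ (-1 : ℝ))
  have h2 := ((hΨ.conjugate.const_mul 2).mul hpb2).mono (by norm_num : _ ≤ (-1 : ℝ))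
  have h3 := (((hasOrder_pS_sub a).mul hρ).mul hρ').mono (by norm_num : _ ≤ (-2 : ℝ))
  have h4 := (((hasOrder_pS_add a).mul hτ).mul (hasOrder_tau' M a)).mono
    (by norm_num : _ ≤ (-2 : ℝ))
  have h5 := (((hasOrder_pS a).const_mul 4).mul (h3.sub h4)).mono (by norm_num : _ ≤ (-1 : ℝ))
  exact (h1.sub h2).sub h5

theorem hasOrder_nn (i : Fin 4) : HasOrder 0 fun p => nn M a p i := frame_isBigO M a 1 1 i
theorem hasOrder_ell (i : Fin 4) : HasOrder 0 fun p => ell M a p i := frame_isBigO M a 0 0 i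
theorem hasOrder_mm (i : Fin 4) : HasOrder 0 fun p => mm a p i := frame_isBigO 0 a 0 1 i
theorem hasOrder_mb (i : Fin 4) : HasOrder 0 fun p => mb a p i := frame_isBigO 0 a 1 0 i

variable {h : Bilin} {q : ℝ}

theorem isSymbol_varPsi0 (hh : ∀ μ ν, IsSymbol 3 q fun p => h p μ ν) :
    IsSymbol 1 (q - 2) (varPsi0 κ M a h) :=
  (asy_varPsi0 M a κ zero_le_one le_rfl fun μ ν => Asy.refl (hh μ ν) 1).left

theorem isSymbol_pS_pow_mul_varPsi0 (hh : ∀ μ ν, IsSymbol 3 q fun p => h p μ ν) :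
    IsSymbol 1 (q + 2) fun y => pS a y ^ 4 * varPsi0 κ M a h y :=
  (((asy_pS a).left.pow 4).mul (isSymbol_varPsi0 κ M a hh)).mono (by push_cast; linarith)

theorem hasOrder_termRadial (hh : ∀ μ ν, IsSymbol 3 q fun p => h p μ ν) :
    HasOrder (q + 1) (termRadial κ M a h) := by
  have hF := isSymbol_pS_pow_mul_varPsi0 κ M a hh
  have h1 := HasOrder.mul (rho'_isBigO M a) (hasOrder_dirD (hasOrder_ell M a) hF)
  have h2 := HasOrder.mul (rho_isBigO M a) (hasOrder_dirD (hasOrder_nn M a) hF)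
  exact ((((hasOrder_pS a).const_mul _).mul (((hasOrder_pS_sub a).pow 2).mul (h1.add h2)))).mono
    (by push_cast; linarith)

theorem hasOrder_termAngular (hh : ∀ μ ν, IsSymbol 3 q fun p => h p μ ν) :
    HasOrder (q + 2) (termAngular κ M a h) := by
  have hF := isSymbol_pS_pow_mul_varPsi0 κ M a hh
  have h1 := HasOrder.mul (hasOrder_tau' M a) (hasOrder_dirD (hasOrder_mm a) hF)
  have h2 := HasOrder.mul (tau_isBigO M a) (hasOrder_dirD (hasOrder_mb a) hF)
  exact ((((hasOrder_pS a).const_mul _).mul (((hasOrder_pS_add a).pow 2).mul (h1.add h2)))).mono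
    (by push_cast; linarith)

theorem hasOrder_termMetric (hh : ∀ μ ν, IsSymbol 3 q fun p => h p μ ν) :
    HasOrder (q + 1) (termMetric M a h) := by
  have hΨ : HasOrder (-3) (Psi0 M a) := (isSymbol_Psi0 (n := 0) M a).hasOrder
  have hρ : HasOrder (-1) (rho M a) := rho_isBigO M a
  have hρ' : HasOrder (-1) (rho' M a) := rho'_isBigO M a
  have hτ : HasOrder (-2) (tau M a) := tau_isBigO M a
  have hτ' := hasOrder_tau' M a
  have hh0 := fun μ ν => (hh μ ν).of_le (Nat.zero_le 3)
  have hl := hasOrder_ell M a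
  have hn := hasOrder_nn M a
  have hm := hasOrder_mm a
  have hb := hasOrder_mb a
  have hH : ∀ {u v : VecField}, (∀ i, HasOrder 0 fun p => u p i) →
      (∀ i, HasOrder 0 fun p => v p i) → HasOrder q (contr (toTensor h) ![u, v]) :=
    fun hu hv => hasOrder_contr_two hh0 hu hv
  have h1 := ((((hH hn hn).mul (hρ.pow 2)).mono (by push_cast; linarith : _ ≤ q - 2)).add
    (((((hH hl hn).const_mul 2).mul hρ).mul hρ').mono (by linarith))).add
    (((hH hl hl).mul (hρ'.pow 2)).mono (by push_cast; linarith))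
  have h2 := ((((((hH hn hb).mul hρ).mul hτ).mono (by linarith : _ ≤ q - 3)).add
    ((((hH hl hb).mul hρ').mul hτ).mono (by linarith))).add
    ((((hH hn hm).mul hρ).mul hτ').mono (by linarith))).add
    ((((hH hl hm).mul hρ').mul hτ').mono (by linarith))
  have h3 := ((((hH hb hb).mul (hτ.pow 2)).mono (by push_cast; linarith : _ ≤ q - 4)).add
    (((((hH hm hb).const_mul 2).mul hτ).mul hτ').mono (by linarith))).add
    (((hH hm hm).mul (hτ'.pow 2)).mono (by push_cast; linarith))
  have h4 := (((((hasOrder_pS_sub a).pow 2).mul h1).mono (by push_cast; linarith : _ ≤ q - 1)).sub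
    ((((((hasOrder_pS a).pow 2).add ((hasOrder_conj_pS a).pow 2)).const_mul 2).mul h2).mono
      (by push_cast; linarith))).add
    ((((hasOrder_pS_add a).pow 2).mul h3).mono (by push_cast; linarith))
  exact (((hΨ.const_mul (3 / 8)).mul ((hasOrder_pS a).pow 5)).mul h4).mono
    (by push_cast; linarith)

/-- A perturbation of order `q` has `𝕀_ζ` of order `q + 2`. -/
theorem Izeta_isBigO (hh : ∀ μ ν, IsSymbol 3 q fun p => h p μ ν) :
    Izeta κ M a h =O[atInfinity] fun p => rad p ^ (q + 2) := by
  have hh2 := fun μ ν => (hh μ ν).of_succ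
  have hρ : HasOrder (-1) (rho M a) := rho_isBigO M a
  have hρ' : HasOrder (-1) (rho' M a) := rho'_isBigO M a
  have hτ : HasOrder (-2) (tau M a) := tau_isBigO M a
  have hϑ1 : HasOrder (q - 2) (varPsi1 κ M a h) := varPsi1_isBigO M a κ hh2
  have hϑm : HasOrder (q - 2) (varPsiM1 κ M a h) := varPsiM1_isBigO M a κ hh2
  have h1 := (hasOrder_termRadial κ M a hh).mono (by linarith : _ ≤ q + 2)
  have h2 := ((((hasOrder_pS a).pow 5).mul (isSymbol_varPsi0 κ M a hh).hasOrder).mul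
    (hasOrder_bracket M a)).mono (by push_cast; linarith : _ ≤ q + 2)
  have h3 := ((((hasOrder_pS a).pow 6).mul (hasOrder_conj_pS a)).mul
    ((((hϑm.mul hρ).mul hτ).mono (by linarith : _ ≤ q - 5)).add
      (((hϑ1.mul hρ').mul (hasOrder_tau' M a)).mono (by linarith)))).mono
    (by push_cast; linarith : _ ≤ q + 2)
  have h4 := (hasOrder_termMetric M a hh).mono (by linarith : _ ≤ q + 2)
  have h5 := ((((h1.sub (hasOrder_termAngular κ M a hh)).add (h2.re.const_mul (1 / 4))).add
    (h3.im.const_mul (2 * Complex.I))).sub h4)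
  exact h5.congr (Eventually.of_forall fun p => (Izeta_eq κ M a h p).symm)

/-! ### The real part of `𝕀_ζ` when the linearized Weyl scalar is real to leading order -/

/-- The coefficient of `p⁵ ϑΨ₀` in the second line of `𝕀_ζ` is imaginary to leading order, because
`ϱ` and `ϱ'` are real to leading order. -/
theorem hasOrder_re_bracket : HasOrder (-2) fun p => ((bracket M a p).re : ℂ) := by
  have hΨ : HasOrder (-3) (Psi0 M a) := (isSymbol_Psi0 (n := 0) M a).hasOrder
  have hρ : HasOrder (-1) (rho M a) := rho_isBigO M a
  have hρ' : HasOrder (-1) (rho' M a) := rho'_isBigO M a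
  have hτ : HasOrder (-2) (tau M a) := tau_isBigO M a
  have hρi : HasOrder (-2) fun p => ((rho M a p).im : ℂ) :=
    (Complex.isBigO_ofReal_left).2 (rho_im_isBigO M a)
  have hρi' : HasOrder (-2) fun p => ((rho' M a p).im : ℂ) :=
    (Complex.isBigO_ofReal_left).2 (rho'_im_isBigO M a)
  have hp := hasOrder_pS a
  have hb := hasOrder_conj_pS a
  have hm := hasOrder_pS_sub a
  -- `Ψ (p² + p̄²) - 2 Ψ̄ p̄²` is `2 p̄² (Ψ - Ψ̄)` up to lower order terms, where `Ψ - Ψ̄` is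
  -- imaginary and `p̄²` is real to leading order
  have h1 := ((hΨ.mul (hm.mul (hasOrder_pS_add a))).mono (by norm_num : _ ≤ (-2 : ℝ)))
  have h2 : HasOrder (-2) fun p =>
      ((2 * conj (pS a p) ^ 2 * (Psi0 M a p - conj (Psi0 M a p))).re : ℂ) := by
    have h3 := (((hm.mul (hasOrder_pS_add a)).mul (hΨ.sub hΨ.conjugate))).mono
      (by norm_num : _ ≤ (-2 : ℝ))
    refine (h3.re.const_mul (-1)).congr (Eventually.of_forall fun p => ?_)
    rw [show (-1 : ℂ) = ((-1 : ℝ) : ℂ) by norm_num, ← Complex.ofReal_mul]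
    congr 1
    simp [pow_two]
    ring
  have h3 := (((hp.const_mul 4).mul (((hasOrder_pS_add a).mul hτ).mul (hasOrder_tau' M a)))).mono
    (by norm_num : _ ≤ (-2 : ℝ))
  have h4 : HasOrder (-2) fun p =>
      ((4 * pS a p * ((pS a p - conj (pS a p)) * rho M a p * rho' M a p)).re : ℂ) := by
    have h5 : HasOrder (-3) fun p => ((rho M a p * rho' M a p).im : ℂ) := by
      refine (((hρ.re.mul hρi').mono (by norm_num)).add ((hρi.mul hρ'.re).mono
        (by norm_num : _ ≤ (-3 : ℝ)))).congr (Eventually.of_forall fun p => ?_)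
      rw [Complex.mul_im]; push_cast; ring
    have h6 := (((hp.re.mul hm.im).mul h5).const_mul (-4)).mono (by norm_num : _ ≤ (-2 : ℝ))
    have h8 : HasOrder 0 fun p => ((pS a p).im : ℂ) := by
      refine (hm.im.const_mul (1 / 2)).congr (Eventually.of_forall fun p => ?_)
      simp
      ring
    have h7 := (((h8.mul hm.im).mul (hρ.mul hρ').re).const_mul (-4)).mono
      (by norm_num : _ ≤ (-2 : ℝ))
    refine (h6.add h7).congr (Eventually.of_forall fun p => ?_)
    have h9 : (pS a p - conj (pS a p)) = Complex.I * ((pS a p - conj (pS a p)).im : ℂ) := by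
      rw [pS_sub_conj]; simp
    rw [show 4 * pS a p * ((pS a p - conj (pS a p)) * rho M a p * rho' M a p)
      = 4 * pS a p * ((pS a p - conj (pS a p)) * (rho M a p * rho' M a p)) by ring]
    generalize (rho M a p * rho' M a p) = z
    rw [h9]
    generalize (pS a p - conj (pS a p)).im = t
    simp
    ring
  refine (((h1.re.add h2).sub h4).add h3.re).congr (Eventually.of_forall fun p => ?_)
  simp only [← Complex.ofReal_add, ← Complex.ofReal_sub, ← Complex.add_re, ← Complex.sub_re]
  congr 2
  simp only [bracket]
  ring

/-- If the imaginary part of `ϑΨ₀` decays faster by one order, then the real part of `𝕀_ζ` is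
smaller by one order than in general. -/
theorem re_Izeta_isBigO (hh : ∀ μ ν, IsSymbol 3 q fun p => h p μ ν)
    (him : IsSymbol 1 (q - 3) fun p => (varPsi0 κ M a h p).im) :
    (fun p => (Izeta κ M a h p).re) =O[atInfinity] fun p => rad p ^ (q + 1) := by
  have hϑS := isSymbol_varPsi0 κ M a hh
  have hϑ := hϑS.hasOrder
  have hϑi : HasOrder (q - 3) fun p => ((varPsi0 κ M a h p).im : ℂ) := him.ofReal.hasOrder
  have hp := hasOrder_pS a
  have hr : HasOrder 1 fun p => (rad p : ℂ) := (isSymbol_rad 0).ofReal.hasOrder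
  -- the algebraic term
  have hT2 : HasOrder (q + 1) fun p =>
      ((pS a p ^ 5 * varPsi0 κ M a h p * bracket M a p).re : ℂ) := by
    have h1 : HasOrder 4 fun p => pS a p ^ 5 - (rad p : ℂ) ^ 5 :=
      ((asy_pS (n := 0) a).pow 5).diff.hasOrder.mono (by norm_num)
    have h2 := (((hr.pow 5).mul (hϑ.re.mul (hasOrder_re_bracket M a))).mono
      (by push_cast; linarith : _ ≤ q + 1)).sub
      (((hr.pow 5).mul (hϑi.mul (hasOrder_bracket M a).im)).mono (by push_cast; linarith))
    have h3 := HasOrder.re_mul_congr h1 (hϑ.mul (hasOrder_bracket M a))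
      (((h2.congr (Eventually.of_forall fun p => ?_))).mono (by linarith))
    · refine (h3.mono (by linarith)).congr (Eventually.of_forall fun p => by rw [mul_assoc])
    · rw [← Complex.ofReal_pow, Complex.re_ofReal_mul, Complex.mul_re]
      push_cast
      ring
  -- the term with angular derivatives
  have hT1 : HasOrder (q + 1) fun p => ((termAngular κ M a h p).re : ℂ) := by
    set F : Pt → ℂ := fun y => pS a y ^ 4 * varPsi0 κ M a h y with hF
    set G : Pt → ℝ := fun y => rad y ^ 4 * (varPsi0 κ M a h y).re with hG
    have hGS : IsSymbol 1 (q + 2) G :=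
      (((isSymbol_rad 1).pow 4).mul hϑS.re).mono (by push_cast; linarith)
    have hFG : IsSymbol 1 (q + 1) fun y => F y - (G y : ℂ) := by
      have h1 : IsSymbol 1 3 fun y => pS a y ^ 4 - (rad y : ℂ) ^ 4 :=
        ((asy_pS (n := 1) a).pow 4).diff.mono (by norm_num)
      have h2 := ((((isSymbol_rad 1).pow 4).mul him).ofReal).const_mul Complex.I
      refine (((h1.mul hϑS).mono (by linarith)).add
        (h2.mono (by push_cast; linarith : _ ≤ q + 1))).congr (Eventually.of_forall fun y => ?_)
      simp only [hF, hG]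
      have hz := Complex.re_add_im (varPsi0 κ M a h y)
      push_cast
      linear_combination (rad y : ℂ) ^ 4 * hz
    have hd : ∀ v : VecField, ∀ᶠ p in atInfinity, dirD v F p
        = dirD v (fun y => (G y : ℂ)) p + dirD v (fun y => F y - (G y : ℂ)) p := by
      intro v
      filter_upwards [hGS.ofReal.differentiableAt, hFG.differentiableAt] with p h1 h2
      simp only [dirD, ← Finset.sum_add_distrib, ← mul_add]
      refine Finset.sum_congr rfl fun μ _ => ?_
      rw [← pd_add h1 h2]
      congr 2
      funext y
      ring
    have hE : ∀ {v : VecField}, (∀ i, HasOrder 0 fun p => v p i) → HasOrder q fun p =>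
        dirD v F p - dirD v (fun y => (G y : ℂ)) p := fun {v} hv => by
      refine ((hasOrder_dirD hv hFG).mono (by linarith)).congr ?_
      filter_upwards [hd v] with p hp
      rw [hp]; ring
    have hconj : ∀ p, dirD (mb a) (fun y => (G y : ℂ)) p
        = conj (dirD (mm a) (fun y => (G y : ℂ)) p) := by
      intro p
      simp only [dirD, map_sum, map_mul, ← pd_conj, Complex.conj_ofReal, mb]
    have hD := hasOrder_dirD (hasOrder_mm a) hGS.ofReal
    -- the leading part is `r³ (τ' + τ̄) m(G)` up to terms with vanishing real part
    have h1 : HasOrder (q - 2) fun p => ((tau' M a p * dirD (mm a) (fun y => (G y : ℂ)) p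
        + tau M a p * dirD (mb a) (fun y => (G y : ℂ)) p).re : ℂ) := by
      refine ((HasOrder.mul (tau'_add_conj_tau_isBigO M a) hD).re.mono (by linarith)).congr
        (Eventually.of_forall fun p => ?_)
      rw [hconj]
      congr 1
      simp
      ring
    have h2 := (((hasOrder_tau' M a).mul (hE (hasOrder_mm a))).add
      (HasOrder.mul (tau_isBigO M a) (hE (hasOrder_mb a)))).mono (by linarith : _ ≤ q - 2)
    have h3 : HasOrder (q - 2) fun p => ((tau' M a p * dirD (mm a) F p
        + tau M a p * dirD (mb a) F p).re : ℂ) := by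
      refine (h1.add h2.re).congr (Eventually.of_forall fun p => ?_)
      rw [← Complex.ofReal_add, ← Complex.add_re]
      congr 2
      ring
    have hFS := isSymbol_pS_pow_mul_varPsi0 κ M a hh
    have h4 := ((HasOrder.mul (hasOrder_tau' M a) (hasOrder_dirD (hasOrder_mm a) hFS)).add
      (HasOrder.mul (tau_isBigO M a) (hasOrder_dirD (hasOrder_mb a) hFS))).mono
      (by linarith : _ ≤ q - 1)
    have h5 : HasOrder 0 fun p => pS a p - (rad p : ℂ) :=
      (asy_pS (n := 0) a).diff.hasOrder.mono (by norm_num)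
    have h6 := HasOrder.re_mul_congr h5 ((hr.pow 2).mul h4)
      ((((hr.pow 3).mul h3).mono (by push_cast; linarith : _ ≤ 0 + (((2 : ℕ) : ℝ) * 1
        + (q - 1)))).congr (Eventually.of_forall fun p => by
          rw [← mul_assoc, ← pow_succ', ← Complex.ofReal_pow, Complex.re_ofReal_mul]
          push_cast; rfl))
    refine (h6.mono (by push_cast; linarith)).congr (Eventually.of_forall fun p => ?_)
    simp only [termAngular, pS_add_conj]
    congr 2
    ring
  have h1 := (((hasOrder_termRadial κ M a hh).re.sub hT1).add (hT2.const_mul (1 / 4))).sub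
    (hasOrder_termMetric M a hh).re
  refine (Complex.isBigO_ofReal_left).1 (h1.congr (Eventually.of_forall fun p => ?_))
  rw [Izeta_eq]
  simp only [Complex.sub_re, Complex.add_re]
  have h2 : ∀ t : ℝ, (2 * Complex.I * (t : ℂ)).re = 0 := fun t => by simp
  have h3 : ∀ t : ℝ, ((1 / 4 : ℂ) * (t : ℂ)).re = (1 / 4) * t := fun t => by simp
  rw [h2, h3]
  push_cast
  ring

end

section

/-! ### Stationary tensors on Minkowski space -/

/-- The parallel frame `e₀ = ∂_{t_*}`, `e_i = ∂_i - (∂_i r) ∂_{t_*}` of Minkowski space, which is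
the coordinate frame of the inertial coordinates `(t_* + r, x)`. -/
def par (p : Pt) (α μ : Fin 4) : ℝ := (if μ = α then 1 else 0) - if μ = 0 then dr p α else 0

/-- Components of a tensor in the parallel frame. -/
def hat {n : ℕ} (T : Tensor n) : Tensor n := fun p i =>
  ∑ k : Fin n → Fin 4, T p k * ∏ j, (par p (i j) (k j) : ℂ)

theorem isHomog_par (α μ : Fin 4) : IsHomog 0 fun p => par p α μ := by
  unfold par
  refine (IsHomog.const _).sub ?_
  split_ifs
  · exact isHomog_dr α
  · exact IsHomog.const 0

theorem IsHomog.congr {E : Type*} [NormedAddCommGroup E] [NormedSpace ℝ E] {d : ℤ} {f g : Pt → E}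
    (h : IsHomog d f) (hg : IsStationary g) (hfg : ∀ p, rad p ≠ 0 → f p = g p) : IsHomog d g where
  smooth p hp := (h.smooth p hp).congr_of_eventuallyEq (by
    filter_upwards [eventually_rad_ne hp] with q hq using (hfg q hq).symm)
  scale c hc p hp := by
    rw [← hfg p hp, ← hfg _ (by rw [rad_smul hc.le]; positivity), h.scale c hc p hp]
  stat := hg

theorem mink_stationary (p : Pt) (s : ℝ) : mink (p + Pi.single 0 s) = mink p := by
  ext μ ν; exact (isHomog_mink μ ν).stat p s

theorem isHomog_christoffel_mink (c b d : Fin 4) : IsHomog (-1) (christoffel mink c b d) := by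
  have h : IsHomog (-1) fun p => if c = 0 then pd b (pd d rad) p else 0 := by
    split_ifs
    · exact (isHomog_rad.pd d).pd b
    · exact ⟨fun _ _ => contDiffAt_const, fun _ _ _ _ => by simp, fun _ _ => rfl⟩
  refine h.congr (fun p s => ?_) fun p hp => (christoffel_mink hp c b d).symm
  have hp := fun a b d => ((isHomog_mink b d).stat.pd a) p s
  simp only [christoffel, hp, mink_stationary]

theorem IsHomog.ofReal {d : ℤ} {f : Pt → ℝ} (h : IsHomog d f) : IsHomog d fun p => (f p : ℂ) :=
  h.clm Complex.ofRealCLM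

theorem IsHomog.prod {ι : Type*} (s : Finset ι) {f : ι → Pt → ℂ} (h : ∀ i ∈ s, IsHomog 0 (f i)) :
    IsHomog 0 fun p => ∏ i ∈ s, f i p := by
  classical
  induction s using Finset.induction_on with
  | empty => simpa using IsHomog.const (1 : ℂ)
  | insert a s ha ih =>
    simp only [Finset.prod_insert ha]
    simpa using (h a (by simp)).mul (ih fun i hi => h i (by simp [hi]))

theorem isHomog_covD {n : ℕ} {d : ℤ} {T : Tensor n} (hT : ∀ k, IsHomog d fun p => T p k)
    (k : Fin (n + 1) → Fin 4) : IsHomog (d - 1) fun p => covD mink T p k := by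
  refine ((hT _).pd (k 0)).sub (IsHomog.sum _ fun j _ => IsHomog.sum _ fun c _ => ?_)
  have := (isHomog_christoffel_mink c (k 0) (Fin.tail k j)).ofReal.mul
    (hT (Function.update (Fin.tail k) j c))
  rwa [neg_add_eq_sub] at this

theorem isHomog_hat {n : ℕ} {d : ℤ} {T : Tensor n} (hT : ∀ k, IsHomog d fun p => T p k)
    (i : Fin n → Fin 4) : IsHomog d fun p => hat T p i := by
  refine IsHomog.sum _ fun k _ => ?_
  simpa using (hT k).mul (IsHomog.prod Finset.univ fun j _ => (isHomog_par (i j) (k j)).ofReal)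

theorem pd_pd_rad_zero {p : Pt} (hp : rad p ≠ 0) (b : Fin 4) : pd b (pd 0 rad) p = 0 := by
  rw [pd_comm ((contDiffAt_rad hp).of_le two_le_infty)]
  exact (isHomog_rad.stat.pd b).pd_zero p

/-- The parallel frame varies only through its component along `∂_{t_*}`. -/
theorem pd_par {p : Pt} (hp : rad p ≠ 0) (b α μ : Fin 4) :
    pd b (fun q => par q α μ) p = if μ = 0 then -pd b (pd α rad) p else 0 := by
  unfold par
  have hd : pd b (fun q => dr q α) p = pd b (pd α rad) p := by
    apply pd_congr
    filter_upwards [eventually_rad_ne hp] with q hq using (pd_rad hq α).symm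
  split_ifs <;> first
    | rw [pd_sub (differentiableAt_const _) ((isHomog_dr α).differentiableAt hp), pd_const, hd,
        zero_sub]
    | rw [pd_const]

/-- One slot of the contraction with the parallel frame: the connection term cancels the
derivative of the frame. -/
theorem sum_par_slot {n : ℕ} (T : (Fin n → Fin 4) → ℂ) (s : Fin 4 → Fin 4 → ℝ)
    (hs : ∀ b, s b 0 = 0) (p : Pt) (b : Fin 4) (i : Fin n → Fin 4) (j : Fin n) :
    ∑ k : Fin n → Fin 4, (s b (k j) : ℂ) * T (Function.update k j 0) * ∏ l, (par p (i l) (k l) : ℂ)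
      = ∑ k : Fin n → Fin 4, T k * ((∏ l ∈ Finset.univ.erase j, (par p (i l) (k l) : ℂ)) *
          ((if k j = 0 then s b (i j) else 0 : ℝ) : ℂ)) := by
  cases n with
  | zero => exact j.elim0
  | succ n =>
    rw [← (Fin.insertNthEquiv (fun _ => Fin 4) j).sum_comp,
      ← (Fin.insertNthEquiv (fun _ => Fin 4) j).sum_comp, Fintype.sum_prod_type_right,
      Fintype.sum_prod_type_right]
    refine Finset.sum_congr rfl fun k _ => ?_
    have herase : ∀ c : Fin 4, ∏ l ∈ Finset.univ.erase j,
        (par p (i l) ((Fin.insertNth j c k : Fin (n + 1) → Fin 4) l) : ℂ)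
        = ∏ l, (par p (i (j.succAbove l)) (k l) : ℂ) := by
      intro c
      rw [← Finset.compl_singleton, ← Fin.image_succAbove_univ,
        Finset.prod_image fun _ _ _ _ h => Fin.succAbove_right_injective h]
      simp
    have hsum : ∑ c, (s b c : ℂ) * (par p (i j) c : ℂ) = (s b (i j) : ℂ) := by
      simp only [par, ← Complex.ofReal_mul, ← Complex.ofReal_sum]
      congr 1
      simp only [mul_sub, Finset.sum_sub_distrib]
      simp [hs]
    have hequiv : ∀ c : Fin 4, (Fin.insertNthEquiv (fun _ => Fin 4) j) (c, k)
        = (Fin.insertNth j c k : Fin (n + 1) → Fin 4) := fun _ => rfl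
    have hupd : ∀ c : Fin 4, Function.update (Fin.insertNth j c k : Fin (n + 1) → Fin 4) j 0
        = Fin.insertNth j 0 k := by
      intro c
      ext1 l
      refine Fin.succAboveCases j ?_ (fun l => ?_) l <;> simp
    simp only [hequiv, hupd, herase, Fin.insertNth_apply_same, Fin.prod_univ_succAbove _ j,
      Fin.insertNth_apply_succAbove]
    simp only [Fin.sum_univ_four] at hsum ⊢
    simp
    linear_combination (T (j.insertNth 0 k) * ∏ l, (par p (i (j.succAbove l)) (k l) : ℂ)) * hsum

/-- In the parallel frame the covariant derivative of a stationary tensor is the partial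
derivative. -/
theorem hat_covD {n : ℕ} {d : ℤ} {T : Tensor n} (hT : ∀ k, IsHomog d fun p => T p k) {p : Pt}
    (hp : rad p ≠ 0) (i : Fin (n + 1) → Fin 4) :
    hat (covD mink T) p i = pd (i 0) (fun q => hat T q (Fin.tail i)) p := by
  set b := i 0 with hb
  set i' := Fin.tail i with hi'
  set s : Fin 4 → Fin 4 → ℝ := fun b c => pd b (pd c rad) p with hs
  have hs0 : ∀ b, s b 0 = 0 := fun b => pd_pd_rad_zero hp b
  have hs0' : ∀ c, s 0 c = 0 := fun c => (isHomog_rad.pd c).stat.pd_zero p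
  -- the components of `∇T`
  have hX : ∀ k₀ (k : Fin n → Fin 4), covD mink T p (Fin.cons k₀ k)
      = pd k₀ (fun q => T q k) p - ∑ j, (s k₀ (k j) : ℂ) * T p (Function.update k j 0) := by
    intro k₀ k
    simp only [covD, Fin.cons_zero, Fin.tail_cons, christoffel_mink hp]
    congr 1
    refine Finset.sum_congr rfl fun j _ => ?_
    rw [Finset.sum_eq_single 0 (fun c _ hc => by simp [hc]) (by simp)]
    simp [hs]
  have hpar : ∀ k : Fin n → Fin 4, ∀ j, DifferentiableAt ℝ (fun q => (par q (i' j) (k j) : ℂ)) p :=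
    fun k j => (isHomog_par (i' j) (k j)).ofReal.differentiableAt hp
  have hprod : ∀ k : Fin n → Fin 4, DifferentiableAt ℝ (fun q => ∏ j, (par q (i' j) (k j) : ℂ)) p :=
    fun k => (IsHomog.prod Finset.univ fun j _ =>
      (isHomog_par (i' j) (k j)).ofReal).differentiableAt hp
  have hpdprod : ∀ k : Fin n → Fin 4, pd b (fun q => ∏ j, (par q (i' j) (k j) : ℂ)) p
      = ∑ j, (∏ l ∈ Finset.univ.erase j, (par p (i' l) (k l) : ℂ)) *
          -((if k j = 0 then s b (i' j) else 0 : ℝ) : ℂ) := by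
    intro k
    unfold pd
    rw [fderiv_finsetProd fun j _ => hpar k j]
    simp only [sum_apply, smul_apply, smul_eq_mul]
    refine Finset.sum_congr rfl fun j _ => ?_
    congr 1
    have := pd_ofReal ((isHomog_par (i' j) (k j)).differentiableAt hp) b
    rw [pd_par hp] at this
    refine Eq.trans this ?_
    split_ifs <;> simp [hs]
  have hR : pd b (fun q => hat T q i') p
      = ∑ k : Fin n → Fin 4, (pd b (fun q => T q k) p * ∏ j, (par p (i' j) (k j) : ℂ)
        - ∑ j, T p k * ((∏ l ∈ Finset.univ.erase j, (par p (i' l) (k l) : ℂ)) *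
          ((if k j = 0 then s b (i' j) else 0 : ℝ) : ℂ))) := by
    unfold hat
    rw [pd_sum _ fun k _ => ((hT k).differentiableAt hp).fun_mul (hprod k)]
    refine Finset.sum_congr rfl fun k _ => ?_
    rw [pd_mul ((hT k).differentiableAt hp) (hprod k), hpdprod, Finset.mul_sum, add_comm,
      sub_eq_add_neg, ← Finset.sum_neg_distrib, mul_comm (∏ j, _)]
    congr 1
    exact Finset.sum_congr rfl fun j _ => by ring
  have hL : hat (covD mink T) p i = ∑ k : Fin n → Fin 4,
      covD mink T p (Fin.cons b k) * ∏ j, (par p (i' j) (k j) : ℂ) := by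
    unfold hat
    rw [sum_fin_cons, Finset.sum_comm]
    refine Finset.sum_congr rfl fun k _ => ?_
    simp only [Fin.prod_univ_succ, Fin.cons_zero, Fin.cons_succ]
    -- the derivative along `∂_{t_*}` vanishes, so only the slot `k₀ = i 0` contributes
    have h0 : covD mink T p (Fin.cons 0 k) = 0 := by
      rw [hX, (hT k).stat.pd_zero]
      simp [hs0']
    have h1 : ∀ k₀, covD mink T p (Fin.cons k₀ k) *
          ((par p (i 0) k₀ : ℂ) * ∏ j, (par p (i j.succ) (k j) : ℂ))
        = if k₀ = b then covD mink T p (Fin.cons b k) * ∏ j, (par p (i' j) (k j) : ℂ) else 0 := by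
      intro k₀
      by_cases hk : k₀ = 0
      · subst hk
        rw [h0]
        split_ifs with h
        · rw [← h, h0]; simp
        · simp
      · have hpk : par p (i 0) k₀ = if k₀ = b then 1 else 0 := by simp [par, hk, hb]
        rw [hpk]
        split_ifs with h
        · rw [h]; simp [hi', Fin.tail]
        · simp
    simp [h1]
  rw [hL, hR]
  simp only [hX, sub_mul, Finset.sum_sub_distrib, Finset.sum_mul]
  congr 1
  rw [Finset.sum_comm, Finset.sum_comm (f := fun k j => T p k * _)]
  exact Finset.sum_congr rfl fun j _ => sum_par_slot (fun k => T p k) s hs0 p b i' j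

/-- The components of `∇∇T` in the parallel frame. -/
theorem hat_covD_covD {n : ℕ} {d : ℤ} {T : Tensor n} (hT : ∀ k, IsHomog d fun p => T p k) {p : Pt}
    (hp : rad p ≠ 0) (i : Fin (n + 2) → Fin 4) : hat (covD mink (covD mink T)) p i
      = pd (i 0) (pd (i 1) (fun q => hat T q (Fin.tail (Fin.tail i)))) p := by
  rw [hat_covD (isHomog_covD hT) hp]
  apply pd_congr
  filter_upwards [eventually_rad_ne hp] with q hq
  rw [hat_covD hT hq]
  rfl

/-- Components in the parallel frame of a vector. -/
def vhat (v : VecField) : VecField := fun p μ =>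
  v p μ + if μ = 0 then ∑ α, v p α * (dr p α : ℂ) else 0

/-- A vector is the combination of the parallel frame with the components `vhat`. -/
theorem sum_vhat_par (v : VecField) (p : Pt) (μ : Fin 4) :
    ∑ α, vhat v p α * (par p α μ : ℂ) = v p μ := by
  fin_cases μ <;> simp [Fin.sum_univ_four, vhat, par, dr_zero]
  ring

theorem contr_eq_contr_hat {n : ℕ} (T : Tensor n) (v : Fin n → VecField) (p : Pt) :
    contr T v p = contr (hat T) (fun j => vhat (v j)) p := by
  unfold contr hat
  simp only [Finset.sum_mul]
  rw [Finset.sum_comm]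
  refine Finset.sum_congr rfl fun k _ => ?_
  simp only [← sum_vhat_par (v _) p]
  rw [Finset.prod_univ_sum, Finset.mul_sum, Fintype.piFinset_univ]
  refine Finset.sum_congr rfl fun i _ => ?_
  rw [Finset.prod_mul_distrib]
  ring

end

section

/-! ### The imaginary part of the middle Weyl scalar on Minkowski space -/

/-- The spinor contraction may be evaluated with components in the parallel frame. -/
theorem spinContr_hat (K : Tensor 4) (f : Fin 2 → Fin 2 → VecField) (A : Fin 4 → Fin 2) (p : Pt) :
    spinContr K f A p = spinContr (hat K) (fun i j => vhat (f i j)) A p := by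
  unfold spinContr
  simp only [contr_eq_contr_hat K]
  refine Finset.sum_congr rfl fun a₁ _ => Finset.sum_congr rfl fun b₁ _ =>
    Finset.sum_congr rfl fun a₂ _ => Finset.sum_congr rfl fun b₂ _ => ?_
  congr 2
  funext j
  fin_cases j <;> rfl

/-- The four terms in which the two antisymmetric spinor forms do not vanish. -/
theorem spinContr_eq (K : Tensor 4) (f : Fin 2 → Fin 2 → VecField) (A : Fin 4 → Fin 2) (p : Pt) :
    spinContr K f A p = contr K ![f (A 0) 0, f (A 1) 0, f (A 2) 1, f (A 3) 1] p
      - contr K ![f (A 0) 0, f (A 1) 1, f (A 2) 1, f (A 3) 0] p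
      - contr K ![f (A 0) 1, f (A 1) 0, f (A 2) 0, f (A 3) 1] p
      + contr K ![f (A 0) 1, f (A 1) 1, f (A 2) 0, f (A 3) 0] p := by
  simp [spinContr, spinEps]
  ring

theorem contr_swap_left {K : Tensor 4} {p : Pt}
    (h : ∀ i j k l, K p ![i, j, k, l] = K p ![j, i, k, l])
    (u v w z : VecField) : contr K ![u, v, w, z] p = contr K ![v, u, w, z] p := by
  rw [contr_four, contr_four, Finset.sum_comm]
  refine Finset.sum_congr rfl fun i _ => Finset.sum_congr rfl fun j _ =>
    Finset.sum_congr rfl fun k _ => Finset.sum_congr rfl fun l _ => ?_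
  rw [h]; ring

theorem contr_swap_right {K : Tensor 4} {p : Pt}
    (h : ∀ i j k l, K p ![i, j, k, l] = K p ![i, j, l, k])
    (u v w z : VecField) : contr K ![u, v, w, z] p = contr K ![u, v, z, w] p := by
  rw [contr_four, contr_four]
  refine Finset.sum_congr rfl fun i _ => Finset.sum_congr rfl fun j _ => ?_
  rw [Finset.sum_comm]
  refine Finset.sum_congr rfl fun k _ => Finset.sum_congr rfl fun l _ => ?_
  rw [h]; ring

theorem contr_conj {n : ℕ} {K : Tensor n} (h : IsRealTensor K) (v : Fin n → VecField) (p : Pt) :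
    conj (contr K v p) = contr K (fun j p μ => conj (v j p μ)) p := by
  simp only [contr, map_sum, map_mul, map_prod, h p]

/-- Each of the six arrangements of `o, o, ι, ι` arises from four permutations. -/
theorem sum_perm_eq (F : (Fin 4 → Fin 2) → ℂ) :
    ∑ s : Equiv.Perm (Fin 4), F (![0, 0, 1, 1] ∘ s) = 4 * (F ![0, 0, 1, 1] + F ![0, 1, 0, 1]
      + F ![0, 1, 1, 0] + F ![1, 0, 0, 1] + F ![1, 0, 1, 0] + F ![1, 1, 0, 0]) := by
  rw [Finset.sum_comp F fun s : Equiv.Perm (Fin 4) => (![0, 0, 1, 1] : Fin 4 → Fin 2) ∘ s]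
  have h : (Finset.univ.image fun s : Equiv.Perm (Fin 4) => (![0, 0, 1, 1] : Fin 4 → Fin 2) ∘ s)
      = {![0, 0, 1, 1], ![0, 1, 0, 1], ![0, 1, 1, 0], ![1, 0, 0, 1], ![1, 0, 1, 0],
        ![1, 1, 0, 0]} := by decide +kernel
  have hc : ∀ b ∈ (Finset.univ.image fun s : Equiv.Perm (Fin 4) =>
      (![0, 0, 1, 1] : Fin 4 → Fin 2) ∘ s), (Finset.univ.filter fun s : Equiv.Perm (Fin 4) =>
      (![0, 0, 1, 1] : Fin 4 → Fin 2) ∘ s = b).card = 4 := by decide +kernel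
  rw [Finset.sum_congr rfl fun b hb => by rw [hc b hb], h]
  repeat rw [Finset.sum_insert (by decide)]
  rw [Finset.sum_singleton]
  simp only [nsmul_eq_mul]
  push_cast
  ring

/-- In the symmetrization of `∇∇h` over the spinor indices `oo ι ι`, only the components of `∇∇h`
along `ℓ m̄ n m` and `n m ℓ m̄` contribute to the imaginary part. -/
theorem im_sum_spinContr {K : Tensor 4} {p : Pt} (hK : IsRealTensor K)
    (h₁ : ∀ i j k l, K p ![i, j, k, l] = K p ![j, i, k, l])
    (h₂ : ∀ i j k l, K p ![i, j, k, l] = K p ![i, j, l, k]) {f : Fin 2 → Fin 2 → VecField}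
    (hf : ∀ i j p μ, conj (f i j p μ) = f j i p μ) :
    (∑ s : Equiv.Perm (Fin 4), spinContr K f (![0, 0, 1, 1] ∘ s) p).im
      = 24 * (contr K ![f 0 0, f 1 0, f 1 1, f 0 1] p
        + contr K ![f 1 1, f 0 1, f 0 0, f 1 0] p).im := by
  rw [sum_perm_eq fun A => spinContr K f A p]
  set Q : Fin 2 → Fin 2 → Fin 2 → Fin 2 → Fin 2 → Fin 2 → Fin 2 → Fin 2 → ℂ :=
    fun a b c d i j k l => contr K ![f a i, f b j, f c k, f d l] p with hQ
  have hconj : ∀ a b c d i j k l, (Q a b c d i j k l).im = -(Q i j k l a b c d).im := by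
    intro a b c d i j k l
    have : Q i j k l a b c d = conj (Q a b c d i j k l) := by
      simp only [hQ]
      rw [contr_conj hK]
      congr 1
      funext s
      fin_cases s <;> · funext q μ; exact (hf _ _ q μ).symm
    rw [this, Complex.conj_im, neg_neg]
  have hl : ∀ a b c d i j k l, Q a b c d i j k l = Q b a c d j i k l :=
    fun _ _ _ _ _ _ _ _ => contr_swap_left h₁ _ _ _ _
  have hr : ∀ a b c d i j k l, Q a b c d i j k l = Q a b d c i j l k :=
    fun _ _ _ _ _ _ _ _ => contr_swap_right h₂ _ _ _ _
  have hS : ∀ A : Fin 4 → Fin 2, spinContr K f A p = Q (A 0) (A 1) (A 2) (A 3) 0 0 1 1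
      - Q (A 0) (A 1) (A 2) (A 3) 0 1 1 0 - Q (A 0) (A 1) (A 2) (A 3) 1 0 0 1
      + Q (A 0) (A 1) (A 2) (A 3) 1 1 0 0 := fun A => spinContr_eq K f A p
  have hgoal : contr K ![f 0 0, f 1 0, f 1 1, f 0 1] p + contr K ![f 1 1, f 0 1, f 0 0, f 1 0] p
      = Q 0 1 1 0 0 0 1 1 + Q 1 0 0 1 1 1 0 0 := rfl
  rw [hgoal]
  simp only [hS, Matrix.cons_val, Complex.add_im, Complex.sub_im, Complex.mul_im,
    show (4 : ℂ).re = 4 from rfl, show (4 : ℂ).im = 0 from rfl, zero_mul, add_zero]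
  have hc₁ := hconj 0 0 1 1 0 1 1 0
  have hc₂ := hconj 1 1 0 0 1 0 0 1
  have hm := hconj 0 0 1 1 1 1 0 0
  have hr₁ := hconj 0 0 1 1 0 0 1 1
  have hr₂ := hconj 0 1 0 1 0 1 0 1
  have hr₃ : (Q 0 1 0 1 0 1 1 0).im = 0 := by
    have := hconj 0 1 0 1 0 1 1 0
    rw [hr 0 1 1 0 0 1 0 1] at this
    linarith
  have hr₄ : (Q 0 1 0 1 1 0 0 1).im = 0 := by
    have := hconj 0 1 0 1 1 0 0 1
    rw [hl 1 0 0 1 0 1 0 1] at this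
    linarith
  have hr₅ : (Q 0 1 1 0 1 0 0 1).im = 0 := by
    have := hconj 0 1 1 0 1 0 0 1
    rw [hl 1 0 0 1 0 1 1 0, hr 0 1 0 1 1 0 1 0] at this
    linarith
  have hr₆ := hconj 0 1 1 0 0 1 1 0
  have hr₇ := hconj 1 1 0 0 1 1 0 0
  rw [hl 0 0 1 1 1 0 0 1, hr 0 0 1 1 0 1 0 1, hr 0 1 0 1 0 0 1 1, hl 0 1 0 1 1 1 0 0,
    hl 0 1 1 0 1 1 0 0, hr 1 0 1 0 1 1 0 0, hl 1 0 0 1 0 0 1 1, hr 0 1 0 1 0 0 1 1,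
    hl 1 0 1 0 0 0 1 1, hl 1 1 0 0 0 1 1 0, hr 1 1 0 0 1 0 1 0,
    hl 1 0 0 1 0 1 1 0, hr 0 1 0 1 1 0 1 0, hl 1 0 0 1 1 0 0 1, hr 0 1 0 1 0 1 0 1,
    hl 1 0 1 0 0 1 1 0, hr 0 1 1 0 1 0 1 0, hl 1 0 1 0 1 0 0 1, hr 0 1 1 0 0 1 0 1]
  linarith

/-- The mixed components of `h` in the parallel frame. -/
def timeSpace (h : Bilin) (l : Fin 4) : Pt → ℝ := fun q => h q 0 l - dr q l * h q 0 0

theorem hat_two (T : Tensor 2) (p : Pt) (k l : Fin 4) : hat T p ![k, l]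
    = ∑ i, ∑ j, T p ![i, j] * ((par p k i : ℂ) * (par p l j : ℂ)) := by
  have := contr_two T (fun p μ => (par p k μ : ℂ)) (fun p μ => (par p l μ : ℂ)) p
  rw [← this]
  unfold hat contr
  refine Finset.sum_congr rfl fun i _ => ?_
  simp [Fin.prod_univ_two]

theorem hat_four (T : Tensor 4) (p : Pt) (i j k l : Fin 4) : hat T p ![i, j, k, l]
    = ∑ a, ∑ b, ∑ c, ∑ d, T p ![a, b, c, d] *
      ((par p i a : ℂ) * (par p j b : ℂ) * (par p k c : ℂ) * (par p l d : ℂ)) := by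
  have := contr_four T (fun p μ => (par p i μ : ℂ)) (fun p μ => (par p j μ : ℂ))
    (fun p μ => (par p k μ : ℂ)) (fun p μ => (par p l μ : ℂ)) p
  rw [← this]
  unfold hat contr
  refine Finset.sum_congr rfl fun i _ => ?_
  simp [Fin.prod_univ_four]

theorem hat_zero_left (B : Bilin) (p : Pt) (l : Fin 4) :
    hat (toTensor B) p ![0, l] = (timeSpace B l p : ℂ) := by
  rw [hat_two]
  simp only [par, dr_zero, toTensor, timeSpace]
  fin_cases l <;> simp [Fin.sum_univ_four, dr_zero] <;> ring

/-- The trace does not contribute to the mixed components, since the parallel frame is orthonormal.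
-/
theorem timeSpace_traceFree (h : Bilin) {l : Fin 4} (hl : l ≠ 0) :
    timeSpace (traceFree mink h) l = timeSpace h l := by
  funext q
  have h0 : mink q 0 l - dr q l * mink q 0 0 = 0 := by
    rw [mink_eq]
    fin_cases l <;> simp at hl ⊢
  simp only [timeSpace, traceFree, Matrix.sub_apply, Matrix.smul_apply, smul_eq_mul]
  linear_combination (-(tr mink h q / 4)) * h0

theorem IsRealTensor.hat {n : ℕ} {T : Tensor n} (h : IsRealTensor T) :
    IsRealTensor (hat T) := by
  intro p i
  simp only [KerrDecay.hat, map_sum, map_mul, map_prod, h p, Complex.conj_ofReal]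

theorem isRealTensor_hess (g h : Bilin) : IsRealTensor (hess g h) :=
  IsRealTensor.covD g (IsRealTensor.covD g fun p i => by simp [toTensor])

theorem vhat_ell₀ {p : Pt} (hp : rad p ≠ 0) (μ : Fin 4) :
    vhat ell₀ p μ = ((vt p μ + dr p μ : ℝ) : ℂ) := by
  have h := dr_sq hp
  have h' : ((dr p 1 : ℂ)) ^ 2 + (dr p 2 : ℂ) ^ 2 + (dr p 3 : ℂ) ^ 2 = 1 := by exact_mod_cast h
  fin_cases μ <;> simp [vhat, ell₀, vt, Fin.sum_univ_four, dr_zero]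
  linear_combination h'

theorem vhat_nn₀ {p : Pt} (hp : rad p ≠ 0) (μ : Fin 4) :
    vhat nn₀ p μ = (((1 / 2) * (vt p μ - dr p μ) : ℝ) : ℂ) := by
  have h := dr_sq hp
  have h' : ((dr p 1 : ℂ)) ^ 2 + (dr p 2 : ℂ) ^ 2 + (dr p 3 : ℂ) ^ 2 = 1 := by exact_mod_cast h
  fin_cases μ <;> simp [vhat, nn₀, vt, Fin.sum_univ_four, dr_zero]
  linear_combination (-1 / 2) * h'

theorem vhat_mm₀ {p : Pt} (hp : rad p ≠ 0) (hc : cyl p ≠ 0) (μ : Fin 4) :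
    vhat mm₀ p μ = mm₀ p μ := by
  have h1 := cyl_sq p
  have h2 : p 3 * p 1 / cyl p * p 1 + p 3 * p 2 / cyl p * p 2 - cyl p * p 3 = 0 := by
    field_simp
    rw [h1]; ring
  have h2' : (p 3 * p 1 / cyl p * p 1 + p 3 * p 2 / cyl p * p 2 - cyl p * p 3 : ℂ) = 0 := by
    exact_mod_cast h2
  have h3 := sqrt_two_ne
  have hr : (rad p : ℂ) ≠ 0 := by exact_mod_cast hp
  have hcc : (cyl p : ℂ) ≠ 0 := by exact_mod_cast hc
  have hs : ∑ α, mm₀ p α * (dr p α : ℂ) = 0 := by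
    simp only [Fin.sum_univ_four, mm₀, vθ, vφ, dr, Matrix.cons_val]
    push_cast
    linear_combination (1 / ((rad p : ℂ) ^ 2 * (√2 : ℝ))) * h2'
  simp [vhat, hs]

theorem conj_vhat_frame₀ (i j : Fin 2) (p : Pt) (μ : Fin 4) :
    conj (vhat (frame₀ i j) p μ) = vhat (frame₀ j i) p μ := by
  have h : ∀ μ, conj (frame₀ i j p μ) = frame₀ j i p μ := by
    intro μ
    fin_cases i <;> fin_cases j <;> simp [frame₀, ell₀, nn₀, Complex.conj_ofNat]
  simp only [vhat, map_add, h]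
  split_ifs <;> simp [h]

end

section

variable {h : Bilin}

theorem isHomog_mink_inv (c d : Fin 4) : IsHomog 0 fun p => (mink p)⁻¹ c d := by
  have h0 : IsHomog 0 fun p => minkInv p c d := by
    have h := isHomog_dr
    fin_cases c <;> fin_cases d <;> first
      | exact IsHomog.const (0 : ℝ)
      | exact IsHomog.const (-1 : ℝ)
      | exact h 1
      | exact h 2
      | exact h 3
  exact h0.congr (fun p s => by rw [mink_stationary]) fun p hp => by rw [mink_inv hp]

theorem isHomog_traceFree (hh : ∀ μ ν, IsHomog (-1) fun p => h p μ ν) (μ ν : Fin 4) :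
    IsHomog (-1) fun p => traceFree mink h p μ ν := by
  have htr : IsHomog (-1) (tr mink h) := by
    refine IsHomog.sum _ fun a _ => IsHomog.sum _ fun b _ => ?_
    simpa using (isHomog_mink_inv a b).mul (hh a b)
  have := (htr.const_mul (1 / 4)).mul (isHomog_mink μ ν)
  refine ((hh μ ν).sub (by simpa using this)).congr (fun p s => ?_) fun p hp => ?_
  · have h1 : h (p + Pi.single 0 s) = h p := by ext a b; exact (hh a b).stat p s
    simp only [traceFree, htr.stat p s, mink_stationary, h1]
  · simp only [traceFree, Matrix.sub_apply, Matrix.smul_apply, smul_eq_mul]; ring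

theorem isHomog_timeSpace (hh : ∀ μ ν, IsHomog (-1) fun p => h p μ ν) (l : Fin 4) :
    IsHomog (-1) (timeSpace h l) :=
  (hh 0 l).sub (by simpa using (isHomog_dr l).mul (hh 0 0))

/-- The components of `∇∇h` in the parallel frame are second partial derivatives. -/
theorem hat_hess (hh : ∀ μ ν, IsHomog (-1) fun p => h p μ ν) {p : Pt} (hp : rad p ≠ 0)
    (i j k l : Fin 4) : hat (hess mink h) p ![i, j, k, l]
      = pd i (pd j fun q => hat (toTensor (traceFree mink h)) q ![k, l]) p :=
  hat_covD_covD (fun k => (isHomog_traceFree hh (k 0) (k 1)).ofReal) hp _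

/-- A vector whose spatial part is radial contracts, by Euler's identity, to a multiple of the
tensor. -/
theorem sum_radial_hat_hess (hh : ∀ μ ν, IsHomog (-1) fun p => h p μ ν) {p : Pt} (hp : rad p ≠ 0)
    {X : Fin 4 → ℂ} {c : ℝ} (hX : ∀ i ≠ 0, X i = ((c * dr p i : ℝ) : ℂ)) (j k l : Fin 4) :
    ∑ i, hat (hess mink h) p ![i, j, k, l] * X i
      = -2 * c / rad p * pd j (fun q => hat (toTensor (traceFree mink h)) q ![k, l]) p := by
  have ht : IsHomog (-1) fun q => hat (toTensor (traceFree mink h)) q ![k, l] :=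
    isHomog_hat (fun k => (isHomog_traceFree hh (k 0) (k 1)).ofReal) _
  have he := (ht.pd j).euler hp
  have h0 := (ht.pd j).stat.pd_zero p
  have hr : (rad p : ℂ) ≠ 0 := by exact_mod_cast hp
  simp only [hat_hess hh hp, Fin.sum_univ_four, hX 1 (by decide), hX 2 (by decide),
    hX 3 (by decide), h0, dr, Matrix.cons_val]
  simp only [Complex.real_smul] at he
  push_cast at he ⊢
  field_simp
  linear_combination (c : ℂ) * he

/-- For a static field that is homogeneous of degree `-1`, the imaginary part of the middle
linearized Weyl scalar on Minkowski space is a multiple of the radial component of the curl of the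
mixed components. -/
theorem im_flat_varPsi (hh : ∀ μ ν, IsHomog (-1) fun p => h p μ ν) (hs : ∀ p, (h p).IsSymm)
    {p : Pt} (hp : rad p ≠ 0) (hc : cyl p ≠ 0) :
    (∑ s : Equiv.Perm (Fin 4), spinContr (hess mink h) frame₀ (![0, 0, 1, 1] ∘ s) p).im
      = -24 / rad p * ∑ j, ∑ l, area p j l * pd j (timeSpace h l) p := by
  set T : Fin 4 → Fin 4 → Pt → ℂ := fun k l q => hat (toTensor (traceFree mink h)) q ![k, l]
    with hT
  have htH : ∀ k l, IsHomog (-1) (T k l) := fun k l =>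
    isHomog_hat (fun k => (isHomog_traceFree hh (k 0) (k 1)).ofReal) _
  have hTsymm : ∀ k l, T k l = T l k := by
    intro k l
    funext q
    have h1 : ∀ i j, traceFree mink h q i j = traceFree mink h q j i := by
      intro i j
      have : h q i j = h q j i := (hs q).apply j i
      simp only [traceFree, Matrix.sub_apply, Matrix.smul_apply, mink_symm q i j, this]
    simp only [hT, hat_two, toTensor, Matrix.cons_val]
    rw [Finset.sum_comm]
    refine Finset.sum_congr rfl fun i _ => Finset.sum_congr rfl fun j _ => ?_
    rw [h1]; ring
  have hK : ∀ i j k l, hat (hess mink h) p ![i, j, k, l] = pd i (pd j (T k l)) p :=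
    fun i j k l => hat_hess hh hp i j k l
  simp only [spinContr_hat (hess mink h)]
  rw [im_sum_spinContr (isRealTensor_hess _ _).hat (fun i j k l => ?_) (fun i j k l => ?_)
    fun i j p μ => conj_vhat_frame₀ i j p μ]
  rotate_left
  · rw [hK, hK, pd_comm (((htH k l).smooth p hp).of_le two_le_infty)]
  · rw [hK, hK, hTsymm]
  -- the first index is contracted with a radial vector
  have hc1 : ∀ (u v w z : VecField) (c : ℝ), (∀ i ≠ 0, u p i = ((c * dr p i : ℝ) : ℂ)) →
      contr (hat (hess mink h)) ![u, v, w, z] p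
        = -2 * c / rad p * ∑ j, ∑ k, ∑ l, pd j (T k l) p * (v p j * w p k * z p l) := by
    intro u v w z c hu
    have e : ∀ i j k l, hat (hess mink h) p ![i, j, k, l] * (u p i * v p j * w p k * z p l)
        = hat (hess mink h) p ![i, j, k, l] * u p i * (v p j * w p k * z p l) := by
      intro i j k l; ring
    rw [contr_four]
    simp only [e]
    rw [Finset.sum_comm, Finset.mul_sum]
    refine Finset.sum_congr rfl fun j _ => ?_
    rw [Finset.sum_comm, Finset.mul_sum]
    refine Finset.sum_congr rfl fun k _ => ?_
    rw [Finset.sum_comm, Finset.mul_sum]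
    refine Finset.sum_congr rfl fun l _ => ?_
    rw [← Finset.sum_mul, sum_radial_hat_hess hh hp hu]
    ring
  have hF : ∀ i j, (fun i j => vhat (frame₀ i j)) i j = vhat (frame₀ i j) := fun _ _ => rfl
  rw [hc1 _ _ _ _ 1 (fun i hi => ?_), hc1 _ _ _ _ (-1 / 2) (fun i hi => ?_)]
  rotate_left
  · change vhat nn₀ p i = _
    rw [vhat_nn₀ hp]
    fin_cases i <;> simp [vt] at hi ⊢ <;> ring
  · change vhat ell₀ p i = _
    rw [vhat_ell₀ hp]
    fin_cases i <;> simp [vt] at hi ⊢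
  have hm : ∀ μ, vhat (frame₀ 0 1) p μ = mm₀ p μ := vhat_mm₀ hp hc
  have hmb : ∀ μ, vhat (frame₀ 1 0) p μ = conj (mm₀ p μ) := fun μ => by
    rw [← hm, conj_vhat_frame₀]
  have hL : ∀ μ, vhat (frame₀ 0 0) p μ = _ := vhat_ell₀ hp
  have hN : ∀ μ, vhat (frame₀ 1 1) p μ = _ := vhat_nn₀ hp
  -- the derivatives are real
  have hreal : ∀ j k l, pd j (T k l) p = ((pd j (T k l) p).re : ℂ) := by
    intro j k l
    refine (Complex.conj_eq_iff_re.mp ?_).symm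
    rw [← pd_conj]
    congr 1
    funext q
    exact IsRealTensor.hat (fun p i => by simp [toTensor]) q _
  have hterm : ∀ j k l, (-2 * ((1 : ℝ) : ℂ) / rad p * (pd j (T k l) p *
        (vhat (frame₀ 1 0) p j * vhat (frame₀ 1 1) p k * vhat (frame₀ 0 1) p l))
      + -2 * ((-1 / 2 : ℝ) : ℂ) / rad p * (pd j (T k l) p *
        (vhat (frame₀ 0 1) p j * vhat (frame₀ 0 0) p k * vhat (frame₀ 1 0) p l))).im
      = -1 / rad p * ((pd j (T k l) p).re * vt p k * area p j l) := by
    intro j k l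
    have e1 := mm₀_mul_conj hp hc l j
    have e2 := mm₀_mul_conj hp hc j l
    have hanti : area p l j = -area p j l := by
      fin_cases j <;> fin_cases l <;> simp [area]
    have hsym : spatial l j = spatial j l := by
      rw [spatial, ← Matrix.diagonal_transpose, Matrix.transpose_apply, Matrix.diagonal_transpose]
    rw [hreal]
    simp only [hm, hmb, hL, hN]
    set d := (pd j (T k l) p).re
    have : (-2 * ((1 : ℝ) : ℂ) / rad p * ((d : ℂ) * (conj (mm₀ p j) *
          (((1 / 2) * (vt p k - dr p k) : ℝ) : ℂ) * mm₀ p l))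
        + -2 * ((-1 / 2 : ℝ) : ℂ) / rad p * ((d : ℂ) * (mm₀ p j * ((vt p k + dr p k : ℝ) : ℂ)
          * conj (mm₀ p l))))
        = ((1 / rad p * d * (spatial j l - dr p j * dr p l) * dr p k : ℝ) : ℂ)
          + ((-1 / rad p * (d * vt p k * area p j l) : ℝ) : ℂ) * Complex.I := by
      rw [hanti, hsym] at e1
      push_cast at e1 e2 ⊢
      linear_combination (-(1 : ℂ) / rad p * d * (vt p k - dr p k)) * e1
        + ((1 : ℂ) / rad p * d * (vt p k + dr p k)) * e2
    rw [this]
    simp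
  rw [Finset.mul_sum, Finset.mul_sum, ← Finset.sum_add_distrib, Complex.im_sum]
  rw [show (-24 / rad p * ∑ j, ∑ l, area p j l * pd j (timeSpace h l) p)
    = 24 * ∑ j, (-1 / rad p) * ∑ l, area p j l * pd j (timeSpace h l) p by
      rw [← Finset.mul_sum]; ring]
  congr 1
  refine Finset.sum_congr rfl fun j _ => ?_
  rw [Finset.mul_sum, Finset.mul_sum, ← Finset.sum_add_distrib, Complex.im_sum]
  have h5 : ∀ k, ((-2 * ((1 : ℝ) : ℂ) / rad p * ∑ l, pd j (T k l) p *
        (vhat (frame₀ 1 0) p j * vhat (frame₀ 1 1) p k * vhat (frame₀ 0 1) p l))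
      + -2 * ((-1 / 2 : ℝ) : ℂ) / rad p * ∑ l, pd j (T k l) p *
        (vhat (frame₀ 0 1) p j * vhat (frame₀ 0 0) p k * vhat (frame₀ 1 0) p l)).im
      = ∑ l, -1 / rad p * ((pd j (T k l) p).re * vt p k * area p j l) := by
    intro k
    rw [Finset.mul_sum, Finset.mul_sum, ← Finset.sum_add_distrib, Complex.im_sum]
    exact Finset.sum_congr rfl fun l _ => hterm j k l
  refine (Finset.sum_congr rfl fun k _ => h5 k).trans ?_
  rw [Finset.sum_eq_single 0 (fun k _ hk => by
    fin_cases k <;> simp [vt] at hk ⊢) (by simp), Finset.mul_sum]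
  refine Finset.sum_congr rfl fun l _ => ?_
  by_cases hl : l = 0
  · subst hl
    have : area p j 0 = 0 := by fin_cases j <;> rfl
    simp [this]
  · have h6 : pd j (T 0 l) p = ((pd j (timeSpace h l) p : ℝ) : ℂ) := by
      rw [← pd_ofReal ((isHomog_timeSpace hh l).differentiableAt hp), ← timeSpace_traceFree h hl]
      congr 1
      funext q
      exact hat_zero_left _ q l
    rw [h6]
    simp only [vt, Matrix.cons_val, Complex.ofReal_re]
    ring

end

section

/-! ### The mixed components of the linearized Ricci tensor of Minkowski space -/

/-- The signs of the Minkowski metric in the parallel frame. -/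
def sgn : Fin 4 → ℝ := ![1, -1, -1, -1]

/-- The parallel frame is orthonormal. -/
theorem mink_inv_eq_sum_par {p : Pt} (hp : rad p ≠ 0) (c d : Fin 4) :
    (mink p)⁻¹ c d = ∑ γ, sgn γ * (par p γ c * par p γ d) := by
  have h := dr_sq hp
  rw [mink_inv hp]
  fin_cases c <;> fin_cases d <;>
    simp [minkInv, Fin.sum_univ_four, par, sgn, dr_zero]
  linear_combination h

theorem sum_metric_contraction (η P Q : Fin 4 → ℂ) (E : Fin 4 → Fin 4 → ℂ)
    (F : Fin 4 → Fin 4 → Fin 4 → Fin 4 → ℂ) :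
    ∑ a, ∑ b, P a * Q b * ∑ c, ∑ d, (∑ γ, η γ * (E γ c * E γ d)) * F a b c d
      = ∑ γ, η γ * ∑ a, ∑ b, ∑ c, ∑ d, F a b c d * (P a * Q b * (E γ c * E γ d)) := by
  simp only [Finset.mul_sum, Finset.sum_mul]
  have h : ∀ G : Fin 4 → Fin 4 → Fin 4 → Fin 4 → Fin 4 → ℂ,
      ∑ a, ∑ b, ∑ c, ∑ d, ∑ γ, G a b c d γ = ∑ γ, ∑ a, ∑ b, ∑ c, ∑ d, G a b c d γ := by
    intro G
    calc _ = ∑ a, ∑ b, ∑ c, ∑ γ, ∑ d, G a b c d γ :=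
          Finset.sum_congr rfl fun a _ => Finset.sum_congr rfl fun b _ =>
            Finset.sum_congr rfl fun c _ => Finset.sum_comm
      _ = ∑ a, ∑ b, ∑ γ, ∑ c, ∑ d, G a b c d γ :=
          Finset.sum_congr rfl fun a _ => Finset.sum_congr rfl fun b _ => Finset.sum_comm
      _ = ∑ a, ∑ γ, ∑ b, ∑ c, ∑ d, G a b c d γ :=
          Finset.sum_congr rfl fun a _ => Finset.sum_comm
      _ = _ := Finset.sum_comm
  rw [h]
  refine Finset.sum_congr rfl fun γ _ => Finset.sum_congr rfl fun a _ =>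
    Finset.sum_congr rfl fun b _ => Finset.sum_congr rfl fun c _ =>
    Finset.sum_congr rfl fun d _ => ?_
  ring

variable {h : Bilin}

theorem hat_covD_covD_toTensor (hh : ∀ μ ν, IsHomog (-1) fun p => h p μ ν) {p : Pt}
    (hp : rad p ≠ 0) (i j k l : Fin 4) :
    hat (covD mink (covD mink (toTensor h))) p ![i, j, k, l]
      = pd i (pd j fun q => hat (toTensor h) q ![k, l]) p :=
  hat_covD_covD (fun k => (hh (k 0) (k 1)).ofReal) hp _

/-- The linearized Ricci tensor of Minkowski space in the parallel frame. -/
theorem sum_par_linRicci {p : Pt} (hp : rad p ≠ 0) (α β : Fin 4) :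
    ∑ a, ∑ b, (par p α a : ℂ) * (par p β b : ℂ) * linRicci mink h p a b
      = (1 / 2) * ∑ γ, (sgn γ : ℂ) *
        (hat (covD mink (covD mink (toTensor h))) p ![γ, α, β, γ]
          + hat (covD mink (covD mink (toTensor h))) p ![γ, β, α, γ]
          - hat (covD mink (covD mink (toTensor h))) p ![γ, γ, α, β]
          - hat (covD mink (covD mink (toTensor h))) p ![α, β, γ, γ]) := by
  set K := covD mink (covD mink (toTensor h))
  have hinv : ∀ c d, (((mink p)⁻¹ c d : ℝ) : ℂ)
      = ∑ γ, (sgn γ : ℂ) * ((par p γ c : ℂ) * (par p γ d : ℂ)) := by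
    intro c d
    rw [mink_inv_eq_sum_par hp]
    push_cast
    rfl
  have h1 := sum_metric_contraction (fun γ => (sgn γ : ℂ)) (fun a => (par p α a : ℂ))
    (fun b => (par p β b : ℂ)) (fun γ c => (par p γ c : ℂ)) fun a b c d =>
      (K p ![c, a, b, d] + K p ![c, b, a, d] - K p ![c, d, a, b] - K p ![a, b, c, d])
  have h2 : ∑ a, ∑ b, (par p α a : ℂ) * (par p β b : ℂ) * linRicci mink h p a b
      = (1 / 2) * ∑ a, ∑ b, (par p α a : ℂ) * (par p β b : ℂ) * ∑ c, ∑ d,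
        (∑ γ, (sgn γ : ℂ) * ((par p γ c : ℂ) * (par p γ d : ℂ))) *
        (K p ![c, a, b, d] + K p ![c, b, a, d] - K p ![c, d, a, b] - K p ![a, b, c, d]) := by
    rw [Finset.mul_sum]
    refine Finset.sum_congr rfl fun a _ => ?_
    rw [Finset.mul_sum]
    refine Finset.sum_congr rfl fun b _ => ?_
    rw [← mul_left_comm]
    simp only [linRicci, hinv]
    rfl
  rw [h2, h1]
  congr 1
  refine Finset.sum_congr rfl fun γ _ => ?_
  congr 1
  clear_value K
  clear h1 h2 hinv
  have c1 : ∀ F : Fin 4 → Fin 4 → Fin 4 → Fin 4 → ℂ, ∑ a, ∑ b, ∑ c, ∑ d, F a b c d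
      = ∑ c, ∑ a, ∑ b, ∑ d, F a b c d := fun F =>
    calc _ = ∑ a, ∑ c, ∑ b, ∑ d, F a b c d :=
          Finset.sum_congr rfl fun a _ => Finset.sum_comm
      _ = _ := Finset.sum_comm
  have c2 : ∀ F : Fin 4 → Fin 4 → Fin 4 → Fin 4 → ℂ, ∑ a, ∑ b, ∑ c, ∑ d, F a b c d
      = ∑ c, ∑ b, ∑ a, ∑ d, F a b c d := fun F =>
    (c1 F).trans (Finset.sum_congr rfl fun c _ => Finset.sum_comm)
  have c3 : ∀ F : Fin 4 → Fin 4 → Fin 4 → Fin 4 → ℂ, ∑ a, ∑ b, ∑ c, ∑ d, F a b c d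
      = ∑ c, ∑ d, ∑ a, ∑ b, F a b c d := fun F =>
    (c1 F).trans (Finset.sum_congr rfl fun c _ =>
      calc _ = ∑ a, ∑ d, ∑ b, F a b c d := Finset.sum_congr rfl fun a _ => Finset.sum_comm
        _ = _ := Finset.sum_comm)
  have e1 : ∑ a, ∑ b, ∑ c, ∑ d, K p ![c, a, b, d] *
      ((par p α a : ℂ) * (par p β b : ℂ) * ((par p γ c : ℂ) * (par p γ d : ℂ)))
      = hat K p ![γ, α, β, γ] := by
    rw [hat_four, c1]
    refine Finset.sum_congr rfl fun i _ => Finset.sum_congr rfl fun j _ =>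
      Finset.sum_congr rfl fun k _ => Finset.sum_congr rfl fun l _ => ?_
    ring
  have e2 : ∑ a, ∑ b, ∑ c, ∑ d, K p ![c, b, a, d] *
      ((par p α a : ℂ) * (par p β b : ℂ) * ((par p γ c : ℂ) * (par p γ d : ℂ)))
      = hat K p ![γ, β, α, γ] := by
    rw [hat_four, c2]
    refine Finset.sum_congr rfl fun i _ => Finset.sum_congr rfl fun j _ =>
      Finset.sum_congr rfl fun k _ => Finset.sum_congr rfl fun l _ => ?_
    ring
  have e3 : ∑ a, ∑ b, ∑ c, ∑ d, K p ![c, d, a, b] *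
      ((par p α a : ℂ) * (par p β b : ℂ) * ((par p γ c : ℂ) * (par p γ d : ℂ)))
      = hat K p ![γ, γ, α, β] := by
    rw [hat_four, c3]
    refine Finset.sum_congr rfl fun i _ => Finset.sum_congr rfl fun j _ =>
      Finset.sum_congr rfl fun k _ => Finset.sum_congr rfl fun l _ => ?_
    ring
  have e4 : ∑ a, ∑ b, ∑ c, ∑ d, K p ![a, b, c, d] *
      ((par p α a : ℂ) * (par p β b : ℂ) * ((par p γ c : ℂ) * (par p γ d : ℂ)))
      = hat K p ![α, β, γ, γ] := by
    rw [hat_four]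
    refine Finset.sum_congr rfl fun i _ => Finset.sum_congr rfl fun j _ =>
      Finset.sum_congr rfl fun k _ => Finset.sum_congr rfl fun l _ => ?_
    ring
  simp only [add_mul, sub_mul, Finset.sum_add_distrib, Finset.sum_sub_distrib, e1, e2, e3, e4]

/-- The mixed components of the linearized Einstein equation of a static field on Minkowski space
say that `curl curl w = 0` for the mixed components `w` of the field. -/
theorem curl_curl_timeSpace (hh : ∀ μ ν, IsHomog (-1) fun p => h p μ ν) {p : Pt} (hp : rad p ≠ 0)
    (hR : ∀ a b, linRicci mink h p a b = 0) (i : Fin 4) :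
    (pd 1 (pd i (timeSpace h 1)) p + pd 2 (pd i (timeSpace h 2)) p
      + pd 3 (pd i (timeSpace h 3)) p) - (pd 1 (pd 1 (timeSpace h i)) p
      + pd 2 (pd 2 (timeSpace h i)) p + pd 3 (pd 3 (timeSpace h i)) p) = 0 := by
  have h1 := sum_par_linRicci (h := h) hp 0 i
  simp only [hR, mul_zero, Finset.sum_const_zero, hat_covD_covD_toTensor hh hp] at h1
  have hH : ∀ k l, IsHomog (-1) fun q => hat (toTensor h) q ![k, l] := fun k l =>
    isHomog_hat (fun k => (hh (k 0) (k 1)).ofReal) _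
  have h00 : ∀ (j : Fin 4) (k l : Fin 4),
      pd j (pd 0 fun q => hat (toTensor h) q ![k, l]) p = 0 := fun j k l => by
    rw [pd_comm (((hH k l).smooth p hp).of_le two_le_infty)]
    exact ((hH k l).stat.pd j).pd_zero p
  have h01 : ∀ (j : Fin 4) (k l : Fin 4),
      pd 0 (pd j fun q => hat (toTensor h) q ![k, l]) p = 0 := fun j k l =>
    ((hH k l).stat.pd j).pd_zero p
  have hw : ∀ l, (fun q => hat (toTensor h) q ![0, l]) = fun q => (timeSpace h l q : ℂ) :=
    fun l => funext fun q => hat_zero_left h q l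
  have hpd : ∀ j k l, pd j (pd k fun q => (timeSpace h l q : ℂ)) p
      = ((pd j (pd k (timeSpace h l)) p : ℝ) : ℂ) := by
    intro j k l
    rw [← pd_ofReal (((isHomog_timeSpace hh l).pd k).differentiableAt hp)]
    apply pd_congr
    filter_upwards [eventually_rad_ne hp] with q hq
    exact pd_ofReal ((isHomog_timeSpace hh l).differentiableAt hq) k
  have h02 : ∀ j l, pd 0 (pd j (timeSpace h l)) p = 0 := fun j l =>
    ((isHomog_timeSpace hh l).stat.pd j).pd_zero p
  simp only [h00, h01, hw, hpd, h02, Fin.sum_univ_four, sgn, Matrix.cons_val] at h1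
  have h2 := congrArg Complex.re h1
  simp at h2
  linarith

end

section

theorem isHomog_linRicci_mink {h : Bilin} (hh : ∀ μ ν, IsHomog (-1) fun p => h p μ ν)
    (a b : Fin 4) : IsHomog (-3) fun p => linRicci mink h p a b := by
  have hK : ∀ i, IsHomog (-3) fun p => covD mink (covD mink (toTensor h)) p i := fun i => by
    simpa using isHomog_covD (isHomog_covD (T := toTensor h) fun k => (hh (k 0) (k 1)).ofReal) i
  unfold linRicci
  refine IsHomog.const_mul _ (IsHomog.sum _ fun c _ => IsHomog.sum _ fun d _ => ?_)
  have := (isHomog_mink_inv c d).ofReal.mul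
    ((((hK ![c, a, b, d]).add (hK ![c, b, a, d])).sub (hK ![c, d, a, b])).sub (hK ![a, b, c, d]))
  rwa [zero_add] at this

/-- The linearized Ricci tensor of Kerr tends to that of Minkowski space. -/
theorem asy_linRicci (M a : ℝ) {δ q : ℝ} (hδ : δ ≤ 1) {h h₀ : Bilin}
    (hh : ∀ μ ν, Asy 2 δ q (fun p => h p μ ν) fun p => h₀ p μ ν) (i j : Fin 4) :
    Asy 0 δ (q - 2) (fun p => linRicci (kerr M a) h p i j) fun p => linRicci mink h₀ p i j := by
  have hK := fun k => asy_covD_covD (n := 0) M a hδ hh k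
  unfold linRicci
  refine Asy.const_mul _ (Asy.sum _ fun c _ => Asy.sum _ fun d _ => ?_)
  exact ((asy_kerr_inv M a c d).mono_delta hδ).ofReal.mul_zero'
    ((((hK ![c, i, j, d]).add (hK ![c, j, i, d])).sub (hK ![c, d, i, j])).sub (hK ![i, j, c, d]))

/-- The leading part of a linearized vacuum perturbation of Kerr solves the linearized Einstein
equation on Minkowski space: its linearized Ricci tensor is homogeneous of degree `-3` but decays
faster than `r⁻³`. -/
theorem linRicci_mink_eq_zero (M a : ℝ) {δ : ℝ} (hδ : 0 < δ) {h k : Bilin}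
    (hh : ∀ μ ν, IsHomog (-1) fun p => h p μ ν)
    (hk : ∀ μ ν, IsSymbol 2 (-(1 + δ)) fun p => k p μ ν)
    (hv : ∀ᶠ p in atInfinity, ∀ μ ν, linRicci (kerr M a) (fun p => h p + k p) p μ ν = 0)
    {p : Pt} (hp : rad p ≠ 0) (μ ν : Fin 4) : linRicci mink h p μ ν = 0 := by
  have hδ' : 0 < min δ 1 := lt_min hδ one_pos
  have hA : ∀ μ ν, Asy 2 (min δ 1) (-1) (fun p => (h p + k p) μ ν) fun p => h p μ ν := fun μ ν => by
    have h1 : IsSymbol 2 (-1) fun p => h p μ ν := by simpa using (hh μ ν).isSymbol 2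
    have h2 : IsSymbol 2 (-1 - min δ 1) fun p => k p μ ν :=
      (hk μ ν).mono (by linarith [min_le_left δ 1])
    simpa using (Asy.refl h1 (min δ 1)).add (Asy.of_lower h2 hδ'.le)
  have hd := (asy_linRicci M a (min_le_right _ _) hA μ ν).diff.isBigO
  have hO : (fun p => linRicci mink h p μ ν) =O[atInfinity]
      fun p => rad p ^ ((-1 - 2 : ℝ) - min δ 1) := by
    refine (hd.neg_left).congr' ?_ EventuallyEq.rfl
    filter_upwards [hv] with p hp
    rw [hp]
    simp
  have hH := isHomog_linRicci_mink hh μ ν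
  exact hH.eq_zero_of_off_axis (fun q hq hc =>
    hH.eq_zero_of_isBigO (by push_cast; linarith) hO hq hc) hp

end

section

/-! ### Stokes' theorem on the unit sphere -/

/-- The curl of the spatial part of a stationary covector field. -/
def curl (w : Fin 4 → Pt → ℝ) : Fin 4 → Pt → ℝ :=
  ![0, fun p => pd 2 (w 3) p - pd 3 (w 2) p, fun p => pd 3 (w 1) p - pd 1 (w 3) p,
    fun p => pd 1 (w 2) p - pd 2 (w 1) p]

/-- The scalar product `x · v` of the spatial parts. -/
def radial (v : Fin 4 → Pt → ℝ) (p : Pt) : ℝ := p 1 * v 1 p + p 2 * v 2 p + p 3 * v 3 p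

/-- Polar coordinates on the unit sphere. -/
def polar (x : ℝ × ℝ) : Pt :=
  ![0, Real.sin x.1 * Real.cos x.2, Real.sin x.1 * Real.sin x.2, Real.cos x.1]

theorem rad_polar (x : ℝ × ℝ) : rad (polar x) = 1 := by
  have h : rad (polar x) ^ 2 = 1 := by
    rw [rad_sq]
    simp only [polar, Matrix.cons_val]
    linear_combination Real.sin x.1 ^ 2 * Real.sin_sq_add_cos_sq x.2 + Real.sin_sq_add_cos_sq x.1
  exact (pow_eq_one_iff_of_nonneg (rad_nonneg _) two_ne_zero).1 h

theorem contDiff_polar : ContDiff ℝ ∞ polar := by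
  unfold polar
  rw [contDiff_pi]
  intro i
  fin_cases i <;> simp <;> fun_prop

/-- Every point off the axis is, up to a time translation and a dilation, in the image of the open
polar chart. -/
theorem exists_polar {p : Pt} (hp : rad p ≠ 0) (hc : cyl p ≠ 0) :
    ∃ x : ℝ × ℝ, x.1 ∈ Set.Ioo 0 Real.pi ∧ x.2 ∈ Set.Icc (-Real.pi) Real.pi ∧
      p = rad p • polar x + Pi.single 0 (p 0) := by
  have hr : 0 < rad p := lt_of_le_of_ne (rad_nonneg p) hp.symm
  have hc' : 0 < cyl p := lt_of_le_of_ne (Real.sqrt_nonneg _) hc.symm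
  have h1 := rad_sq p
  have h2 := cyl_sq p
  have h3 : (p 3 / rad p) ^ 2 < 1 := by
    rw [div_pow, div_lt_one (by positivity)]
    nlinarith
  have h4 := abs_lt.1 ((sq_lt_one_iff_abs_lt_one _).1 h3)
  have h5 : Real.sin (Real.arccos (p 3 / rad p)) = cyl p / rad p := by
    rw [Real.sin_arccos, Real.sqrt_eq_iff_mul_self_eq (by linarith) (by positivity)]
    field_simp
    linarith
  have hn : ‖(⟨p 1, p 2⟩ : ℂ)‖ = cyl p := by
    rw [Complex.norm_def, Complex.normSq_mk, cyl]
    congr 1; ring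
  have hz : (⟨p 1, p 2⟩ : ℂ) ≠ 0 := by rw [← norm_ne_zero_iff, hn]; exact hc
  refine ⟨(Real.arccos (p 3 / rad p), Complex.arg ⟨p 1, p 2⟩), ⟨Real.arccos_pos.2 h4.2,
    lt_of_le_of_ne (Real.arccos_le_pi _) fun h => ?_⟩,
    ⟨(Complex.neg_pi_lt_arg _).le, Complex.arg_le_pi _⟩, ?_⟩
  · rw [Real.arccos_eq_pi] at h; linarith
  · ext i
    fin_cases i
    · simp [polar]
    · simp [polar, h5, Complex.cos_arg hz, hn]; field_simp
    · simp [polar, h5, Complex.sin_arg, hn]; field_simp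
    · simp [polar, Real.cos_arccos h4.1.le h4.2.le]; field_simp

theorem IsHomog.eq_zero_of_polar {d : ℤ} {f : Pt → ℝ} (h : IsHomog d f)
    (h0 : ∀ x : ℝ × ℝ, x.1 ∈ Set.Ioo 0 Real.pi → x.2 ∈ Set.Icc (-Real.pi) Real.pi →
      f (polar x) = 0) {p : Pt} (hp : rad p ≠ 0) : f p = 0 := by
  refine h.eq_zero_of_off_axis (fun q hq hc => ?_) hp
  obtain ⟨x, h1, h2, h3⟩ := exists_polar hq hc
  rw [h3, h.stat, h.scale _ (lt_of_le_of_ne (rad_nonneg q) hq.symm) _ (by simp [rad_polar]),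
    h0 x h1 h2, smul_zero]

/-- The chain rule along a curve, in coordinates. -/
theorem hasDerivAt_comp_curve {f : Pt → ℝ} {c : ℝ → Pt} {c' : Pt} {t : ℝ}
    (hf : DifferentiableAt ℝ f (c t)) (hc : HasDerivAt c c' t) :
    HasDerivAt (fun s => f (c s)) (∑ j, c' j * pd j f (c t)) t := by
  have h := hf.hasFDerivAt.comp_hasDerivAt t hc
  refine h.congr_deriv ?_
  have h1 : c' = ∑ j, c' j • (Pi.single j (1 : ℝ) : Pt) := by
    ext i
    simp [Finset.sum_apply, Pi.single_apply]
  conv_lhs => rw [h1, map_sum]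
  simp only [map_smul, smul_eq_mul, pd]

/-- The derivative of the polar chart in the polar angle. -/
def polarθ (x : ℝ × ℝ) : Pt :=
  ![0, Real.cos x.1 * Real.cos x.2, Real.cos x.1 * Real.sin x.2, -Real.sin x.1]

/-- The derivative of the polar chart in the azimuthal angle. -/
def polarφ (x : ℝ × ℝ) : Pt :=
  ![0, -(Real.sin x.1 * Real.sin x.2), Real.sin x.1 * Real.cos x.2, 0]

theorem hasDerivAt_polar_left (θ φ : ℝ) :
    HasDerivAt (fun s => polar (s, φ)) (polarθ (θ, φ)) θ := by
  rw [hasDerivAt_pi]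
  intro i
  fin_cases i
  · exact hasDerivAt_const _ _
  · exact (Real.hasDerivAt_sin θ).mul_const (Real.cos φ)
  · exact (Real.hasDerivAt_sin θ).mul_const (Real.sin φ)
  · exact Real.hasDerivAt_cos θ

theorem hasDerivAt_polar_right (θ φ : ℝ) :
    HasDerivAt (fun s => polar (θ, s)) (polarφ (θ, φ)) φ := by
  rw [hasDerivAt_pi]
  intro i
  fin_cases i
  · exact hasDerivAt_const _ _
  · exact ((Real.hasDerivAt_cos φ).const_mul (Real.sin θ)).congr_deriv (by simp [polarφ])
  · exact (Real.hasDerivAt_sin φ).const_mul (Real.sin θ)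
  · exact hasDerivAt_const φ (Real.cos θ)

variable {W : Fin 4 → Pt → ℝ}

theorem contDiff_comp_polar {f : Pt → ℝ} (hf : ∀ p, rad p ≠ 0 → ContDiffAt ℝ ∞ f p) :
    ContDiff ℝ ∞ fun x => f (polar x) :=
  contDiff_iff_contDiffAt.2 fun x =>
    (hf _ (by simp [rad_polar])).comp x contDiff_polar.contDiffAt

theorem fderiv_fst {f : ℝ × ℝ → ℝ} (hf : Differentiable ℝ f) {θ φ y : ℝ}
    (h : HasDerivAt (fun s => f (s, φ)) y θ) : fderiv ℝ f (θ, φ) (1, 0) = y := by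
  have h1 : HasDerivAt (fun s : ℝ => (s, φ)) ((1, 0) : ℝ × ℝ) θ :=
    (hasDerivAt_id θ).prodMk (hasDerivAt_const θ φ)
  exact ((hf (θ, φ)).hasFDerivAt.comp_hasDerivAt θ h1).unique h

theorem fderiv_snd {f : ℝ × ℝ → ℝ} (hf : Differentiable ℝ f) {θ φ y : ℝ}
    (h : HasDerivAt (fun s => f (θ, s)) y φ) : fderiv ℝ f (θ, φ) (0, 1) = y := by
  have h1 : HasDerivAt (fun s : ℝ => (θ, s)) ((0, 1) : ℝ × ℝ) φ :=
    (hasDerivAt_const φ θ).prodMk (hasDerivAt_id φ)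
  exact ((hf (θ, φ)).hasFDerivAt.comp_hasDerivAt φ h1).unique h

/-- Stokes' theorem on the unit sphere in polar coordinates. -/
theorem integral_radial_curl (hW : ∀ i p, rad p ≠ 0 → ContDiffAt ℝ ∞ (W i) p) :
    ∫ x in Set.Icc ((0, -Real.pi) : ℝ × ℝ) (Real.pi, Real.pi),
      Real.sin x.1 * radial (curl W) (polar x) = 0 := by
  set f : ℝ × ℝ → ℝ := fun x => W 1 (polar x) * polarφ x 1 + W 2 (polar x) * polarφ x 2 with hf
  set g : ℝ × ℝ → ℝ := fun x => -(W 1 (polar x) * polarθ x 1 + W 2 (polar x) * polarθ x 2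
    + W 3 (polar x) * polarθ x 3) with hg
  have hWp := fun i => contDiff_comp_polar (hW i)
  have h1 := hWp 1
  have h2 := hWp 2
  have h3 := hWp 3
  have hfc : ContDiff ℝ ∞ f := by
    simp only [hf, polarφ, Matrix.cons_val]
    exact (h1.mul (by fun_prop)).add (h2.mul (by fun_prop))
  have hgc : ContDiff ℝ ∞ g := by
    simp only [hg, polarθ, Matrix.cons_val]
    exact (((h1.mul (by fun_prop)).add (h2.mul (by fun_prop))).add (h3.mul (by fun_prop))).neg
  have hfd : Differentiable ℝ f := hfc.differentiable (by simp)
  have hgd : Differentiable ℝ g := hgc.differentiable (by simp)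
  have hpt : ∀ x : ℝ × ℝ, fderiv ℝ f x (1, 0) + fderiv ℝ g x (0, 1)
      = Real.sin x.1 * radial (curl W) (polar x) := by
    rintro ⟨θ, φ⟩
    have hd := fun i => (hW i (polar (θ, φ)) (by simp [rad_polar])).differentiableAt (by simp)
    have hθ := fun i => hasDerivAt_comp_curve (hd i) (hasDerivAt_polar_left θ φ)
    have hφ := fun i => hasDerivAt_comp_curve (hd i) (hasDerivAt_polar_right θ φ)
    have e1 : HasDerivAt (fun s => f (s, φ)) _ θ :=
      ((hθ 1).mul (((Real.hasDerivAt_sin θ).mul_const (Real.sin φ)).neg)).add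
        ((hθ 2).mul ((Real.hasDerivAt_sin θ).mul_const (Real.cos φ)))
    have e2 : HasDerivAt (fun s => g (θ, s)) _ φ :=
      ((((hφ 1).mul ((Real.hasDerivAt_cos φ).const_mul (Real.cos θ))).add
        ((hφ 2).mul ((Real.hasDerivAt_sin φ).const_mul (Real.cos θ)))).add
        ((hφ 3).mul (hasDerivAt_const φ (-Real.sin θ)))).neg
    rw [fderiv_fst hfd e1, fderiv_snd hgd e2]
    have q1 : polar (θ, φ) 1 = Real.sin θ * Real.cos φ := rfl
    have q2 : polar (θ, φ) 2 = Real.sin θ * Real.sin φ := rfl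
    have q3 : polar (θ, φ) 3 = Real.cos θ := rfl
    simp only [Fin.sum_univ_four, polarθ, polarφ, radial, curl, Matrix.cons_val, q1, q2, q3,
      Pi.neg_apply]
    linear_combination (Real.sin θ * Real.cos θ * (pd 1 (W 2) (polar (θ, φ))
      - pd 2 (W 1) (polar (θ, φ)))) * Real.sin_sq_add_cos_sq φ
  have hdiv := MeasureTheory.integral_divergence_prod_Icc_of_hasFDerivAt_of_le f g
    (fderiv ℝ f) (fderiv ℝ g) (0, -Real.pi) (Real.pi, Real.pi)
    ⟨Real.pi_pos.le, by linarith [Real.pi_pos]⟩ hfc.continuous.continuousOn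
    hgc.continuous.continuousOn (fun x _ => (hfd x).hasFDerivAt) (fun x _ => (hgd x).hasFDerivAt)
    (ContinuousOn.integrableOn_compact isCompact_Icc (Continuous.continuousOn (by
      have c1 := hfc.continuous_fderiv (by simp)
      have c2 := hgc.continuous_fderiv (by simp)
      fun_prop)))
  simp only [hpt] at hdiv
  rw [hdiv]
  simp [hf, hg, polar, polarθ, polarφ]

/-- If the radial component of a curl has a sign on the unit sphere, then it vanishes. -/
theorem radial_curl_eq_zero_of_nonneg (hW : ∀ i p, rad p ≠ 0 → ContDiffAt ℝ ∞ (W i) p)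
    (h0 : ∀ x, 0 ≤ radial (curl W) (polar x)) {x : ℝ × ℝ} (h1 : x.1 ∈ Set.Ioo 0 Real.pi)
    (h2 : x.2 ∈ Set.Icc (-Real.pi) Real.pi) : radial (curl W) (polar x) = 0 := by
  have hc : Continuous fun x : ℝ × ℝ => Real.sin x.1 * radial (curl W) (polar x) := by
    have hd : ∀ i j, Continuous fun x => pd j (W i) (polar x) := fun i j =>
      (contDiff_comp_polar fun p hp => contDiffAt_pd (hW i p hp) j).continuous
    have hp : ∀ i, Continuous fun x => polar x i := fun i =>
      (continuous_apply i).comp contDiff_polar.continuous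
    simp only [radial, curl, Matrix.cons_val]
    have := hd 1 2
    have := hd 1 3
    have := hd 2 1
    have := hd 2 3
    have := hd 3 1
    have := hd 3 2
    fun_prop
  set S := Set.Icc ((0, -Real.pi) : ℝ × ℝ) (Real.pi, Real.pi) with hS
  have hmem : x ∈ S := ⟨⟨h1.1.le, h2.1⟩, ⟨h1.2.le, h2.2⟩⟩
  have hae := (MeasureTheory.setIntegral_eq_zero_iff_of_nonneg_ae (s := S)
    (MeasureTheory.ae_restrict_of_forall_mem measurableSet_Icc fun x hx =>
      mul_nonneg (Real.sin_nonneg_of_nonneg_of_le_pi hx.1.1 hx.2.1) (h0 x))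
    (hc.continuousOn.integrableOn_compact isCompact_Icc)).1 (integral_radial_curl hW)
  have hE := MeasureTheory.Measure.eqOn_of_ae_eq hae hc.continuousOn continuousOn_const (by
    rw [hS, ← Set.Icc_prod_Icc, interior_prod_eq, interior_Icc, interior_Icc, closure_prod_eq,
      closure_Ioo Real.pi_pos.ne, closure_Ioo (by linarith [Real.pi_pos])])
  have h3 : Real.sin x.1 * radial (curl W) (polar x) = 0 := hE hmem
  exact (mul_eq_zero.1 h3).resolve_left (Real.sin_pos_of_pos_of_lt_pi h1.1 h1.2).ne'

end

section

/-! ### Fields with `curl curl w = 0` -/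

theorem pd_coord (j i : Fin 4) (p : Pt) : pd j (fun q : Pt => q i) p = if i = j then 1 else 0 := by
  have h : HasFDerivAt (fun q : Pt => q i) (ContinuousLinearMap.proj i : Pt →L[ℝ] ℝ) p :=
    (ContinuousLinearMap.proj i : Pt →L[ℝ] ℝ).hasFDerivAt
  unfold pd
  rw [h.fderiv]
  simp [Pi.single_apply]

theorem differentiableAt_coord (i : Fin 4) (p : Pt) : DifferentiableAt ℝ (fun q : Pt => q i) p := by
  fun_prop

variable {v w : Fin 4 → Pt → ℝ}

theorem isHomog_curl (hw : ∀ i, IsHomog (-1) (w i)) (i : Fin 4) : IsHomog (-2) (curl w i) := by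
  have h : ∀ i j k l, IsHomog (-2) fun p => pd i (w j) p - pd k (w l) p := fun i j k l =>
    ((hw j).pd i).sub ((hw l).pd k)
  fin_cases i
  · exact ⟨fun _ _ => contDiffAt_const, fun _ _ _ _ => by simp [curl], fun _ _ => rfl⟩
  · exact h 2 3 3 2
  · exact h 3 1 1 3
  · exact h 1 2 2 1

theorem isHomog_radial (hv : ∀ i, IsHomog (-2) (v i)) : IsHomog (-1) (radial v) := by
  have h : ∀ i : Fin 4, i ≠ 0 → IsHomog (-1) fun p => p i * v i p := fun i hi => by
    simpa using (isHomog_coord hi).mul (hv i)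
  exact ((h 1 (by decide)).add (h 2 (by decide))).add (h 3 (by decide))

/-- A curl-free and divergence-free field, homogeneous of degree `-2`. -/
structure IsHarmonic (v : Fin 4 → Pt → ℝ) : Prop where
  homog : ∀ i, IsHomog (-2) (v i)
  curl_free : ∀ p, rad p ≠ 0 → ∀ i j, i ≠ 0 → j ≠ 0 → pd i (v j) p = pd j (v i) p
  div_free : ∀ p, rad p ≠ 0 → pd 1 (v 1) p + pd 2 (v 2) p + pd 3 (v 3) p = 0

/-- The gradient of `x · v` is `-v`. -/
theorem IsHarmonic.pd_radial (hv : IsHarmonic v) {p : Pt} (hp : rad p ≠ 0) {j : Fin 4}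
    (hj : j ≠ 0) : pd j (radial v) p = -v j p := by
  have hd := fun i => (hv.homog i).differentiableAt hp
  have hx := fun i => differentiableAt_coord i p
  have he := (hv.homog j).euler hp
  have h1 := hv.curl_free p hp j 1 hj (by decide)
  have h2 := hv.curl_free p hp j 2 hj (by decide)
  have h3 := hv.curl_free p hp j 3 hj (by decide)
  have e : pd j (radial v) p = (p 1 * pd j (v 1) p + v 1 p * pd j (fun q => q 1) p)
      + (p 2 * pd j (v 2) p + v 2 p * pd j (fun q => q 2) p)
      + (p 3 * pd j (v 3) p + v 3 p * pd j (fun q => q 3) p) := by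
    unfold radial
    have hm := fun i => (hx i).fun_mul (hd i)
    rw [pd_add ((hm 1).fun_add (hm 2)) (hm 3), pd_add (hm 1) (hm 2),
      pd_mul (hx 1) (hd 1), pd_mul (hx 2) (hd 2),
      pd_mul (hx 3) (hd 3)]
  rw [e, h1, h2, h3]
  simp only [pd_coord, smul_eq_mul] at he ⊢
  push_cast at he
  fin_cases j <;> simp at hj he ⊢ <;> linarith

/-- The cross product `v × x`. -/
def crossX (v : Fin 4 → Pt → ℝ) : Fin 4 → Pt → ℝ :=
  ![0, fun p => v 2 p * p 3 - v 3 p * p 2, fun p => v 3 p * p 1 - v 1 p * p 3,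
    fun p => v 1 p * p 2 - v 2 p * p 1]

theorem isHomog_crossX (hv : ∀ i, IsHomog (-2) (v i)) (i : Fin 4) :
    IsHomog (-1) (crossX v i) := by
  have h : ∀ i j : Fin 4, j ≠ 0 → IsHomog (-1) fun p => v i p * p j := fun i j hj => by
    simpa using (hv i).mul (isHomog_coord hj)
  fin_cases i
  · exact ⟨fun _ _ => contDiffAt_const, fun _ _ _ _ => by simp [crossX], fun _ _ => rfl⟩
  · exact (h 2 3 (by decide)).sub (h 3 2 (by decide))
  · exact (h 3 1 (by decide)).sub (h 1 3 (by decide))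
  · exact (h 1 2 (by decide)).sub (h 2 1 (by decide))

/-- The field `(x · v) (v × x)` has the radial curl `|v × x|²`, because `v × x` is curl-free and
the gradient of `x · v` is `-v`. -/
theorem IsHarmonic.radial_curl (hv : IsHarmonic v) {p : Pt} (hp : rad p ≠ 0) :
    radial (curl fun i p => radial v p * crossX v i p) p
      = crossX v 1 p ^ 2 + crossX v 2 p ^ 2 + crossX v 3 p ^ 2 := by
  have hd := fun i => (hv.homog i).differentiableAt hp
  have hx := fun i => differentiableAt_coord i p
  have hu := (isHomog_radial hv.homog).differentiableAt hp
  have hX := fun i => (isHomog_crossX hv.homog i).differentiableAt hp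
  have hpX : ∀ j k l m n, pd j (fun p => v k p * p l - v m p * p n) p
      = v k p * (if l = j then 1 else 0) + p l * pd j (v k) p
        - (v m p * (if n = j then 1 else 0) + p n * pd j (v m) p) := by
    intro j k l m n
    rw [pd_sub ((hd k).fun_mul (hx l)) ((hd m).fun_mul (hx n)), pd_mul (hd k) (hx l),
      pd_mul (hd m) (hx n), pd_coord, pd_coord]
  have h1 := fun j => hpX j 2 3 3 2
  have h2 := fun j => hpX j 3 1 1 3
  have h3 := fun j => hpX j 1 2 2 1
  have g1 := hv.pd_radial hp (j := 1) (by decide)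
  have g2 := hv.pd_radial hp (j := 2) (by decide)
  have g3 := hv.pd_radial hp (j := 3) (by decide)
  have E : ∀ i, _ := fun i => (hv.homog i).euler hp
  have e1 := E 1
  have e2 := E 2
  have e3 := E 3
  have c12 := hv.curl_free p hp 1 2 (by decide) (by decide)
  have c13 := hv.curl_free p hp 1 3 (by decide) (by decide)
  have c23 := hv.curl_free p hp 2 3 (by decide) (by decide)
  have hdiv := hv.div_free p hp
  have hm : ∀ i j, pd j (fun p => radial v p * crossX v i p) p
      = radial v p * pd j (crossX v i) p + crossX v i p * pd j (radial v) p :=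
    fun i j => pd_mul hu (hX i) j
  have k1 : ∀ j, pd j (crossX v 1) p = _ := h1
  have k2 : ∀ j, pd j (crossX v 2) p = _ := h2
  have k3 : ∀ j, pd j (crossX v 3) p = _ := h3
  rw [radial]
  simp only [curl, Matrix.cons_val, hm, k1, k2, k3, g1, g2, g3]
  simp only [smul_eq_mul] at e1 e2 e3
  push_cast at e1 e2 e3
  simp [crossX]
  linear_combination radial v p * (p 1 * (e1 - p 1 * hdiv) + p 2 * (e2 - p 2 * hdiv)
    + p 3 * (e3 - p 3 * hdiv))

/-- A harmonic field that is homogeneous of degree `-2` is radial. -/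
theorem IsHarmonic.crossX_eq_zero (hv : IsHarmonic v) (i : Fin 4) {p : Pt} (hp : rad p ≠ 0) :
    crossX v i p = 0 := by
  have hV : ∀ i, IsHomog (-2) fun p => radial v p * crossX v i p := fun i => by
    simpa using (isHomog_radial hv.homog).mul (isHomog_crossX hv.homog i)
  have hpol : ∀ x, rad (polar x) ≠ 0 := fun x => by simp [rad_polar]
  refine (isHomog_crossX hv.homog i).eq_zero_of_polar (fun x h1 h2 => ?_) hp
  have h := radial_curl_eq_zero_of_nonneg (fun i => (hV i).smooth) (fun x => by
    rw [hv.radial_curl (hpol x)]; positivity) h1 h2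
  rw [hv.radial_curl (hpol x)] at h
  have s1 := sq_nonneg (crossX v 1 (polar x))
  have s2 := sq_nonneg (crossX v 2 (polar x))
  have s3 := sq_nonneg (crossX v 3 (polar x))
  fin_cases i
  · rfl
  · exact pow_eq_zero_iff two_ne_zero |>.1 (by linarith : crossX v 1 (polar x) ^ 2 = 0)
  · exact pow_eq_zero_iff two_ne_zero |>.1 (by linarith : crossX v 2 (polar x) ^ 2 = 0)
  · exact pow_eq_zero_iff two_ne_zero |>.1 (by linarith : crossX v 3 (polar x) ^ 2 = 0)

/-- The radial component of a harmonic field is constant on the unit sphere. -/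
theorem IsHarmonic.radial_polar (hv : IsHarmonic v) (x : ℝ × ℝ) :
    radial v (polar x) = radial v (polar (0, 0)) := by
  have hpol : ∀ x, rad (polar x) ≠ 0 := fun x => by simp [rad_polar]
  have hgrad : ∀ (x : ℝ × ℝ) (c : Pt), c 0 = 0 → ∑ j, polar x j * c j = 0 →
      ∑ j, c j * pd j (radial v) (polar x) = 0 := by
    intro x c hc h
    have g1 := hv.pd_radial (hpol x) (j := 1) (by decide)
    have g2 := hv.pd_radial (hpol x) (j := 2) (by decide)
    have g3 := hv.pd_radial (hpol x) (j := 3) (by decide)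
    have x1 : v 2 (polar x) * polar x 3 - v 3 (polar x) * polar x 2 = 0 :=
      hv.crossX_eq_zero 1 (hpol x)
    have x2 : v 3 (polar x) * polar x 1 - v 1 (polar x) * polar x 3 = 0 :=
      hv.crossX_eq_zero 2 (hpol x)
    have x3 : v 1 (polar x) * polar x 2 - v 2 (polar x) * polar x 1 = 0 :=
      hv.crossX_eq_zero 3 (hpol x)
    have hr := rad_sq (polar x)
    rw [rad_polar] at hr
    simp only [Fin.sum_univ_four, g1, g2, g3, hc] at h ⊢
    linear_combination (-(v 1 (polar x) * c 1 + v 2 (polar x) * c 2 + v 3 (polar x) * c 3)) * hr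
      - (v 1 (polar x) * polar x 1 + v 2 (polar x) * polar x 2 + v 3 (polar x) * polar x 3) * h
      - x1 * (c 2 * polar x 3 - c 3 * polar x 2) - x2 * (c 3 * polar x 1 - c 1 * polar x 3)
      - x3 * (c 1 * polar x 2 - c 2 * polar x 1)
  have hd := fun x => (isHomog_radial hv.homog).differentiableAt (hpol x)
  have hθ : ∀ φ θ, radial v (polar (θ, φ)) = radial v (polar (0, φ)) := fun φ θ =>
    is_const_of_deriv_eq_zero (f := fun s => radial v (polar (s, φ)))
      (fun θ => (hasDerivAt_comp_curve (hd _) (hasDerivAt_polar_left θ φ)).differentiableAt)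
      (fun θ => (hasDerivAt_comp_curve (hd _) (hasDerivAt_polar_left θ φ)).deriv.trans
        (hgrad _ _ rfl (by
          simp [Fin.sum_univ_four, polar, polarθ]
          linear_combination Real.sin θ * Real.cos θ * Real.sin_sq_add_cos_sq φ))) θ 0
  have hφ : ∀ θ φ, radial v (polar (θ, φ)) = radial v (polar (θ, 0)) := fun θ φ =>
    is_const_of_deriv_eq_zero (f := fun s => radial v (polar (θ, s)))
      (fun φ => (hasDerivAt_comp_curve (hd _) (hasDerivAt_polar_right θ φ)).differentiableAt)
      (fun φ => (hasDerivAt_comp_curve (hd _) (hasDerivAt_polar_right θ φ)).deriv.trans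
        (hgrad _ _ rfl (by
          simp [Fin.sum_univ_four, polar, polarφ]
          ring))) φ 0
  rw [← hθ 0 x.1, ← hφ x.1 x.2]

/-- If `curl curl w = 0`, then `curl w` is harmonic. -/
theorem isHarmonic_curl (hw : ∀ i, IsHomog (-1) (w i))
    (hcc : ∀ p, rad p ≠ 0 → ∀ i, (pd 1 (pd i (w 1)) p + pd 2 (pd i (w 2)) p
      + pd 3 (pd i (w 3)) p) - (pd 1 (pd 1 (w i)) p + pd 2 (pd 2 (w i)) p
      + pd 3 (pd 3 (w i)) p) = 0) : IsHarmonic (curl w) := by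
  have hd : ∀ p, rad p ≠ 0 → ∀ i j, DifferentiableAt ℝ (pd i (w j)) p := fun p hp i j =>
    ((hw j).pd i).differentiableAt hp
  have hcomm : ∀ p, rad p ≠ 0 → ∀ i j k, pd i (pd j (w k)) p = pd j (pd i (w k)) p :=
    fun p hp i j k => pd_comm (((hw k).smooth p hp).of_le two_le_infty) i j
  have hpc : ∀ p, rad p ≠ 0 → ∀ i j k l m, pd i (fun q => pd j (w k) q - pd l (w m) q) p
      = pd i (pd j (w k)) p - pd i (pd l (w m)) p := fun p hp i j k l m =>
    pd_sub (hd p hp j k) (hd p hp l m) i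
  refine ⟨isHomog_curl hw, fun p hp i j hi hj => ?_, fun p hp => ?_⟩
  · have h1 := hcc p hp 1
    have h2 := hcc p hp 2
    have h3 := hcc p hp 3
    have := hcomm p hp 1 2
    have := hcomm p hp 1 3
    have := hcomm p hp 2 3
    fin_cases i <;> fin_cases j <;> simp [curl, hpc p hp] at hi hj ⊢ <;>
      linarith [hcomm p hp 1 2 1, hcomm p hp 1 2 2, hcomm p hp 1 2 3, hcomm p hp 1 3 1,
        hcomm p hp 1 3 2, hcomm p hp 1 3 3, hcomm p hp 2 3 1, hcomm p hp 2 3 2, hcomm p hp 2 3 3]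
  · simp only [curl, Matrix.cons_val, hpc p hp]
    linarith [hcomm p hp 1 2 3, hcomm p hp 1 3 2, hcomm p hp 2 3 1]

/-- If `w` is homogeneous of degree `-1` and `curl curl w = 0`, then `curl w` has no radial
component. -/
theorem radial_curl_eq_zero (hw : ∀ i, IsHomog (-1) (w i))
    (hcc : ∀ p, rad p ≠ 0 → ∀ i, (pd 1 (pd i (w 1)) p + pd 2 (pd i (w 2)) p
      + pd 3 (pd i (w 3)) p) - (pd 1 (pd 1 (w i)) p + pd 2 (pd 2 (w i)) p
      + pd 3 (pd 3 (w i)) p) = 0) {p : Pt} (hp : rad p ≠ 0) : radial (curl w) p = 0 := by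
  have hv := isHarmonic_curl hw hcc
  have hpol : ∀ x, rad (polar x) ≠ 0 := fun x => by simp [rad_polar]
  set c := radial (curl w) (polar (0, 0)) with hc
  -- the flux of the curl of `c w` through the sphere has the integrand `c²`
  have hcw : ∀ x, radial (curl fun i p => c * w i p) (polar x) = c ^ 2 := by
    intro x
    have hm : ∀ i j, pd j (fun p => c * w i p) (polar x) = c * pd j (w i) (polar x) := by
      intro i j
      rw [pd_mul (differentiableAt_const c) ((hw i).differentiableAt (hpol x)), pd_const]
      simp
    rw [show c ^ 2 = c * radial (curl w) (polar x) by rw [hv.radial_polar x, pow_two]]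
    simp only [radial, curl, Matrix.cons_val, hm]
    ring
  refine (isHomog_radial (isHomog_curl hw)).eq_zero_of_polar (fun x h1 h2 => ?_) hp
  have h := radial_curl_eq_zero_of_nonneg (W := fun i p => c * w i p)
    (fun i p hp => contDiffAt_const.mul ((hw i).smooth p hp))
    (fun x => by rw [hcw]; positivity) h1 h2
  rw [hcw] at h
  rw [hv.radial_polar x, ← hc]
  exact pow_eq_zero_iff two_ne_zero |>.1 h

end

section

/-! ### Stationary fields as functions on space -/

/-- The projection to space. -/
def toSpace : Pt →L[ℝ] Space :=
  (EuclideanSpace.equiv (Fin 3) ℝ).symm.toContinuousLinearMap ∘L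
    ContinuousLinearMap.pi fun i : Fin 3 => ContinuousLinearMap.proj i.succ

theorem toSpace_apply (p : Pt) : toSpace p = !₂[p 1, p 2, p 3] := by
  ext i
  fin_cases i <;> rfl

theorem norm_toSpace (p : Pt) : ‖toSpace p‖ = rad p := by
  rw [toSpace_apply, EuclideanSpace.norm_eq, rad]
  simp [Fin.sum_univ_three]

theorem tendsto_toSpace : Tendsto toSpace atInfinity (Bornology.cobounded Space) := by
  rw [← tendsto_norm_atTop_iff_cobounded]
  simp only [norm_toSpace]
  exact tendsto_comap.mono_left inf_le_left

/-- Decay of the iterated derivatives on space gives a symbol near infinity. -/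
theorem isSymbol_comp_toSpace {n : ℕ} {q : ℝ} {f : Space → ℝ}
    (hf : ∀ᶠ x in Bornology.cobounded Space, ContDiffAt ℝ n f x)
    (hb : ∀ k ≤ n, iteratedFDeriv ℝ k f =O[Bornology.cobounded Space] fun x => ‖x‖ ^ (q - k)) :
    IsSymbol n q fun p => f (toSpace p) := by
  have h0 : ∀ {n : ℕ} {q : ℝ} {f : Space → ℝ},
      (∀ k ≤ n, iteratedFDeriv ℝ k f =O[Bornology.cobounded Space] fun x => ‖x‖ ^ (q - k)) →
      (fun p => f (toSpace p)) =O[atInfinity] fun p => rad p ^ q := by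
    intro n q f hb
    have h1 := (hb 0 (Nat.zero_le _)).norm_left
    simp only [norm_iteratedFDeriv_zero, Nat.cast_zero, sub_zero] at h1
    have h2 := h1.of_norm_left.comp_tendsto tendsto_toSpace
    simpa only [Function.comp_def, norm_toSpace] using h2
  induction n generalizing q f with
  | zero => exact h0 hb
  | succ n ih =>
    have hd : ∀ᶠ p in atInfinity, DifferentiableAt ℝ f (toSpace p) :=
      tendsto_toSpace.eventually (hf.mono fun x hx => hx.differentiableAt (by simp))
    refine ⟨h0 hb, hd.mono fun p hp => hp.comp p toSpace.differentiableAt, fun μ => ?_⟩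
    set e : Space := toSpace (Pi.single μ 1)
    refine (ih (q := q - 1) (f := fun x => fderiv ℝ f x e) ?_ fun k hk => ?_).congr ?_
    · filter_upwards [hf] with x hx
      exact (hx.fderiv_right (m := n) (by push_cast; rfl)).clm_apply contDiffAt_const
    · have hk1 := hb (k + 1) (by omega)
      refine IsBigO.trans (IsBigO.of_bound ‖e‖ ?_) (hk1.trans_eventuallyEq ?_)
      · filter_upwards [hf] with x hx
        have hx' : ContDiffAt ℝ n (fderiv ℝ f) x := hx.fderiv_right (m := n) (by push_cast; rfl)
        refine (norm_iteratedFDeriv_clm_apply_const hx' (by exact_mod_cast hk)).trans ?_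
        rw [norm_iteratedFDeriv_fderiv]
      · refine Eventually.of_forall fun x => ?_
        push_cast
        ring_nf
    · filter_upwards [hd] with p hp
      have := (hp.hasFDerivAt.comp p toSpace.hasFDerivAt).fderiv
      simp only [Function.comp_def] at this
      simp only [pd, this]
      rfl

theorem DecaysLike.isSymbol {q : ℝ} {H : Coeff} (h : DecaysLike q H) (μ ν : Fin 4) :
    IsSymbol 3 (-q) fun p => stationary H p μ ν := by
  have := isSymbol_comp_toSpace (n := 3) (q := -q) (h.contDiffAt μ ν) (h.isBigO μ ν)
  simpa only [toSpace_apply, stationary] using this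

variable {G : Sphere → Matrix (Fin 4) (Fin 4) ℝ}

/-- The field `g₀ / r` is smooth away from the origin, because `x ↦ x / |x|` is smooth as a map into
the sphere. -/
theorem contDiffAt_overR (hG : IsBoundaryTensor G) (μ ν : Fin 4) {x : Space} (hx : x ≠ 0) :
    ContDiffAt ℝ ∞ (fun y => overR G y μ ν) x := by
  let U : TopologicalSpace.Opens Space := ⟨{0}ᶜ, isOpen_compl_singleton⟩
  have hval : ContMDiff 𝓘(ℝ, Space) 𝓘(ℝ, Space) ∞ (fun y : U => (y : Space)) :=
    contMDiff_subtype_val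
  have hn : ∀ y : U, ‖(y : Space)‖ ≠ 0 := fun y => norm_ne_zero_iff.2 y.2
  have hinv : ContMDiff 𝓘(ℝ, Space) 𝓘(ℝ, ℝ) ∞ (fun y : U => ‖(y : Space)‖⁻¹) := fun y =>
    contMDiffAt_subtype_iff.2
      ((contDiffAt_norm ℝ (y.2 : (y : Space) ≠ 0)).inv (hn y)).contMDiffAt
  have hdir : ContMDiff 𝓘(ℝ, Space) 𝓘(ℝ, Space) ∞ (fun y : U => ‖(y : Space)‖⁻¹ • (y : Space)) :=
    hinv.smul hval
  have hmem : ∀ y : U, ‖(y : Space)‖⁻¹ • (y : Space) ∈ Metric.sphere (0 : Space) 1 := fun y => by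
    rw [mem_sphere_zero_iff_norm, norm_smul, norm_inv, norm_norm, inv_mul_cancel₀ (hn y)]
  have := Fact.mk (@finrank_euclideanSpace_fin ℝ _ (2 + 1))
  have hcomp := (hG.smooth μ ν).comp (hdir.codRestrict_sphere (n := 2) hmem)
  have hprod := hinv.mul hcomp
  have h1 : ContMDiffAt 𝓘(ℝ, Space) 𝓘(ℝ, ℝ) ∞ (fun y : U => overR G y μ ν) ⟨x, hx⟩ := by
    refine (hprod ⟨x, hx⟩).congr_of_eventuallyEq (Eventually.of_forall fun y => ?_)
    have hy : (y : Space) ≠ 0 := y.2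
    simp only [overR, dif_pos hy]
    rfl
  exact (contMDiffAt_subtype_iff (x := (⟨x, hx⟩ : U))).1 h1 |>.contDiffAt

theorem overR_smul (G : Sphere → Matrix (Fin 4) (Fin 4) ℝ) {c : ℝ} (hc : 0 < c) {x : Space}
    (hx : x ≠ 0) : overR G (c • x) = c⁻¹ • overR G x := by
  have hcx : c • x ≠ 0 := smul_ne_zero hc.ne' hx
  have hdir : ‖c • x‖⁻¹ • c • x = ‖x‖⁻¹ • x := by
    rw [norm_smul, Real.norm_of_nonneg hc.le, smul_smul]
    congr 1
    field_simp
  simp only [overR, dif_pos hx, dif_pos hcx, hdir]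
  simp only [smul_smul, norm_smul, Real.norm_of_nonneg hc.le, mul_inv]

theorem isHomog_overR (hG : IsBoundaryTensor G) (μ ν : Fin 4) :
    IsHomog (-1) fun p => stationary (overR G) p μ ν := by
  have hne : ∀ p, rad p ≠ 0 → toSpace p ≠ 0 := fun p hp => by
    rwa [← norm_ne_zero_iff, norm_toSpace]
  have hst : ∀ p, stationary (overR G) p = overR G (toSpace p) := fun p => by
    rw [toSpace_apply]; rfl
  refine ⟨fun p hp => ?_, fun c hc p hp => ?_, fun p s => ?_⟩
  · simp only [hst]
    exact (contDiffAt_overR hG μ ν (hne p hp)).comp p toSpace.contDiff.contDiffAt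
  · simp only [hst, map_smul, overR_smul G hc (hne p hp), Matrix.smul_apply, zpow_neg, zpow_one]
  · simp [stationary]

theorem isSymm_overR (hG : IsBoundaryTensor G) (p : Pt) : (stationary (overR G) p).IsSymm := by
  unfold stationary overR
  split_ifs
  · exact (hG.symm _).smul _
  · exact Matrix.isSymm_zero

/-! ### The decay of the imaginary part of the middle Weyl scalar -/

theorem sum_area_pd {w : Fin 4 → Pt → ℝ} {p : Pt} (hp : rad p ≠ 0) :
    ∑ j, ∑ l, area p j l * pd j (w l) p = radial (curl w) p / rad p := by
  simp [Fin.sum_univ_four, area, dr, radial, curl]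
  field_simp
  ring

/-- For the leading part of a linearized vacuum perturbation the imaginary part of the middle
linearized Weyl scalar gains one power of `r`. -/
theorem isSymbol_im_varPsi0 (κ M a : ℝ) {h : Bilin} (hh : ∀ μ ν, IsHomog (-1) fun p => h p μ ν)
    (hs : ∀ p, (h p).IsSymm) (hR : ∀ p, rad p ≠ 0 → ∀ μ ν, linRicci mink h p μ ν = 0) :
    IsSymbol 1 (-1 - 3) fun p => (varPsi0 κ M a h p).im := by
  have hA : ∀ μ ν, Asy 3 1 (-1) (fun p => h p μ ν) fun p => h p μ ν := fun μ ν =>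
    Asy.refl (by simpa using (hh μ ν).isSymbol 3) 1
  have hd := ((asy_varPsi0 M a κ (n := 1) zero_le_one le_rfl hA).diff).im
  refine (hd.mono (by norm_num)).congr ?_
  filter_upwards [eventually_rad_gt 0, eventually_cyl_ne] with p hp hc
  have h0 := im_flat_varPsi hh hs hp.ne' hc
  rw [sum_area_pd hp.ne', radial_curl_eq_zero (isHomog_timeSpace hh)
    (fun q hq i => curl_curl_timeSpace hh hq (hR q hq) i) hp.ne'] at h0
  set S := ∑ s : Equiv.Perm (Fin 4), spinContr (hess mink h) frame₀ (![0, 0, 1, 1] ∘ s) p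
  have h1 : ((1 / 2 : ℂ) * ((1 / 24) * S)).im = 0 := by
    rw [show (1 / 2 : ℂ) * ((1 / 24) * S) = ((1 / 48 : ℝ) : ℂ) * S by push_cast; ring,
      Complex.im_ofReal_mul, h0]
    simp
  rw [Complex.sub_im, h1, sub_zero]

end

end KerrDecay

end

theorem mainTheorem9 (M a : ℝ) (ha : |a| < M) (κ : ℝ) (hκ : κ = 1 / 4 ∨ κ = -1 / 4) :
    (∀ G : KerrDecay.Sphere → Matrix (Fin 4) (Fin 4) ℝ, KerrDecay.IsBoundaryTensor G →
      (KerrDecay.Izeta κ M a (KerrDecay.stationary (KerrDecay.overR G))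
          =O[KerrDecay.atInfinity] KerrDecay.rad) ∧
      ((∃ δ : ℝ, 0 < δ ∧ ∃ K : KerrDecay.Coeff, KerrDecay.DecaysLike (1 + δ) K ∧
          KerrDecay.IsLinVacuum M a (fun x => KerrDecay.overR G x + K x)) →
        (fun p => (KerrDecay.Izeta κ M a (KerrDecay.stationary (KerrDecay.overR G)) p).re)
          =O[KerrDecay.atInfinity] fun _ => (1 : ℝ))) ∧
    (∀ ε : ℝ, 0 < ε → ∀ H : KerrDecay.Coeff, KerrDecay.DecaysLike (1 + ε) H →
      KerrDecay.Izeta κ M a (KerrDecay.stationary H)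
        =O[KerrDecay.atInfinity] fun p => KerrDecay.rad p ^ (1 - ε)) := by
  have key : ∀ {E : Type} [NormedAddCommGroup E] {f : KerrDecay.Pt → E} {q q' : ℝ},
      f =O[KerrDecay.atInfinity] (fun p => KerrDecay.rad p ^ q) → q = q' →
      f =O[KerrDecay.atInfinity] fun p => KerrDecay.rad p ^ q' := fun h hq => hq ▸ h
  refine ⟨fun G hG => ?_, fun ε _ H hH => ?_⟩
  · have hh := KerrDecay.isHomog_overR hG
    have hs : ∀ μ ν, KerrDecay.IsSymbol 3 (-1)
        fun p => KerrDecay.stationary (KerrDecay.overR G) p μ ν := fun μ ν => by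
      simpa using (hh μ ν).isSymbol 3
    refine ⟨?_, ?_⟩
    · simpa using key (KerrDecay.Izeta_isBigO κ M a hs) (by norm_num : (-1 + 2 : ℝ) = 1)
    · rintro ⟨δ, hδ, K, hK, hvac⟩
      have hR := fun p (hp : KerrDecay.rad p ≠ 0) => KerrDecay.linRicci_mink_eq_zero M a hδ hh
        (fun μ ν => (hK.isSymbol μ ν).of_le (by norm_num)) hvac hp
      have him := KerrDecay.isSymbol_im_varPsi0 κ M a hh (KerrDecay.isSymm_overR hG) hR
      simpa using key (KerrDecay.re_Izeta_isBigO κ M a hs him) (by norm_num : (-1 + 1 : ℝ) = 0)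
  · exact key (KerrDecay.Izeta_isBigO κ M a hH.isSymbol) (by ring)
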